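/- Fix a uniform prior on a state $\theta\in\{0,1\}$. Finite game $\Gamma_n$. A count $K\in\{0,\dots,n\}$ of high signals is observed. Given $\theta$ and a local precision $c\in[0,\sqrt n/2]$, put $\pi=\tfrac12+c/\sqrt n$; then $K\sim\mathrm{Bin}(n,\pi)$ if $\theta=1$ and $K\sim\mathrm{Bin}(n,1-\pi)$ if $\theta=0$. Nature chooses a probability measure $\gamma_n$ on $[0,\sqrt n/2]$ to maximize, and the decision-maker chooses $a_n=(a_{n,0},\dots,a_{n,n})\in[0,1]^{n+1}$ to minimize, the ex-ante regret $$R_n(a_n,\gamma_n)=\mathbb E_{c\sim\gamma_n}\sum_{k=0}^n \Pr(k\mid c)\,\bigl(\Pr(\theta=1\mid k,c)-a_{n,k}\bigr)^2 .$$ Limit game $\tilde\Gamma$. A signal $Z$ is observed with $Z\mid\theta,c\sim\mathcal N(2c,1)$ if $\theta=1$ and $\mathcal N(-2c,1)$ if $\theta=0$. Nature chooses a probability measure $\gamma$ on $[0,\infty)$ to maximize, and the decision-maker chooses a non-decreasing $a:\mathbb R\to[0,1]$ to minimize, $$\tilde R(a,\gamma)=\mathbb E_{c\sim\gamma}\int_{\mathbb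 R} \tfrac12\bigl(\phi(z-2c)+\phi(z+2c)\bigr)\bigl(\Pr(\theta=1\mid z,c)-a(z)\bigr)^2\,dz ,$$ where $\phi$ is the standard normal density. Claim. The limit game $\tilde\Gamma$ has a Nash equilibrium (saddle point) $(a^*,\gamma^*)$ such that for every sequence $(a_n^*,\gamma_n^*)$ of Nash equilibria of the games $\Gamma_n$, as $n\to\infty$: 1. (Non-vanishing regret) $R_n(a_n^*,\gamma_n^*)\to\tilde R(a^*,\gamma^*)>0$. 2. (Failure of asymptotic learning) Under equilibrium play ($\theta$ uniform, $c\sim\gamma_n^*$ independent of $\theta$) the posterior $a^*_{n,K}$ does not converge to $\theta$ in probability: there are $\varepsilon,\delta>0$ such that $\Pr(|a^*_{n,K}-\theta|\ge\varepsilon)\ge\delta$ for all large $n$. Instead, $(\theta,a^*_{n,K})$ converges in distribution to $(\theta,a^*(Z))$, where $\theta$ is uniform, $c\sim\gamma^*$ is independent of $\theta$, and $Z\mid\theta,c\sim\mathcal N(\pm 2c,1)$ as above. The random variable $a^*(Z)$ is non-degenerate (not almost surely constant) and satisfies $0<a^*(Z)<1$ almost surely. -/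

import Mathlib

open MeasureTheory ProbabilityTheory Filter Topology

noncomputable section

namespace RobustLearning

/-- The numerical value of the state: `true` is `θ = 1`, `false` is `θ = 0`. -/
def stateValue (θ : Bool) : ℝ := if θ then 1 else 0

/-! ### The finite game with `n` symmetric binary signals -/

/-- Nature's mixed strategies in the finite game: Borel probability measures on the interval
`[0, √n / 2]` of local precision parameters `c = √n (π - 1/2)`. -/
abbrev NatureStrategy (n : ℕ) : Type := ProbabilityMeasure (Set.Icc (0 : ℝ) (√(n : ℝ) / 2))

/-- The precision `π = 1/2 + c / √n` with local parameter `c`. -/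
def precision (n : ℕ) (c : ℝ) : ℝ := 1 / 2 + c / √(n : ℝ)

/-- Probability of a high signal in state `θ`: it is `π` if `θ = 1` and `1 - π` if `θ = 0`. -/
def highProb (n : ℕ) (θ : Bool) (c : ℝ) : ℝ :=
  if θ then precision n c else 1 - precision n c

/-- Probability of exactly `k` high signals among `n`, given the state `θ` and the parameter `c`. -/
def countProb (n : ℕ) (θ : Bool) (c : ℝ) (k : Fin (n + 1)) : ℝ :=
  (n.choose k : ℝ) * highProb n θ c ^ (k : ℕ) * (1 - highProb n θ c) ^ (n - (k : ℕ))

/-- `Pr(k | c)`, the probability of `k` high signals under the uniform prior on the state. -/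
def marginalProb (n : ℕ) (c : ℝ) (k : Fin (n + 1)) : ℝ :=
  (countProb n true c k + countProb n false c k) / 2

/-- `Pr(θ = 1 | k, c)`, the posterior of the oracle, who knows `c`. (At counts of probability zero
the value is immaterial, since it is weighted by `marginalProb n c k = 0` below.) -/
def oracle (n : ℕ) (c : ℝ) (k : Fin (n + 1)) : ℝ :=
  countProb n true c k / 2 / marginalProb n c k

/-- Ex-ante mean-squared-error regret of the belief rule `a` when the parameter is `c`. -/
def regretAt (n : ℕ) (a : Fin (n + 1) → ℝ) (c : ℝ) : ℝ :=
  ∑ k, marginalProb n c k * (oracle n c k - a k) ^ 2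

/-- Ex-ante regret `R_n(a, γ)` against Nature's mixed strategy `γ`. -/
def regret (n : ℕ) (a : Fin (n + 1) → ℝ) (γ : NatureStrategy n) : ℝ :=
  ∫ c, regretAt n a c ∂(γ : Measure (Set.Icc (0 : ℝ) (√(n : ℝ) / 2)))

/-- Nash equilibria (saddle points) of the finite zero-sum game: the decision-maker chooses
beliefs in `[0,1]` to minimize the regret, Nature chooses `γ` to maximize it. -/
structure IsEquilibrium (n : ℕ) (a : Fin (n + 1) → ℝ) (γ : NatureStrategy n) : Prop where
  mem_unit : ∀ k, a k ∈ Set.Icc (0 : ℝ) 1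
  nature_optimal : ∀ γ' : NatureStrategy n, regret n a γ' ≤ regret n a γ
  dm_optimal : ∀ a' : Fin (n + 1) → ℝ, (∀ k, a' k ∈ Set.Icc (0 : ℝ) 1) →
    regret n a γ ≤ regret n a' γ

/-- The joint law of the state `θ` and the number `K` of high signals when `θ` is uniform, Nature
draws `c` from `γ` independently of `θ`, and `n` conditionally i.i.d. signals are drawn. -/
def playLaw (n : ℕ) (γ : NatureStrategy n) : Measure (Bool × Fin (n + 1)) :=
  ∑ θ : Bool, ∑ k : Fin (n + 1),
    (∫⁻ c, ENNReal.ofReal (countProb n θ c k / 2) ∂(γ : Measure (Set.Icc (0 : ℝ) (√(n : ℝ) / 2)))) •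
      Measure.dirac (θ, k)

/-! ### The limit game -/

/-- Nature's mixed strategies in the limit game: Borel probability measures on `[0, ∞)`. -/
abbrev LimitNatureStrategy : Type := ProbabilityMeasure (Set.Ici (0 : ℝ))

/-- The mean of the Gaussian signal: `2c` in state `1` and `-2c` in state `0`. -/
def signalMean (θ : Bool) (c : ℝ) : ℝ := if θ then 2 * c else -(2 * c)

/-- The density of the signal at `z` under the uniform prior on the state, given `c`. -/
def limitMarginal (c z : ℝ) : ℝ :=
  (gaussianPDFReal (signalMean true c) 1 z + gaussianPDFReal (signalMean false c) 1 z) / 2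

/-- `Pr(θ = 1 | z, c)`, the oracle's posterior in the Gaussian experiment. -/
def limitOracle (c z : ℝ) : ℝ :=
  gaussianPDFReal (signalMean true c) 1 z / 2 / limitMarginal c z

/-- The limit regret of the belief rule `a` when the parameter is `c`. -/
def limitRegretAt (a : ℝ → ℝ) (c : ℝ) : ℝ :=
  ∫ z, limitMarginal c z * (limitOracle c z - a z) ^ 2

/-- The limit regret against Nature's mixed strategy `γ`. -/
def limitRegret (a : ℝ → ℝ) (γ : LimitNatureStrategy) : ℝ :=
  ∫ c, limitRegretAt a c ∂(γ : Measure (Set.Ici (0 : ℝ)))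

/-- The decision-maker's strategies in the limit game: monotone maps from `ℝ` to `[0,1]`. -/
def IsLimitRule (a : ℝ → ℝ) : Prop := Monotone a ∧ ∀ z, a z ∈ Set.Icc (0 : ℝ) 1

/-- Nash equilibria (saddle points) of the zero-sum limit game. -/
structure IsLimitEquilibrium (a : ℝ → ℝ) (γ : LimitNatureStrategy) : Prop where
  isLimitRule : IsLimitRule a
  nature_optimal : ∀ γ' : LimitNatureStrategy, limitRegret a γ' ≤ limitRegret a γ
  dm_optimal : ∀ a' : ℝ → ℝ, IsLimitRule a' → limitRegret a γ ≤ limitRegret a' γ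

/-- The law of `(θ, c, W)` with `θ` uniform on the two states, `c` drawn from `γ` and `W` standard
normal, all independent. -/
def limitPlayLaw (γ : LimitNatureStrategy) : Measure (Bool × Set.Ici (0 : ℝ) × ℝ) :=
  (PMF.uniformOfFintype Bool).toMeasure.prod
    ((γ : Measure (Set.Ici (0 : ℝ))).prod (gaussianReal 0 1))

/-- The signal `Z` of the limit experiment: conditionally on `θ` and `c` it is normal with mean
`signalMean θ c` and variance one. -/
def limitSignal (ω : Bool × Set.Ici (0 : ℝ) × ℝ) : ℝ := signalMean ω.1 ω.2.1 + ω.2.2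

/-! ### The laws of play are probability measures -/

lemma precision_mem (n : ℕ) (c : Set.Icc (0 : ℝ) (√(n : ℝ) / 2)) :
    0 ≤ precision n c ∧ precision n c ≤ 1 := by
  have h0 := c.2.1
  have h1 := c.2.2
  have hs := Real.sqrt_nonneg (n : ℝ)
  have h2 : 0 ≤ (c : ℝ) / √(n : ℝ) := div_nonneg h0 hs
  have h3 : (c : ℝ) / √(n : ℝ) ≤ 1 / 2 := div_le_of_le_mul₀ hs (by norm_num) (by linarith)
  unfold precision
  constructor <;> linarith

lemma highProb_mem (n : ℕ) (θ : Bool) (c : Set.Icc (0 : ℝ) (√(n : ℝ) / 2)) :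
    0 ≤ highProb n θ c ∧ highProb n θ c ≤ 1 := by
  have := precision_mem n c
  cases θ <;> simp [highProb, this.1, this.2]

lemma countProb_nonneg (n : ℕ) (θ : Bool) (c : Set.Icc (0 : ℝ) (√(n : ℝ) / 2))
    (k : Fin (n + 1)) : 0 ≤ countProb n θ c k := by
  have h := highProb_mem n θ c
  have h' : 0 ≤ 1 - highProb n θ c := by linarith [h.2]
  have h0 := h.1
  unfold countProb
  positivity

lemma sum_countProb (n : ℕ) (θ : Bool) (c : ℝ) : ∑ k, countProb n θ c k = 1 := by
  have h := add_pow (highProb n θ c) (1 - highProb n θ c) n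
  rw [add_sub_cancel, one_pow, ← Fin.sum_univ_eq_sum_range
    (fun m => highProb n θ c ^ m * (1 - highProb n θ c) ^ (n - m) * (n.choose m : ℝ))] at h
  rw [h]
  refine Finset.sum_congr rfl fun k _ => ?_
  unfold countProb
  ring

lemma measurable_countProb (n : ℕ) (θ : Bool) (k : Fin (n + 1)) :
    Measurable fun c : Set.Icc (0 : ℝ) (√(n : ℝ) / 2) => countProb n θ c k := by
  cases θ <;>
    simp only [countProb, highProb, precision, if_true, Bool.false_eq_true, if_false] <;> fun_prop

instance isProbabilityMeasure_playLaw (n : ℕ) (γ : NatureStrategy n) :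
    IsProbabilityMeasure (playLaw n γ) := by
  constructor
  have key : ∀ θ : Bool, ∑ k : Fin (n + 1), ∫⁻ c, ENNReal.ofReal (countProb n θ c k / 2)
      ∂(γ : Measure (Set.Icc (0 : ℝ) (√(n : ℝ) / 2))) = ENNReal.ofReal (1 / 2) := by
    intro θ
    rw [← lintegral_finsetSum _ fun k _ => ((measurable_countProb n θ k).div_const 2).ennreal_ofReal]
    have : ∀ c : Set.Icc (0 : ℝ) (√(n : ℝ) / 2),
        ∑ k, ENNReal.ofReal (countProb n θ c k / 2) = ENNReal.ofReal (1 / 2) := by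
      intro c
      rw [← ENNReal.ofReal_sum_of_nonneg fun k _ => div_nonneg (countProb_nonneg n θ c k) zero_le_two,
        ← Finset.sum_div, sum_countProb]
    simp [this]
  simp only [playLaw, Measure.coe_finsetSum, Finset.sum_apply, Measure.smul_apply, measure_univ,
    smul_eq_mul, mul_one, key]
  rw [Finset.sum_const, Finset.card_univ, Fintype.card_bool, nsmul_eq_mul,
    ← ENNReal.ofReal_natCast, ← ENNReal.ofReal_mul (by positivity)]
  norm_num

instance isProbabilityMeasure_limitPlayLaw (γ : LimitNatureStrategy) : IsProbabilityMeasure (limitPlayLaw γ) := by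
  unfold limitPlayLaw
  infer_instance

end RobustLearning

end

noncomputable section

namespace RobustLearning

/-! ### Integration against the standard Gaussian -/

/-! Put `x = 2c`, so that the limit signal has mean `± x`. The regret of a rule is its Brier loss
minus that of the oracle. The candidate equilibrium pairs a prior with mass `w` at `0` and `1 - w`
at some `x > 0` with its posterior `bayesRule w x`.

Shape of the regret. By symmetry of this reply, its regret at `y` has derivative `exp (-y²/2)` times
`regretDrift`, which is half of `lossSpeed` minus `replySpeed`. Gaussian integration by parts shows
that `lossSpeed` is concave on `[0, ∞)`, and `replySpeed` is a nonnegative mixture of exponentials,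
hence convex. So the drift is concave, and it is negative at `0`: the regret falls, rises at most
once and then falls again. If it takes equal values at `0` and at a critical point `x > 0`, these
are its only maximisers (`gaussRegret_lt_of_critical`).

Existence. The Bayes regret `bayesRegret w x` attains its maximum at an interior point, because it
vanishes for `w = 0`, `w = 1`, `x = 0` and as `x → ∞`. An envelope argument gives exactly the two
conditions above (`exists_isSaddle`), hence a saddle point with value `v > 0`.

Finite games. A central limit theorem, uniform for local parameters near a given one, shows that the
regret of the limit rule applied to the normalised count converges to the limit regret; exponential
moments control large `c`. The decision-maker can therefore hold the value to `v + o(1)`. Nature can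
use the two-point prior, whose finite Bayes risk tends to `v`. Hence the values converge
(`IsSaddle.tendsto_value`).

Equilibrium play. Against Nature's equilibrium strategies the limit rule earns regret tending to
`v`, but it earns strictly less away from `{0, x/2}`, so these strategies concentrate there. A limit
`w'` of the weights near `0` must satisfy `v ≤ bayesRegret w' x`, and strict convexity of squared
loss forces `w' = w`. The parallelogram identity brings the equilibrium rule close to the limit rule
in mean square. The law of play therefore converges, and its limit puts the posterior strictly
between `0` and `1`, which excludes learning. -/

/-- The standard Gaussian measure on the line. -/
abbrev gauss : Measure ℝ := gaussianReal 0 1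

lemma integral_gauss (f : ℝ → ℝ) : ∫ z, f z ∂gauss = ∫ z, gaussianPDFReal 0 1 z * f z := by
  rw [integral_gaussianReal_eq_integral_smul one_ne_zero]; rfl

lemma integrable_gauss_iff (f : ℝ → ℝ) :
    Integrable f gauss ↔ Integrable (fun z => gaussianPDFReal 0 1 z * f z) := by
  rw [gauss, gaussianReal_of_var_ne_zero _ one_ne_zero,
    integrable_withDensity_iff_integrable_smul' (measurable_gaussianPDF _ _)
      (ae_of_all _ fun _ => gaussianPDF_lt_top)]
  simp

lemma gaussianPDFReal_zero_one (z : ℝ) :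
    gaussianPDFReal 0 1 z = (√(2 * Real.pi))⁻¹ * Real.exp (-z ^ 2 / 2) := by
  simp [gaussianPDFReal]

lemma gaussianPDFReal_shift (x z : ℝ) :
    gaussianPDFReal x 1 z = gaussianPDFReal 0 1 z * Real.exp (x * z - x ^ 2 / 2) := by
  simp only [gaussianPDFReal, NNReal.coe_one, mul_one, sub_zero]
  rw [mul_assoc, ← Real.exp_add]
  ring_nf

/-- The exponential is the density of `N(x, 1)` relative to `N(0, 1)`; completing the square turns
reweighting into translation. -/
lemma integral_gauss_tilt (x : ℝ) (f : ℝ → ℝ) :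
    ∫ z, Real.exp (x * z - x ^ 2 / 2) * f z ∂gauss = ∫ z, f (x + z) ∂gauss := by
  rw [integral_gauss, integral_gauss,
    ← integral_add_left_eq_self (fun z => gaussianPDFReal 0 1 z * (Real.exp (x * z - x ^ 2 / 2) * f z)) x]
  refine integral_congr_ae (ae_of_all _ fun z => ?_)
  dsimp only
  rw [← mul_assoc, gaussianPDFReal_zero_one, gaussianPDFReal_zero_one, mul_assoc (√(2 * Real.pi))⁻¹,
    ← Real.exp_add, show -(x + z) ^ 2 / 2 + (x * (x + z) - x ^ 2 / 2) = -z ^ 2 / 2 by ring]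

lemma integrable_gauss_of_bounded {f : ℝ → ℝ} (hf : Measurable f) {C : ℝ} (h : ∀ z, |f z| ≤ C) :
    Integrable f gauss :=
  Integrable.of_bound hf.aestronglyMeasurable C (ae_of_all _ h)

lemma integrable_sq_gauss : Integrable (fun z : ℝ => 1 + z ^ 2) gauss := by
  refine (integrable_const _).add ?_
  have := (memLp_id_gaussianReal (μ := 0) (v := 1) 2).integrable_sq
  simpa using this

lemma integrable_gauss_of_sq_bound {f : ℝ → ℝ} (hf : Measurable f) {C : ℝ}
    (h : ∀ z, |f z| ≤ C * (1 + z ^ 2)) : Integrable f gauss :=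
  (integrable_sq_gauss.const_mul C).mono' hf.aestronglyMeasurable (ae_of_all _ h)

lemma abs_le_one_add_sq (z : ℝ) : |z| ≤ 1 + z ^ 2 := by
  rw [← sq_abs]; nlinarith [sq_nonneg (|z| - 1), abs_nonneg z]

lemma integrable_exp_abs_gauss (t : ℝ) : Integrable (fun z => Real.exp (t * |z|)) gauss := by
  refine ((integrable_exp_mul_gaussianReal (μ := 0) (v := 1) t).add
    (integrable_exp_mul_gaussianReal (μ := 0) (v := 1) (-t))).mono'
    (by fun_prop) (ae_of_all _ fun z => ?_)
  simp only [Pi.add_apply, Real.norm_eq_abs, Real.abs_exp]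
  rcases abs_cases z with ⟨h, _⟩ | ⟨h, _⟩ <;> rw [h]
  · linarith [Real.exp_pos (-t * z)]
  · rw [mul_neg, ← neg_mul]; linarith [Real.exp_pos (t * z)]

/-- Gaussian integration by parts. -/
lemma stein {f f' : ℝ → ℝ} (hd : ∀ z, HasDerivAt f (f' z) z) (hf : Integrable f gauss)
    (hzf : Integrable (fun z => z * f z) gauss) (hf' : Integrable f' gauss) :
    ∫ z, z * f z ∂gauss = ∫ z, f' z ∂gauss := by
  have hφ : ∀ z, HasDerivAt (gaussianPDFReal 0 1) (-z * gaussianPDFReal 0 1 z) z := by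
    intro z
    have h : HasDerivAt (fun z : ℝ => (√(2 * Real.pi))⁻¹ * Real.exp (-z ^ 2 / 2))
        ((√(2 * Real.pi))⁻¹ * (Real.exp (-z ^ 2 / 2) * (-(2 * z) / 2))) z := by
      refine (HasDerivAt.exp ?_).const_mul _
      simpa using ((hasDerivAt_pow 2 z).neg).div_const 2
    rw [show gaussianPDFReal 0 1 = fun z : ℝ => (√(2 * Real.pi))⁻¹ * Real.exp (-z ^ 2 / 2) from
      funext gaussianPDFReal_zero_one]
    exact h.congr_deriv (by ring)
  -- With `φ' = -z φ` the integrand is the derivative of `φ f`, and an integrable function with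
  -- integrable derivative has derivative of integral zero.
  have key : ∫ z, (gaussianPDFReal 0 1 z * f' z - gaussianPDFReal 0 1 z * (z * f z)) = 0 := by
    refine integral_eq_zero_of_hasDerivAt_of_integrable
      (f := fun z => gaussianPDFReal 0 1 z * f z) (fun z => ?_) ?_ ?_
    · exact ((hφ z).mul (hd z)).congr_deriv (by ring)
    · exact ((integrable_gauss_iff _).1 hf').sub ((integrable_gauss_iff _).1 hzf)
    · exact (integrable_gauss_iff _).1 hf
  rw [integral_sub ((integrable_gauss_iff _).1 hf') ((integrable_gauss_iff _).1 hzf)] at key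
  rw [integral_gauss, integral_gauss]
  linarith

/-- A quadratic bound on the derivative suffices for domination because the Gaussian has a second
moment. -/
lemma hasDerivAt_integral_gauss {F F' : ℝ → ℝ → ℝ} (hF : ∀ x, Integrable (F x) gauss)
    (hF' : ∀ x, Measurable (F' x)) (hd : ∀ x z, HasDerivAt (fun x => F x z) (F' x z) x) {C : ℝ}
    (hC : ∀ x z, |F' x z| ≤ C * (1 + z ^ 2)) (x : ℝ) :
    HasDerivAt (fun x => ∫ z, F x z ∂gauss) (∫ z, F' x z ∂gauss) x :=
  (hasDerivAt_integral_of_dominated_loc_of_deriv_le (s := Set.univ) Filter.univ_mem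
    (Eventually.of_forall fun x => (hF x).aestronglyMeasurable) (hF x)
    (hF' x).aestronglyMeasurable (ae_of_all _ fun z x _ => hC x z)
    (integrable_sq_gauss.const_mul C) (ae_of_all _ fun z x _ => hd x z)).2

/-- The origin is exempted because an uninformative realisation `z = 0` makes all the posteriors
agree; a single point is Gaussian-null. -/
lemma integral_gauss_pos {f : ℝ → ℝ} (hf : Integrable f gauss) (hpos : ∀ z, z ≠ 0 → 0 < f z)
    (h0 : 0 ≤ f 0) : 0 < ∫ z, f z ∂gauss := by
  rw [integral_pos_iff_support_of_nonneg (fun z => ?_) hf]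
  · have h1 : gauss {0}ᶜ = 1 := by
      rw [prob_compl_eq_one_iff (measurableSet_singleton _)]
      have := nullSingletonClass_gaussianReal (μ := 0) (v := 1) one_ne_zero
      exact measure_singleton 0
    have h2 : ({0}ᶜ : Set ℝ) ⊆ Function.support f := fun z hz => (hpos z hz).ne'
    exact lt_of_lt_of_le (by rw [h1]; exact one_pos) (measure_mono h2)
  · by_cases hz : z = 0
    · rw [hz]; exact h0
    · exact (hpos z hz).le

/-! ### The oracle's Brier loss and its derivative -/

/-- The hyperbolic secant. -/
def sech (y : ℝ) : ℝ := (Real.cosh y)⁻¹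

lemma sech_pos (y : ℝ) : 0 < sech y := inv_pos.2 (Real.cosh_pos y)

lemma sech_le_one (y : ℝ) : sech y ≤ 1 := inv_le_one_of_one_le₀ (Real.one_le_cosh y)

@[fun_prop]
lemma continuous_sech : Continuous sech :=
  Real.continuous_cosh.inv₀ fun y => (Real.cosh_pos y).ne'

@[fun_prop]
lemma measurable_sech : Measurable sech := continuous_sech.measurable

lemma abs_tanh_le_one (y : ℝ) : |Real.tanh y| ≤ 1 := (Real.abs_tanh_lt_one y).le

lemma hasDerivAt_sech (y : ℝ) : HasDerivAt sech (-Real.tanh y * sech y) y := by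
  refine ((Real.hasDerivAt_cosh y).inv (Real.cosh_pos y).ne').congr_deriv ?_
  have := (Real.cosh_pos y).ne'
  rw [Real.tanh_eq_sinh_div_cosh, sech]
  field_simp

lemma tanh_sq (y : ℝ) : Real.tanh y ^ 2 = 1 - sech y ^ 2 := by
  have := (Real.cosh_pos y).ne'
  rw [Real.tanh_eq_sinh_div_cosh, sech]
  field_simp
  linarith [Real.cosh_sq y]

lemma hasDerivAt_tanh' (y : ℝ) : HasDerivAt Real.tanh (sech y ^ 2) y := by
  have h := (Real.hasDerivAt_sinh y).div (Real.hasDerivAt_cosh y) (Real.cosh_pos y).ne'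
  have e : Real.tanh = fun y => Real.sinh y / Real.cosh y := funext Real.tanh_eq_sinh_div_cosh
  rw [e]
  refine h.congr_deriv ?_
  rw [sech, inv_pow, div_eq_iff (pow_ne_zero 2 (Real.cosh_pos y).ne'),
    inv_mul_cancel₀ (pow_ne_zero 2 (Real.cosh_pos y).ne')]
  linarith [Real.cosh_sq y]

/-- The Brier loss of the oracle at signal-to-noise parameter `x`. -/
def oracleLoss (x : ℝ) : ℝ := 1 / 4 * Real.exp (-x ^ 2 / 2) * ∫ z, sech (x * z) ∂gauss

/-- The normalised speed of decrease of the oracle's loss. -/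
def lossSpeed (x : ℝ) : ℝ := x * ∫ z, sech (x * z) ^ 3 ∂gauss

@[fun_prop]
lemma measurable_tanh : Measurable Real.tanh := by
  rw [show Real.tanh = fun y => Real.sinh y / Real.cosh y from funext Real.tanh_eq_sinh_div_cosh]
  fun_prop

lemma abs_mul_le_of_abs_le_one {b c : ℝ} (hb : |b| ≤ 1) : |b * c| ≤ |c| := by
  rw [abs_mul]; exact mul_le_of_le_one_left (abs_nonneg _) hb

lemma abs_sech (y : ℝ) : |sech y| ≤ 1 := by rw [abs_of_pos (sech_pos y)]; exact sech_le_one y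

lemma abs_mul_le_one {b c : ℝ} (hb : |b| ≤ 1) (hc : |c| ≤ 1) : |b * c| ≤ 1 :=
  (abs_mul_le_of_abs_le_one hb).trans hc

lemma abs_sech_pow (y : ℝ) (k : ℕ) : |sech y ^ k| ≤ 1 := by
  rw [abs_pow]; exact pow_le_one₀ (abs_nonneg _) (abs_sech y)

/-- Differentiation under the integral produces a factor `z`, which integration by parts removes,
since `-tanh · sech` has derivative `sech - 2 sech³`. The `sech` term then cancels the derivative of
the Gaussian prefactor and only `sech³` survives. -/
lemma hasDerivAt_oracleLoss (x : ℝ) :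
    HasDerivAt oracleLoss (-(1 / 2) * Real.exp (-x ^ 2 / 2) * lossSpeed x) x := by
  have h1 : HasDerivAt (fun x => ∫ z, sech (x * z) ∂gauss)
      (∫ z, z * (-Real.tanh (x * z) * sech (x * z)) ∂gauss) x := by
    refine hasDerivAt_integral_gauss (F := fun x z => sech (x * z))
      (F' := fun x z => z * (-Real.tanh (x * z) * sech (x * z))) (C := 1)
      (fun x => integrable_gauss_of_bounded (by fun_prop) fun z => abs_sech _)
      (fun x => by fun_prop) (fun x z => ?_) (fun x z => ?_) x
    · refine ((hasDerivAt_sech (x * z)).comp x ((hasDerivAt_id x).mul_const z)).congr_deriv ?_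
      ring
    · rw [one_mul, mul_comm]
      refine (abs_mul_le_of_abs_le_one (abs_mul_le_one ?_ (abs_sech _))).trans (abs_le_one_add_sq z)
      rw [abs_neg]; exact abs_tanh_le_one _
  have h2 : ∫ z, z * (-Real.tanh (x * z) * sech (x * z)) ∂gauss
      = x * ∫ z, sech (x * z) ∂gauss - 2 * lossSpeed x := by
    have hs : ∀ z, HasDerivAt (fun z => -Real.tanh (x * z) * sech (x * z))
        (x * sech (x * z) - 2 * (x * sech (x * z) ^ 3)) z := by
      intro z
      have hl : HasDerivAt (fun z : ℝ => x * z) x z := by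
        simpa using (hasDerivAt_id z).const_mul x
      have ht := ((hasDerivAt_tanh' (x * z)).comp z hl).neg.mul ((hasDerivAt_sech (x * z)).comp z hl)
      refine ht.congr_deriv ?_
      simp only [Pi.neg_apply, Function.comp_apply]
      linear_combination (x * sech (x * z)) * tanh_sq (x * z)
    have hb : ∀ z, |(-Real.tanh (x * z) * sech (x * z))| ≤ 1 := fun z =>
      abs_mul_le_one (by rw [abs_neg]; exact abs_tanh_le_one _) (abs_sech _)
    have hi1 : Integrable (fun z => x * sech (x * z)) gauss :=
      (integrable_gauss_of_bounded (by fun_prop) fun z => abs_sech _).const_mul x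
    have hi3 : Integrable (fun z => 2 * (x * sech (x * z) ^ 3)) gauss :=
      ((integrable_gauss_of_bounded (by fun_prop) fun z => abs_sech_pow _ 3).const_mul x).const_mul 2
    rw [stein hs (integrable_gauss_of_bounded (by fun_prop) hb)
      (integrable_gauss_of_sq_bound (C := 1) (by fun_prop) fun z => by
        rw [mul_comm, one_mul]
        exact (abs_mul_le_of_abs_le_one (hb z)).trans (abs_le_one_add_sq z)) (hi1.sub hi3),
      integral_sub hi1 hi3, integral_const_mul, integral_const_mul, integral_const_mul, lossSpeed]
  rw [h2] at h1
  have h3 : HasDerivAt (fun x : ℝ => 1 / 4 * Real.exp (-x ^ 2 / 2))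
      (1 / 4 * (Real.exp (-x ^ 2 / 2) * (-(2 * x) / 2))) x := by
    refine (HasDerivAt.exp ?_).const_mul _
    simpa using ((hasDerivAt_pow 2 x).neg).div_const 2
  exact (h3.mul h1).congr_deriv (by ring)

/-- Integration by parts applied to `z * sech (x * z) ^ 3` collects the two terms of the product
rule into one integrand that is visibly decreasing in `x > 0`. -/
lemma hasDerivAt_lossSpeed (x : ℝ) :
    HasDerivAt lossSpeed (∫ z, z ^ 2 * sech (x * z) ^ 3 ∂gauss) x := by
  have hl : ∀ z, HasDerivAt (fun z : ℝ => x * z) x z := fun z => by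
    simpa using (hasDerivAt_id z).const_mul x
  have hq : ∀ y, HasDerivAt (fun y => sech y ^ 3) (-3 * Real.tanh y * sech y ^ 3) y := fun y => by
    exact ((hasDerivAt_sech y).pow 3).congr_deriv (by ring)
  have hb : ∀ y, |(-Real.tanh y * sech y ^ 3)| ≤ 1 := fun y =>
      abs_mul_le_one (by rw [abs_neg]; exact abs_tanh_le_one _) (abs_sech_pow _ _)
  have hb' : ∀ y z, |z * (-3 * Real.tanh y * sech y ^ 3)| ≤ 3 * (1 + z ^ 2) := by
    intro y z
    rw [show z * (-3 * Real.tanh y * sech y ^ 3) = 3 * ((-Real.tanh y * sech y ^ 3) * z) by ring,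
      abs_mul, abs_of_pos (by norm_num : (0 : ℝ) < 3)]
    gcongr
    exact (abs_mul_le_of_abs_le_one (hb _)).trans (abs_le_one_add_sq z)
  have h1 : HasDerivAt (fun x => ∫ z, sech (x * z) ^ 3 ∂gauss)
      (∫ z, z * (-3 * Real.tanh (x * z) * sech (x * z) ^ 3) ∂gauss) x := by
    refine hasDerivAt_integral_gauss (F := fun x z => sech (x * z) ^ 3)
      (F' := fun x z => z * (-3 * Real.tanh (x * z) * sech (x * z) ^ 3)) (C := 3)
      (fun x => integrable_gauss_of_bounded (by fun_prop) fun z => abs_sech_pow _ 3)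
      (fun x => by fun_prop) (fun x z => ?_) (fun x z => hb' _ _) x
    refine ((hq (x * z)).comp x ((hasDerivAt_id x).mul_const z)).congr_deriv ?_
    ring
  have hi0 : Integrable (fun z => sech (x * z) ^ 3) gauss :=
    integrable_gauss_of_bounded (by fun_prop) fun z => abs_sech_pow _ 3
  have hi1 : Integrable (fun z => x * (z * (-3 * Real.tanh (x * z) * sech (x * z) ^ 3))) gauss :=
    (integrable_gauss_of_sq_bound (by fun_prop) fun z => hb' _ _).const_mul x
  have h2 : ∫ z, z * (z * sech (x * z) ^ 3) ∂gauss = ∫ z, (sech (x * z) ^ 3 +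
      x * (z * (-3 * Real.tanh (x * z) * sech (x * z) ^ 3))) ∂gauss := by
    refine stein (fun z => ?_) ?_ ?_ (hi0.add hi1)
    · refine ((hasDerivAt_id z).mul ((hq (x * z)).comp z (hl z))).congr_deriv ?_
      simp only [id, Function.comp_apply]
      ring
    · refine integrable_gauss_of_sq_bound (C := 1) (by fun_prop) fun z => ?_
      rw [mul_comm, one_mul]
      exact (abs_mul_le_of_abs_le_one (abs_sech_pow _ 3)).trans (abs_le_one_add_sq z)
    · refine integrable_gauss_of_sq_bound (C := 1) (by fun_prop) fun z => ?_
      rw [← mul_assoc, mul_comm, one_mul]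
      refine (abs_mul_le_of_abs_le_one (abs_sech_pow _ 3)).trans ?_
      rw [abs_of_nonneg (mul_self_nonneg z)]
      nlinarith
  rw [integral_add hi0 hi1, integral_const_mul] at h2
  refine ((hasDerivAt_id x).mul h1).congr_deriv ?_
  simp only [id, one_mul]
  rw [← h2]
  refine integral_congr_ae (ae_of_all _ fun z => ?_)
  dsimp only
  ring

/-- The derivative averages `z ^ 2 * sech (x * z) ^ 3`, and `sech (x * z)` decreases in `x > 0` for
every `z`. -/
lemma concaveOn_lossSpeed : ConcaveOn ℝ (Set.Ici 0) lossSpeed := by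
  have hd : Differentiable ℝ lossSpeed := fun x => (hasDerivAt_lossSpeed x).differentiableAt
  refine AntitoneOn.concaveOn_of_deriv (convex_Ici 0) hd.continuous.continuousOn
    hd.differentiableOn ?_
  intro x hx y hy hxy
  rw [interior_Ici] at hx hy
  simp only [Set.mem_Ioi] at hx hy
  rw [(hasDerivAt_lossSpeed x).deriv, (hasDerivAt_lossSpeed y).deriv]
  have hi : ∀ x : ℝ, Integrable (fun z => z ^ 2 * sech (x * z) ^ 3) gauss := fun x => by
    refine integrable_gauss_of_sq_bound (C := 1) (by fun_prop) fun z => ?_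
    rw [mul_comm, one_mul]
    refine (abs_mul_le_of_abs_le_one (abs_sech_pow _ 3)).trans ?_
    rw [abs_of_nonneg (sq_nonneg z)]
    linarith
  refine integral_mono (hi y) (hi x) fun z => ?_
  have : sech (y * z) ≤ sech (x * z) := by
    refine inv_anti₀ (Real.cosh_pos _) (Real.cosh_le_cosh.2 ?_)
    rw [abs_mul, abs_mul, abs_of_pos hx, abs_of_pos hy]
    gcongr
  have h0 := (sech_pos (y * z)).le
  dsimp only
  gcongr

/-! ### The limit regret as a Gaussian integral -/

/-- The likelihood ratio of `N(x, 1)` against `N(0, 1)`. -/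
def tilt (x z : ℝ) : ℝ := Real.exp (x * z - x ^ 2 / 2)

lemma tilt_pos (x z : ℝ) : 0 < tilt x z := Real.exp_pos _

@[fun_prop]
lemma continuous_tilt (x : ℝ) : Continuous (tilt x) := by unfold tilt; fun_prop

lemma tilt_zero (z : ℝ) : tilt 0 z = 1 := by simp [tilt]

lemma integral_tilt_mul (x : ℝ) (f : ℝ → ℝ) :
    ∫ z, tilt x z * f z ∂gauss = ∫ z, f (x + z) ∂gauss := integral_gauss_tilt x f

lemma integral_gauss_neg (f : ℝ → ℝ) : ∫ z, f (-z) ∂gauss = ∫ z, f z ∂gauss := by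
  conv_rhs => rw [show gauss = gauss.map (fun z => -z) by
    rw [gaussianReal_map_neg, neg_zero]]
  exact (integral_map_equiv (μ := gauss) (MeasurableEquiv.neg ℝ) f).symm

lemma integrable_tilt (x : ℝ) : Integrable (tilt x) gauss := by
  have := (integrable_exp_mul_gaussianReal (μ := 0) (v := 1) x).mul_const (Real.exp (-x ^ 2 / 2))
  refine this.congr (ae_of_all _ fun z => ?_)
  simp only [tilt]
  rw [← Real.exp_add]
  ring_nf

lemma integrable_tilt_neg (x : ℝ) : Integrable (fun z => tilt x (-z)) gauss := by
  refine (integrable_exp_mul_gaussianReal (μ := 0) (v := 1) (-x)).mul_const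
    (Real.exp (-x ^ 2 / 2)) |>.congr (ae_of_all _ fun z => ?_)
  simp only [tilt]
  rw [← Real.exp_add]
  ring_nf

/-- The density of the signal under the uniform prior, relative to `N(0, 1)`. -/
def mix (x z : ℝ) : ℝ := (tilt x z + tilt x (-z)) / 2

/-- The posterior of state `1` when the signal has mean `± x`. -/
def posterior (x z : ℝ) : ℝ := tilt x z / 2 / mix x z

lemma mix_pos (x z : ℝ) : 0 < mix x z := by
  have := tilt_pos x z; have := tilt_pos x (-z); unfold mix; positivity

@[fun_prop]
lemma continuous_mix (x : ℝ) : Continuous (mix x) := by unfold mix; fun_prop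

@[fun_prop]
lemma measurable_mix (x : ℝ) : Measurable (mix x) := (continuous_mix x).measurable

lemma integrable_mix (x : ℝ) : Integrable (mix x) gauss :=
  ((integrable_tilt x).add (integrable_tilt_neg x)).div_const 2

@[fun_prop]
lemma continuous_posterior (x : ℝ) : Continuous (posterior x) := by
  unfold posterior
  exact ((continuous_tilt x).div_const 2).div₀ (continuous_mix x) fun z => (mix_pos x z).ne'

@[fun_prop]
lemma measurable_posterior (x : ℝ) : Measurable (posterior x) := (continuous_posterior x).measurable

lemma posterior_mem (x z : ℝ) : posterior x z ∈ Set.Icc (0 : ℝ) 1 := by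
  have h1 := tilt_pos x z
  have h2 := tilt_pos x (-z)
  refine ⟨div_nonneg (by positivity) (mix_pos x z).le, ?_⟩
  rw [posterior, div_le_one (mix_pos x z), mix]
  linarith

lemma mix_zero (z : ℝ) : mix 0 z = 1 := by simp [mix, tilt_zero]

lemma posterior_zero (z : ℝ) : posterior 0 z = 1 / 2 := by
  simp [posterior, mix_zero, tilt_zero]

/-- The regret of the rule `a` when the signal is normal with mean `± x`. -/
def gaussRegret (a : ℝ → ℝ) (x : ℝ) : ℝ := ∫ z, mix x z * (posterior x z - a z) ^ 2 ∂gauss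

lemma limitRegretAt_eq (a : ℝ → ℝ) (c : ℝ) : limitRegretAt a c = gaussRegret a (2 * c) := by
  have h1 : ∀ z, gaussianPDFReal (signalMean true c) 1 z
      = gaussianPDFReal 0 1 z * tilt (2 * c) z := fun z => by
    rw [gaussianPDFReal_shift]; simp [signalMean, tilt]
  have h2 : ∀ z, gaussianPDFReal (signalMean false c) 1 z
      = gaussianPDFReal 0 1 z * tilt (2 * c) (-z) := fun z => by
    rw [gaussianPDFReal_shift]; simp [signalMean, tilt]
  have h3 : ∀ z, limitMarginal c z = gaussianPDFReal 0 1 z * mix (2 * c) z := fun z => by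
    rw [limitMarginal, h1, h2, mix]; ring
  have h4 : ∀ z, limitOracle c z = posterior (2 * c) z := fun z => by
    have hp := gaussianPDFReal_pos 0 1 z one_ne_zero
    rw [limitOracle, h1, h3, posterior, mul_div_assoc, mul_div_mul_left _ _ hp.ne']
  rw [limitRegretAt, gaussRegret, integral_gauss]
  refine integral_congr_ae (ae_of_all _ fun z => ?_)
  dsimp only
  rw [h3, h4]; ring

lemma sq_le_one_of_mem {p q : ℝ} (hp : p ∈ Set.Icc (0 : ℝ) 1) (hq : q ∈ Set.Icc (0 : ℝ) 1) :
    (p - q) ^ 2 ≤ 1 := by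
  rw [sq_le_one_iff_abs_le_one, abs_le]
  exact ⟨by linarith [hp.1, hq.2], by linarith [hp.2, hq.1]⟩

section UnitRule

variable {a : ℝ → ℝ}

lemma abs_sq_sub_le_one (h01 : ∀ z, a z ∈ Set.Icc (0 : ℝ) 1) (x z : ℝ) :
    |(posterior x z - a z) ^ 2| ≤ 1 := by
  rw [abs_of_nonneg (sq_nonneg _)]
  exact sq_le_one_of_mem (posterior_mem x z) (h01 z)

lemma integrable_gaussRegret (ha : Measurable a) (h01 : ∀ z, a z ∈ Set.Icc (0 : ℝ) 1) (x : ℝ) :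
    Integrable (fun z => mix x z * (posterior x z - a z) ^ 2) gauss := by
  refine (integrable_mix x).mono' (by fun_prop) (ae_of_all _ fun z => ?_)
  rw [Real.norm_eq_abs, mul_comm]
  exact (abs_mul_le_of_abs_le_one (abs_sq_sub_le_one h01 x z)).trans (abs_of_pos (mix_pos x z)).le

lemma gaussRegret_nonneg (a : ℝ → ℝ) (x : ℝ) : 0 ≤ gaussRegret a x :=
  integral_nonneg fun z => mul_nonneg (mix_pos x z).le (sq_nonneg _)

/-- With `p` the posterior, `(p - t)² = p (1 - t)² + (1 - p) t² - p (1 - p)`. The last term is the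
oracle's own loss; it does not involve `t`, and multiplied by `mix` it becomes the `sech` term. -/
lemma mix_mul_sq (x z t : ℝ) : mix x z * (posterior x z - t) ^ 2 =
    tilt x z * (1 - t) ^ 2 / 2 + tilt x (-z) * t ^ 2 / 2
      - 1 / 4 * Real.exp (-x ^ 2 / 2) * sech (x * z) := by
  have h1 := tilt_pos x z
  have h2 := tilt_pos x (-z)
  have h12 : tilt x z + tilt x (-z) ≠ 0 := by positivity
  have h3 : Real.exp (-x ^ 2 / 2) * sech (x * z)
      = 2 * (tilt x z * tilt x (-z)) / (tilt x z + tilt x (-z)) := by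
    have e1 : tilt x z + tilt x (-z) = 2 * (Real.exp (-x ^ 2 / 2) * Real.cosh (x * z)) := by
      rw [Real.cosh_eq, tilt, tilt, show x * z - x ^ 2 / 2 = -x ^ 2 / 2 + x * z by ring,
        show x * -z - x ^ 2 / 2 = -x ^ 2 / 2 + -(x * z) by ring, Real.exp_add, Real.exp_add]
      ring
    have e2 : tilt x z * tilt x (-z) = Real.exp (-x ^ 2 / 2) * Real.exp (-x ^ 2 / 2) := by
      rw [tilt, tilt, ← Real.exp_add, ← Real.exp_add]; ring_nf
    have hc := Real.cosh_pos (x * z)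
    have he := Real.exp_pos (-x ^ 2 / 2)
    rw [e1, e2, sech]
    field_simp
  rw [mul_assoc, h3, posterior, mix]
  field_simp
  ring

lemma gaussRegret_eq (ha : Measurable a) (h01 : ∀ z, a z ∈ Set.Icc (0 : ℝ) 1) (x : ℝ) :
    gaussRegret a x = (∫ z, (1 - a (x + z)) ^ 2 ∂gauss) / 2 + (∫ z, a (-x + z) ^ 2 ∂gauss) / 2
      - oracleLoss x := by
  have hb : ∀ z, |a z ^ 2| ≤ 1 := fun z => by
    rw [abs_pow, abs_of_nonneg (h01 _).1]; exact pow_le_one₀ (h01 _).1 (h01 _).2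
  have hb' : ∀ z, |(1 - a z) ^ 2| ≤ 1 := fun z => by
    rw [abs_pow, abs_of_nonneg (by linarith [(h01 z).2])]
    exact pow_le_one₀ (by linarith [(h01 z).2]) (by linarith [(h01 z).1])
  have i1 : Integrable (fun z => tilt x z * (1 - a z) ^ 2) gauss := by
    refine (integrable_tilt x).mono' (by fun_prop) (ae_of_all _ fun z => ?_)
    rw [Real.norm_eq_abs, mul_comm]
    exact (abs_mul_le_of_abs_le_one (hb' z)).trans (abs_of_pos (tilt_pos x z)).le
  have i2 : Integrable (fun z => tilt x (-z) * a z ^ 2) gauss := by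
    refine (integrable_tilt_neg x).mono' (by fun_prop) (ae_of_all _ fun z => ?_)
    rw [Real.norm_eq_abs, mul_comm]
    exact (abs_mul_le_of_abs_le_one (hb z)).trans (abs_of_pos (tilt_pos x _)).le
  have i3 : Integrable (fun z => 1 / 4 * Real.exp (-x ^ 2 / 2) * sech (x * z)) gauss :=
    (integrable_gauss_of_bounded (by fun_prop) fun z => abs_sech _).const_mul _
  have e2 : ∫ z, tilt x (-z) * a z ^ 2 ∂gauss = ∫ z, a (-x + z) ^ 2 ∂gauss := by
    rw [← integral_tilt_mul (-x) (fun z => a z ^ 2)]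
    refine integral_congr_ae (ae_of_all _ fun z => ?_)
    simp [tilt]
  have i12 : Integrable (fun z => tilt x z * (1 - a z) ^ 2 / 2 + tilt x (-z) * a z ^ 2 / 2) gauss :=
    (i1.div_const 2).add (i2.div_const 2)
  simp only [gaussRegret, mix_mul_sq]
  rw [integral_sub i12 i3,
    integral_add (i1.div_const 2) (i2.div_const 2), integral_div, integral_div,
    integral_tilt_mul x (fun z => (1 - a z) ^ 2), e2, integral_const_mul, oracleLoss]

/-- Under the reflection `z ↦ -z` the losses in the two states coincide. -/
lemma gaussRegret_eq_of_symm (ha : Measurable a) (h01 : ∀ z, a z ∈ Set.Icc (0 : ℝ) 1)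
    (hs : ∀ z, a (-z) = 1 - a z) (x : ℝ) :
    gaussRegret a x = (∫ z, (1 - a (x + z)) ^ 2 ∂gauss) - oracleLoss x := by
  have : ∫ z, a (-x + z) ^ 2 ∂gauss = ∫ z, (1 - a (x + z)) ^ 2 ∂gauss := by
    rw [← integral_gauss_neg]
    refine integral_congr_ae (ae_of_all _ fun z => ?_)
    dsimp only
    rw [← hs]; ring_nf
  rw [gaussRegret_eq ha h01, this]; ring

end UnitRule

/-! ### Best replies to two-point priors -/

/-- The likelihood of state `1`, when the signal is uninformative with probability `w` and has
mean `± x` otherwise. -/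
def lik (w x z : ℝ) : ℝ := w + (1 - w) * tilt x z

/-- The posterior of state `1` for the prior with mass `w` at `0` and `1 - w` at `x`. -/
def bayesRule (w x z : ℝ) : ℝ := lik w x z / (lik w x z + lik w x (-z))

lemma lik_pos {w : ℝ} (hw : w ∈ Set.Icc (0 : ℝ) 1) (x z : ℝ) : 0 < lik w x z := by
  have := tilt_pos x z
  have h1 := hw.1
  have h2 : 0 ≤ 1 - w := by linarith [hw.2]
  unfold lik
  rcases h1.eq_or_lt with h | h
  · rw [← h]; simpa
  · positivity

lemma bayesRule_mem {w : ℝ} (hw : w ∈ Set.Icc (0 : ℝ) 1) (x z : ℝ) :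
    0 < bayesRule w x z ∧ bayesRule w x z < 1 := by
  have h1 := lik_pos hw x z
  have h2 := lik_pos hw x (-z)
  refine ⟨by unfold bayesRule; positivity, ?_⟩
  rw [bayesRule, div_lt_one (by positivity)]
  linarith

lemma bayesRule_mem_Icc {w : ℝ} (hw : w ∈ Set.Icc (0 : ℝ) 1) (x z : ℝ) :
    bayesRule w x z ∈ Set.Icc (0 : ℝ) 1 :=
  ⟨(bayesRule_mem hw x z).1.le, (bayesRule_mem hw x z).2.le⟩

lemma bayesRule_neg {w : ℝ} (hw : w ∈ Set.Icc (0 : ℝ) 1) (x z : ℝ) :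
    bayesRule w x (-z) = 1 - bayesRule w x z := by
  have h1 := lik_pos hw x z
  have h2 := lik_pos hw x (-z)
  have : lik w x z + lik w x (-z) ≠ 0 := by positivity
  have : lik w x (-z) + lik w x z ≠ 0 := by positivity
  simp only [bayesRule, neg_neg]
  field_simp
  ring

lemma hasDerivAt_lik (w x z : ℝ) : HasDerivAt (lik w x) ((1 - w) * (tilt x z * x)) z := by
  refine (HasDerivAt.const_mul _ (HasDerivAt.exp ?_)).const_add _
  simpa using ((hasDerivAt_id z).const_mul x).sub_const (x ^ 2 / 2)

lemma continuous_lik (w x : ℝ) : Continuous (lik w x) := by unfold lik; fun_prop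

lemma continuous_bayesRule {w : ℝ} (hw : w ∈ Set.Icc (0 : ℝ) 1) (x : ℝ) :
    Continuous (bayesRule w x) :=
  (continuous_lik w x).div₀ ((continuous_lik w x).add ((continuous_lik w x).comp continuous_neg))
    fun z => (add_pos (lik_pos hw x z) (lik_pos hw x (-z))).ne'

/-- The derivative of `bayesRule w x`. -/
def bayesSlope (w x z : ℝ) : ℝ :=
  (1 - w) * x * (tilt x z * lik w x (-z) + lik w x z * tilt x (-z)) /
    (lik w x z + lik w x (-z)) ^ 2

lemma hasDerivAt_bayesRule {w : ℝ} (hw : w ∈ Set.Icc (0 : ℝ) 1) (x z : ℝ) :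
    HasDerivAt (bayesRule w x) (bayesSlope w x z) z := by
  have h1 := lik_pos hw x z
  have h2 := lik_pos hw x (-z)
  have hn : HasDerivAt (fun z => lik w x (-z)) (-((1 - w) * (tilt x (-z) * x))) z := by
    have := (hasDerivAt_lik w x (-z)).comp z (hasDerivAt_neg z)
    exact this.congr_deriv (by ring)
  have := (hasDerivAt_lik w x z).div ((hasDerivAt_lik w x z).add hn) (add_pos h1 h2).ne'
  refine this.congr_deriv ?_
  rw [bayesSlope]
  congr 1
  simp only [Pi.add_apply]
  ring

lemma continuous_bayesSlope {w : ℝ} (hw : w ∈ Set.Icc (0 : ℝ) 1) (x : ℝ) :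
    Continuous (bayesSlope w x) := by
  have hl := continuous_lik w x
  have hl' : Continuous fun z => lik w x (-z) := hl.comp continuous_neg
  have ht : Continuous fun z => tilt x (-z) := (continuous_tilt x).comp continuous_neg
  unfold bayesSlope
  refine Continuous.div₀ (by fun_prop) (by fun_prop) fun z => ?_
  exact pow_ne_zero 2 (add_pos (lik_pos hw x z) (lik_pos hw x (-z))).ne'

lemma bayesSlope_nonneg {w : ℝ} (hw : w ∈ Set.Icc (0 : ℝ) 1) {x : ℝ} (hx : 0 ≤ x) (z : ℝ) :
    0 ≤ bayesSlope w x z := by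
  have h1 := lik_pos hw x z
  have h2 := lik_pos hw x (-z)
  have := tilt_pos x z
  have := tilt_pos x (-z)
  have : 0 ≤ 1 - w := by linarith [hw.2]
  unfold bayesSlope
  positivity

lemma bayesSlope_pos {w : ℝ} (hw : w ∈ Set.Icc (0 : ℝ) 1) (hw1 : w < 1) {x : ℝ} (hx : 0 < x)
    (z : ℝ) : 0 < bayesSlope w x z := by
  have h1 := lik_pos hw x z
  have h2 := lik_pos hw x (-z)
  have := tilt_pos x z
  have := tilt_pos x (-z)
  have : 0 < 1 - w := by linarith
  unfold bayesSlope
  positivity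

/-- Each tilt term is at most the corresponding likelihood, and `2 L L' ≤ (L + L')²`. A bound
uniform in `z` is what dominated convergence needs later. -/
lemma bayesSlope_le {w : ℝ} (hw : w ∈ Set.Icc (0 : ℝ) 1) {x : ℝ} (hx : 0 ≤ x) (z : ℝ) :
    bayesSlope w x z ≤ x := by
  have h1 := lik_pos hw x z
  have h2 := lik_pos hw x (-z)
  have h3 : (1 - w) * tilt x z ≤ lik w x z := by unfold lik; linarith [hw.1]
  have h4 : (1 - w) * tilt x (-z) ≤ lik w x (-z) := by unfold lik; linarith [hw.1]
  unfold bayesSlope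
  rw [div_le_iff₀ (by positivity)]
  have h5 : (1 - w) * tilt x z * lik w x (-z) ≤ lik w x z * lik w x (-z) := by gcongr
  have h6 : (1 - w) * tilt x (-z) * lik w x z ≤ lik w x (-z) * lik w x z := by gcongr
  calc (1 - w) * x * (tilt x z * lik w x (-z) + lik w x z * tilt x (-z))
      = x * ((1 - w) * tilt x z * lik w x (-z) + (1 - w) * tilt x (-z) * lik w x z) := by ring
    _ ≤ x * (lik w x z + lik w x (-z)) ^ 2 := by
        gcongr
        nlinarith [sq_nonneg (lik w x z), sq_nonneg (lik w x (-z))]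

lemma strictMono_bayesRule {w : ℝ} (hw : w ∈ Set.Icc (0 : ℝ) 1) (hw1 : w < 1) {x : ℝ}
    (hx : 0 < x) : StrictMono (bayesRule w x) :=
  strictMono_of_hasDerivAt_pos (hasDerivAt_bayesRule hw x) (bayesSlope_pos hw hw1 hx)

/-- The value of the limit game against the prior with mass `w` at `0` and `1 - w` at `x`. -/
def bayesRegret (w x : ℝ) : ℝ :=
  ∫ z, w * (1 - w) * mix x z * (posterior x z - 1 / 2) ^ 2 / (w + (1 - w) * mix x z) ∂gauss

lemma mixWeight_pos {w : ℝ} (hw : w ∈ Set.Icc (0 : ℝ) 1) (x z : ℝ) :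
    0 < w + (1 - w) * mix x z := by
  have h1 := lik_pos hw x z
  have h2 := lik_pos hw x (-z)
  unfold lik at h1 h2
  unfold mix
  linarith

/-- Completing the square in `t`: the minimiser is the posterior mean and the constant term the
pointwise Bayes regret. Here `M` is the informative density relative to the uninformative one; the
identity serves the limit game and the finite games alike. -/
lemma two_point_sq {w M p : ℝ} (hT : w + (1 - w) * M ≠ 0) (t : ℝ) :
    w * (1 / 2 - t) ^ 2 + (1 - w) * (M * (p - t) ^ 2) =
      w * (1 - w) * M * (p - 1 / 2) ^ 2 / (w + (1 - w) * M) +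
      (w + (1 - w) * M) * (t - (w / 2 + (1 - w) * (M * p)) / (w + (1 - w) * M)) ^ 2 := by
  field_simp
  ring

lemma bayesRule_eq (w x z : ℝ) : bayesRule w x z =
    (w / 2 + (1 - w) * (mix x z * posterior x z)) / (w + (1 - w) * mix x z) := by
  have h := mix_pos x z
  rw [posterior, mul_div_cancel₀ _ h.ne', bayesRule, lik, lik, mix,
    show w + (1 - w) * tilt x z + (w + (1 - w) * tilt x (-z))
      = 2 * (w + (1 - w) * ((tilt x z + tilt x (-z)) / 2)) by ring,
    show w + (1 - w) * tilt x z = 2 * (w / 2 + (1 - w) * (tilt x z / 2)) by ring,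
    mul_div_mul_left _ _ two_ne_zero]

lemma bayesRegret_integrand_nonneg {w : ℝ} (hw : w ∈ Set.Icc (0 : ℝ) 1) (x z : ℝ) :
    0 ≤ w * (1 - w) * mix x z * (posterior x z - 1 / 2) ^ 2 / (w + (1 - w) * mix x z) := by
  have h1 := mixWeight_pos hw x z
  have h2 := mix_pos x z
  have h3 : 0 ≤ 1 - w := by linarith [hw.2]
  have h4 := hw.1
  positivity

/-- The bound `1` gives domination, while the bound `mix x z` gives decay as `x → ∞`. -/
lemma bayesRegret_integrand_le {w : ℝ} (hw : w ∈ Set.Icc (0 : ℝ) 1) (x z : ℝ) :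
    w * (1 - w) * mix x z * (posterior x z - 1 / 2) ^ 2 / (w + (1 - w) * mix x z) ≤
      min 1 (mix x z) := by
  have h1 := mixWeight_pos hw x z
  have h2 := mix_pos x z
  have h3 : 0 ≤ 1 - w := by linarith [hw.2]
  have h4 := hw.1
  have h5 := sq_le_one_of_mem (posterior_mem x z) (q := 1 / 2) ⟨by norm_num, by norm_num⟩
  have h6 : w * (1 - w) * mix x z * (posterior x z - 1 / 2) ^ 2 ≤ w * (1 - w) * mix x z * 1 := by
    gcongr
  have h7 : w * (1 - w) * mix x z ≤ (1 - w) * mix x z := by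
    have := mul_nonneg h3 h2.le
    nlinarith [hw.2]
  have h8 : w * (1 - w) * mix x z ≤ w * mix x z := by
    have := mul_nonneg h4 h2.le
    nlinarith [hw.1]
  refine le_min ?_ ?_ <;> rw [div_le_iff₀ h1]
  · linarith
  · rcases le_total 1 (mix x z) with h | h
    · nlinarith [hw.2]
    · have : w * (1 - w) * mix x z ≤ mix x z * (w + (1 - w) * mix x z) := by
        have := mul_nonneg h3 (mul_self_nonneg (mix x z))
        nlinarith
      linarith

lemma integrable_bayesRegret {w : ℝ} (hw : w ∈ Set.Icc (0 : ℝ) 1) (x : ℝ) :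
    Integrable (fun z => w * (1 - w) * mix x z * (posterior x z - 1 / 2) ^ 2 /
      (w + (1 - w) * mix x z)) gauss :=
  integrable_gauss_of_bounded (C := 1) (by fun_prop) fun z => by
    rw [abs_of_nonneg (bayesRegret_integrand_nonneg hw x z)]
    exact (bayesRegret_integrand_le hw x z).trans (min_le_left _ _)

/-- Pythagoras for squared loss, from `two_point_sq` pointwise. The remainder yields both the
optimality of `bayesRule w x` and the uniqueness of the weight in `IsSaddle.eq_of_bayesRegret_eq`.
-/
lemma twoPoint_regret {a : ℝ → ℝ} (ha : Measurable a) (h01 : ∀ z, a z ∈ Set.Icc (0 : ℝ) 1) {w : ℝ}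
    (hw : w ∈ Set.Icc (0 : ℝ) 1) (x : ℝ) :
    w * gaussRegret a 0 + (1 - w) * gaussRegret a x = bayesRegret w x +
      ∫ z, (w + (1 - w) * mix x z) * (a z - bayesRule w x z) ^ 2 ∂gauss := by
  have i0 := integrable_gaussRegret ha h01 0
  have i1 := integrable_gaussRegret ha h01 x
  have hm : Measurable (bayesRule w x) := (continuous_bayesRule hw x).measurable
  have i3 : Integrable (fun z => (w + (1 - w) * mix x z) * (a z - bayesRule w x z) ^ 2) gauss := by
    refine ((integrable_const w).add ((integrable_mix x).const_mul (1 - w))).mono'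
      (by fun_prop) (ae_of_all _ fun z => ?_)
    rw [Real.norm_eq_abs, mul_comm]
    refine (abs_mul_le_of_abs_le_one ?_).trans (abs_of_pos (mixWeight_pos hw x z)).le
    rw [abs_of_nonneg (sq_nonneg _)]
    exact sq_le_one_of_mem (h01 z) (bayesRule_mem_Icc hw x z)
  rw [bayesRegret, ← integral_add (integrable_bayesRegret hw x) i3, gaussRegret, gaussRegret,
    ← integral_const_mul, ← integral_const_mul, ← integral_add (i0.const_mul w) (i1.const_mul _)]
  refine integral_congr_ae (ae_of_all _ fun z => ?_)
  dsimp only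
  rw [bayesRule_eq, mix_zero, posterior_zero, one_mul]
  exact two_point_sq (mixWeight_pos hw x z).ne' _

lemma bayesRegret_le {a : ℝ → ℝ} (ha : Measurable a) (h01 : ∀ z, a z ∈ Set.Icc (0 : ℝ) 1) {w : ℝ}
    (hw : w ∈ Set.Icc (0 : ℝ) 1) (x : ℝ) :
    bayesRegret w x ≤ w * gaussRegret a 0 + (1 - w) * gaussRegret a x := by
  rw [twoPoint_regret ha h01 hw]
  exact le_add_of_nonneg_right (integral_nonneg fun z =>
    mul_nonneg (mixWeight_pos hw x z).le (sq_nonneg _))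

lemma bayesRegret_eq {w : ℝ} (hw : w ∈ Set.Icc (0 : ℝ) 1) (x : ℝ) :
    bayesRegret w x =
      w * gaussRegret (bayesRule w x) 0 + (1 - w) * gaussRegret (bayesRule w x) x := by
  rw [twoPoint_regret (continuous_bayesRule hw x).measurable (bayesRule_mem_Icc hw x) hw]
  simp

/-! ### The shape of the regret of a best reply -/

/-- The normalised speed at which the loss of the rule `bayesRule w x` decreases at `y`. -/
def replySpeed (w x y : ℝ) : ℝ :=
  ∫ z, Real.exp (y * z) * (2 * (1 - bayesRule w x z) * bayesSlope w x z) ∂gauss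

/-- The derivative of the regret of `bayesRule w x` at `y`, up to a positive factor. -/
def regretDrift (w x y : ℝ) : ℝ := lossSpeed y / 2 - replySpeed w x y

section Reply

variable {w x : ℝ}

lemma replyWeight_nonneg (hw : w ∈ Set.Icc (0 : ℝ) 1) (hx : 0 ≤ x) (z : ℝ) :
    0 ≤ 2 * (1 - bayesRule w x z) * bayesSlope w x z := by
  have h1 : 0 ≤ 1 - bayesRule w x z := by linarith [(bayesRule_mem hw x z).2]
  have h2 := bayesSlope_nonneg hw hx z
  positivity

lemma replyWeight_le (hw : w ∈ Set.Icc (0 : ℝ) 1) (hx : 0 ≤ x) (z : ℝ) :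
    2 * (1 - bayesRule w x z) * bayesSlope w x z ≤ 2 * x := by
  have h1 := bayesRule_mem hw x z
  have h2 := bayesSlope_nonneg hw hx z
  have h3 := bayesSlope_le hw hx z
  nlinarith

lemma continuous_replyWeight (hw : w ∈ Set.Icc (0 : ℝ) 1) :
    Continuous fun z => 2 * (1 - bayesRule w x z) * bayesSlope w x z := by
  have h1 := continuous_bayesRule hw x
  have h2 := continuous_bayesSlope hw x
  fun_prop

lemma exp_mul_le_exp_abs {y Y : ℝ} (h : |y| ≤ Y) (z : ℝ) :
    Real.exp (y * z) ≤ Real.exp (Y * |z|) := by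
  refine Real.exp_le_exp.2 ((le_abs_self _).trans ?_)
  rw [abs_mul]
  gcongr

lemma integrable_replySpeed (hw : w ∈ Set.Icc (0 : ℝ) 1) (hx : 0 ≤ x) (y : ℝ) :
    Integrable (fun z => Real.exp (y * z) * (2 * (1 - bayesRule w x z) * bayesSlope w x z))
      gauss := by
  have hc := continuous_replyWeight (x := x) hw
  refine ((integrable_exp_abs_gauss |y|).mul_const (2 * x)).mono'
    (Continuous.aestronglyMeasurable (by fun_prop)) (ae_of_all _ fun z => ?_)
  rw [Real.norm_eq_abs, abs_mul, Real.abs_exp, abs_of_nonneg (replyWeight_nonneg hw hx z)]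
  exact mul_le_mul (exp_mul_le_exp_abs le_rfl z) (replyWeight_le hw hx z)
    (replyWeight_nonneg hw hx z) (Real.exp_pos _).le

/-- Each `y ↦ exp (y z)` is convex and the weights are nonnegative because the reply is
nondecreasing and at most one. -/
lemma convexOn_replySpeed (hw : w ∈ Set.Icc (0 : ℝ) 1) (hx : 0 ≤ x) :
    ConvexOn ℝ (Set.Ici 0) (replySpeed w x) := by
  refine ⟨convex_Ici 0, fun y _ y' _ s t hs ht hst => ?_⟩
  simp only [smul_eq_mul, replySpeed]
  rw [← integral_const_mul, ← integral_const_mul, ← integral_add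
    ((integrable_replySpeed hw hx y).const_mul s) ((integrable_replySpeed hw hx y').const_mul t)]
  refine integral_mono (integrable_replySpeed hw hx _)
    (((integrable_replySpeed hw hx y).const_mul s).add
      ((integrable_replySpeed hw hx y').const_mul t)) fun z => ?_
  simp only
  rw [← mul_assoc s, ← mul_assoc t, ← add_mul]
  refine mul_le_mul_of_nonneg_right ?_ (replyWeight_nonneg hw hx z)
  have := convexOn_exp.2 (Set.mem_univ (y * z)) (Set.mem_univ (y' * z)) hs ht hst
  simp only [smul_eq_mul] at this
  convert! this using 2
  ring

/-- This is the source of the shape of the regret: a concave function that is negative at `0`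
changes sign at most twice on `[0, ∞)`. -/
lemma concaveOn_regretDrift (hw : w ∈ Set.Icc (0 : ℝ) 1) (hx : 0 ≤ x) :
    ConcaveOn ℝ (Set.Ici 0) (regretDrift w x) := by
  have h := (concaveOn_lossSpeed.smul (c := (1 / 2 : ℝ)) (by norm_num)).sub
    (convexOn_replySpeed hw hx)
  refine h.congr fun y _ => ?_
  simp [regretDrift]
  ring

/-- At `0` the oracle's loss is stationary, whereas the loss of a strictly increasing reply already
decreases. -/
lemma regretDrift_zero_neg (hw : w ∈ Set.Icc (0 : ℝ) 1) (hw1 : w < 1) (hx : 0 < x) :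
    regretDrift w x 0 < 0 := by
  have : 0 < replySpeed w x 0 := by
    have hp : ∀ z, 0 < Real.exp (0 * z) * (2 * (1 - bayesRule w x z) * bayesSlope w x z) := by
      intro z
      have h1 : 0 < 1 - bayesRule w x z := by linarith [(bayesRule_mem hw x z).2]
      have h2 := bayesSlope_pos hw hw1 hx z
      have := Real.exp_pos (0 * z)
      positivity
    exact integral_gauss_pos (integrable_replySpeed hw hx.le 0) (fun z _ => hp z) (hp 0).le
  simp only [regretDrift, lossSpeed, zero_mul, zero_div]
  linarith

/-- Differentiate the symmetric formula for the regret under the integral, then trade the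
translation by `y` for a tilt; this pulls out the factor `exp (-y²/2)`. -/
lemma hasDerivAt_gaussRegret (hw : w ∈ Set.Icc (0 : ℝ) 1) (hx : 0 ≤ x) (y : ℝ) :
    HasDerivAt (gaussRegret (bayesRule w x))
      (Real.exp (-y ^ 2 / 2) * regretDrift w x y) y := by
  have hc := continuous_bayesRule hw x
  have hs := continuous_bayesSlope hw x
  have hm := hc.measurable
  have hms := hs.measurable
  have h1 : HasDerivAt (fun y => ∫ z, (1 - bayesRule w x (y + z)) ^ 2 ∂gauss)
      (∫ z, -(2 * (1 - bayesRule w x (y + z)) * bayesSlope w x (y + z)) ∂gauss) y := by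
    refine hasDerivAt_integral_gauss (F := fun y z => (1 - bayesRule w x (y + z)) ^ 2)
      (F' := fun y z => -(2 * (1 - bayesRule w x (y + z)) * bayesSlope w x (y + z)))
      (C := 2 * x) (fun y => ?_) (fun y => by fun_prop) (fun y z => ?_) (fun y z => ?_) y
    · refine integrable_gauss_of_bounded (C := 1) (by fun_prop) fun z => ?_
      have := bayesRule_mem hw x (y + z)
      rw [abs_of_nonneg (sq_nonneg _)]
      exact sq_le_one_of_mem ⟨zero_le_one, le_rfl⟩ (bayesRule_mem_Icc hw x _)
    · have := ((((hasDerivAt_bayesRule hw x (y + z)).comp y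
        ((hasDerivAt_id y).add_const z)).const_sub 1).pow 2)
      refine this.congr_deriv ?_
      simp
    · rw [abs_neg, abs_of_nonneg (replyWeight_nonneg hw hx _)]
      exact (replyWeight_le hw hx _).trans (le_mul_of_one_le_right (by positivity)
        (by nlinarith [sq_nonneg z]))
  have h2 : ∫ z, -(2 * (1 - bayesRule w x (y + z)) * bayesSlope w x (y + z)) ∂gauss
      = -(Real.exp (-y ^ 2 / 2) * replySpeed w x y) := by
    rw [integral_neg, ← integral_tilt_mul y
      (fun z => 2 * (1 - bayesRule w x z) * bayesSlope w x z), replySpeed, ← integral_const_mul]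
    congr 1
    refine integral_congr_ae (ae_of_all _ fun z => ?_)
    simp only
    rw [← mul_assoc (Real.exp _), ← Real.exp_add, tilt,
      show y * z - y ^ 2 / 2 = -y ^ 2 / 2 + y * z by ring]
  rw [h2] at h1
  have h3 := h1.sub (hasDerivAt_oracleLoss y)
  rw [show gaussRegret (bayesRule w x) = fun y =>
      (∫ z, (1 - bayesRule w x (y + z)) ^ 2 ∂gauss) - oracleLoss y from
    funext fun y => gaussRegret_eq_of_symm hm (bayesRule_mem_Icc hw x) (bayesRule_neg hw x) y]
  refine h3.congr_deriv ?_
  rw [regretDrift]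
  ring

/-- A best reply whose regret is the same at `0` and at a critical point `x > 0` has no larger
regret anywhere, and a strictly smaller one elsewhere. -/
lemma gaussRegret_lt_of_critical (hw : w ∈ Set.Icc (0 : ℝ) 1) (hw1 : w < 1) (hx : 0 < x)
    (heq : gaussRegret (bayesRule w x) 0 = gaussRegret (bayesRule w x) x)
    (hcrit : regretDrift w x x = 0) {y : ℝ} (hy : 0 < y) (hyx : y ≠ x) :
    gaussRegret (bayesRule w x) y < gaussRegret (bayesRule w x) x := by
  set D := gaussRegret (bayesRule w x) with hD
  have hd := hasDerivAt_gaussRegret hw hx.le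
  rw [← hD] at hd
  have hdiff : Differentiable ℝ D := fun y => (hd y).differentiableAt
  have hconc := concaveOn_regretDrift hw hx.le
  -- a mean value point for every pair of points
  have mvt : ∀ s t, s < t → ∃ ξ ∈ Set.Ioo s t,
      Real.exp (-ξ ^ 2 / 2) * regretDrift w x ξ * (t - s) = D t - D s := by
    intro s t hst
    obtain ⟨ξ, hξ, h⟩ := exists_hasDerivAt_eq_slope D _ hst hdiff.continuous.continuousOn
      (fun z _ => hd z)
    refine ⟨ξ, hξ, ?_⟩
    rw [h, div_mul_cancel₀ _ (sub_pos.2 hst).ne']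
  have mvt_pos : ∀ s t, s < t → D s < D t → ∃ ξ ∈ Set.Ioo s t, 0 < regretDrift w x ξ := by
    intro s t hst h
    obtain ⟨ξ, hξ, e⟩ := mvt s t hst
    refine ⟨ξ, hξ, ?_⟩
    by_contra! hn
    have := Real.exp_pos (-ξ ^ 2 / 2)
    have : Real.exp (-ξ ^ 2 / 2) * regretDrift w x ξ * (t - s) ≤ 0 :=
      mul_nonpos_of_nonpos_of_nonneg (mul_nonpos_of_nonneg_of_nonpos this.le hn) (by linarith)
    linarith
  have mvt_nonneg : ∀ s t, s < t → D s ≤ D t → ∃ ξ ∈ Set.Ioo s t, 0 ≤ regretDrift w x ξ := by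
    intro s t hst h
    obtain ⟨ξ, hξ, e⟩ := mvt s t hst
    refine ⟨ξ, hξ, ?_⟩
    by_contra! hn
    have := Real.exp_pos (-ξ ^ 2 / 2)
    have : Real.exp (-ξ ^ 2 / 2) * regretDrift w x ξ * (t - s) < 0 :=
      mul_neg_of_neg_of_pos (mul_neg_of_pos_of_neg this hn) (by linarith)
    linarith
  have mvt_nonpos : ∀ s t, s < t → D t ≤ D s → ∃ ξ ∈ Set.Ioo s t, regretDrift w x ξ ≤ 0 := by
    intro s t hst h
    obtain ⟨ξ, hξ, e⟩ := mvt s t hst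
    refine ⟨ξ, hξ, ?_⟩
    by_contra! hn
    have := Real.exp_pos (-ξ ^ 2 / 2)
    have : 0 < Real.exp (-ξ ^ 2 / 2) * regretDrift w x ξ * (t - s) :=
      mul_pos (mul_pos this hn) (by linarith)
    linarith
  -- the regret is initially decreasing
  have hdec : ∀ᶠ s in 𝓝[>] (0 : ℝ), D s < D 0 := by
    have h0 : Real.exp (-(0 : ℝ) ^ 2 / 2) * regretDrift w x 0 < 0 :=
      mul_neg_of_pos_of_neg (Real.exp_pos _) (regretDrift_zero_neg hw hw1 hx)
    have ht := (hasDerivAt_iff_tendsto_slope.1 (hd 0)).eventually (gt_mem_nhds h0)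
    have ht' : ∀ᶠ s in 𝓝[>] (0 : ℝ), slope D 0 s < 0 :=
      ht.filter_mono (nhdsWithin_mono 0 fun s (hs : 0 < s) => hs.ne')
    filter_upwards [ht', self_mem_nhdsWithin] with s hs hs0
    rw [slope_def_field, sub_zero, div_neg_iff] at hs
    have : (0 : ℝ) < s := hs0
    rcases hs with h | h <;> linarith [h.1, h.2]
  by_contra! hge
  -- Near `0` the regret drops below its common value at `0` and `x`, so it has to rise strictly
  -- from `s` to either `x` or `y`; this provides a point of positive drift.
  obtain ⟨s, hs, hs0⟩ := (hdec.and (Ioo_mem_nhdsGT (lt_min hy hx))).exists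
  have hsy : s < y := hs0.2.trans_le (min_le_left _ _)
  have hsx : s < x := hs0.2.trans_le (min_le_right _ _)
  -- On either side of `x` there are three ordered points, one of them `x`, at which the drift is
  -- first positive, then at most `0`, then at least `0`. The adjacent slopes go from negative to
  -- nonnegative, contradicting concavity.
  rcases lt_or_gt_of_ne hyx with h | h
  · obtain ⟨ξ, hξ, hξp⟩ := mvt_pos s y hsy (by linarith)
    obtain ⟨η, hη, hηn⟩ := mvt_nonpos y x h hge
    have hξη : ξ < η := hξ.2.trans hη.1
    have := hconc.slope_anti_adjacent (x := ξ) (y := η) (z := x) (hs0.1.trans hξ.1).le hx.le hξη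
      hη.2
    rw [hcrit, div_le_div_iff₀ (by linarith [hη.2]) (by linarith)] at this
    nlinarith [hη.2, hξη]
  · obtain ⟨ξ, hξ, hξp⟩ := mvt_pos s x hsx (by linarith)
    obtain ⟨η, hη, hηn⟩ := mvt_nonneg x y h hge
    have := hconc.slope_anti_adjacent (x := ξ) (y := x) (z := η) (hs0.1.trans hξ.1).le
      (hx.trans hη.1).le hξ.2 hη.1
    rw [hcrit, div_le_div_iff₀ (by linarith [hη.1]) (by linarith [hξ.2])] at this
    nlinarith [hη.1, hξ.2]

end Reply

/-! ### Continuity in the prior -/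

section Continuity

variable {ι : Type*} {l : Filter ι} {w x : ι → ℝ} {w₀ x₀ : ℝ}

lemma tendsto_tilt (hx : Tendsto x l (𝓝 x₀)) (z : ℝ) :
    Tendsto (fun i => tilt (x i) z) l (𝓝 (tilt x₀ z)) := by
  unfold tilt
  exact (Real.continuous_exp.tendsto _).comp ((hx.mul_const z).sub ((hx.pow 2).div_const 2))

lemma tendsto_mix (hx : Tendsto x l (𝓝 x₀)) (z : ℝ) :
    Tendsto (fun i => mix (x i) z) l (𝓝 (mix x₀ z)) :=
  ((tendsto_tilt hx z).add (tendsto_tilt hx (-z))).div_const 2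

lemma tendsto_posterior (hx : Tendsto x l (𝓝 x₀)) (z : ℝ) :
    Tendsto (fun i => posterior (x i) z) l (𝓝 (posterior x₀ z)) :=
  ((tendsto_tilt hx z).div_const 2).div (tendsto_mix hx z) (mix_pos x₀ z).ne'

lemma tendsto_lik (hw : Tendsto w l (𝓝 w₀)) (hx : Tendsto x l (𝓝 x₀)) (z : ℝ) :
    Tendsto (fun i => lik (w i) (x i) z) l (𝓝 (lik w₀ x₀ z)) :=
  hw.add ((hw.const_sub 1).mul (tendsto_tilt hx z))

lemma tendsto_bayesRule (hw₀ : w₀ ∈ Set.Icc (0 : ℝ) 1) (hw : Tendsto w l (𝓝 w₀))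
    (hx : Tendsto x l (𝓝 x₀)) (z : ℝ) :
    Tendsto (fun i => bayesRule (w i) (x i) z) l (𝓝 (bayesRule w₀ x₀ z)) :=
  (tendsto_lik hw hx z).div ((tendsto_lik hw hx z).add (tendsto_lik hw hx (-z)))
    (add_pos (lik_pos hw₀ x₀ z) (lik_pos hw₀ x₀ (-z))).ne'

lemma tendsto_bayesSlope (hw₀ : w₀ ∈ Set.Icc (0 : ℝ) 1) (hw : Tendsto w l (𝓝 w₀))
    (hx : Tendsto x l (𝓝 x₀)) (z : ℝ) :
    Tendsto (fun i => bayesSlope (w i) (x i) z) l (𝓝 (bayesSlope w₀ x₀ z)) := by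
  have h1 := tendsto_lik hw hx z
  have h2 := tendsto_lik hw hx (-z)
  have h3 := tendsto_tilt hx z
  have h4 := tendsto_tilt hx (-z)
  exact (((hw.const_sub 1).mul hx).mul ((h3.mul h2).add (h1.mul h4))).div ((h1.add h2).pow 2)
    (pow_ne_zero 2 (add_pos (lik_pos hw₀ x₀ z) (lik_pos hw₀ x₀ (-z))).ne')

variable [l.IsCountablyGenerated]

lemma tendsto_gaussRegret (hw₀ : w₀ ∈ Set.Icc (0 : ℝ) 1) (hw : Tendsto w l (𝓝 w₀))
    (hx : Tendsto x l (𝓝 x₀)) (hwl : ∀ᶠ i in l, w i ∈ Set.Icc (0 : ℝ) 1) (y : ℝ) :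
    Tendsto (fun i => gaussRegret (bayesRule (w i) (x i)) y) l
      (𝓝 (gaussRegret (bayesRule w₀ x₀) y)) := by
  refine tendsto_integral_filter_of_dominated_convergence (mix y) ?_ ?_ (integrable_mix y) ?_
  · filter_upwards [hwl] with i hi
    exact (integrable_gaussRegret (continuous_bayesRule hi _).measurable
      (bayesRule_mem_Icc hi _) y).aestronglyMeasurable
  · filter_upwards [hwl] with i hi
    refine ae_of_all _ fun z => ?_
    rw [Real.norm_eq_abs, mul_comm]
    exact (abs_mul_le_of_abs_le_one (abs_sq_sub_le_one (bayesRule_mem_Icc hi _) y z)).trans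
      (abs_of_pos (mix_pos y z)).le
  · exact ae_of_all _ fun z => (((tendsto_bayesRule hw₀ hw hx z).const_sub _).pow 2).const_mul _

lemma tendsto_replySpeed {y : ι → ℝ} {y₀ : ℝ} (hw₀ : w₀ ∈ Set.Icc (0 : ℝ) 1)
    (hw : Tendsto w l (𝓝 w₀)) (hx : Tendsto x l (𝓝 x₀))
    (hwl : ∀ᶠ i in l, w i ∈ Set.Icc (0 : ℝ) 1) (hxl : ∀ᶠ i in l, 0 ≤ x i)
    (hy : Tendsto y l (𝓝 y₀)) :
    Tendsto (fun i => replySpeed (w i) (x i) (y i)) l (𝓝 (replySpeed w₀ x₀ y₀)) := by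
  have hxb : ∀ᶠ i in l, x i ≤ x₀ + 1 := hx.eventually (ge_mem_nhds (lt_add_one x₀))
  have hyb : ∀ᶠ i in l, |y i| ≤ |y₀| + 1 := hy.abs.eventually (ge_mem_nhds (lt_add_one _))
  refine tendsto_integral_filter_of_dominated_convergence
    (fun z => Real.exp ((|y₀| + 1) * |z|) * (2 * (x₀ + 1))) ?_ ?_
    ((integrable_exp_abs_gauss _).mul_const _) ?_
  · filter_upwards [hwl, hxl] with i hi hi'
    exact (integrable_replySpeed hi hi' _).aestronglyMeasurable
  · filter_upwards [hwl, hxl, hxb, hyb] with i hi hi' hxi hyi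
    refine ae_of_all _ fun z => ?_
    have h0 := replyWeight_nonneg hi hi' z
    rw [Real.norm_eq_abs, abs_mul, Real.abs_exp, abs_of_nonneg h0]
    exact mul_le_mul (exp_mul_le_exp_abs hyi z) ((replyWeight_le hi hi' z).trans (by linarith)) h0
      (Real.exp_pos _).le
  · refine ae_of_all _ fun z => ?_
    exact ((Real.continuous_exp.tendsto _).comp (hy.mul_const z)).mul
      ((((tendsto_bayesRule hw₀ hw hx z).const_sub 1).const_mul 2).mul
        (tendsto_bayesSlope hw₀ hw hx z))

/-- The evaluation point varies together with the prior because the mean-value points in the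
first-order condition for `x` do. -/
lemma tendsto_regretDrift {y : ι → ℝ} {y₀ : ℝ} (hw₀ : w₀ ∈ Set.Icc (0 : ℝ) 1)
    (hw : Tendsto w l (𝓝 w₀)) (hx : Tendsto x l (𝓝 x₀))
    (hwl : ∀ᶠ i in l, w i ∈ Set.Icc (0 : ℝ) 1) (hxl : ∀ᶠ i in l, 0 ≤ x i)
    (hy : Tendsto y l (𝓝 y₀)) :
    Tendsto (fun i => regretDrift (w i) (x i) (y i)) l (𝓝 (regretDrift w₀ x₀ y₀)) := by
  have hc : ContinuousAt lossSpeed y₀ := (hasDerivAt_lossSpeed y₀).continuousAt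
  exact ((hc.tendsto.comp hy).div_const 2).sub (tendsto_replySpeed hw₀ hw hx hwl hxl hy)

lemma tendsto_bayesRegret (hw₀ : w₀ ∈ Set.Icc (0 : ℝ) 1)
    (hw : Tendsto w l (𝓝 w₀)) (hx : Tendsto x l (𝓝 x₀))
    (hwl : ∀ᶠ i in l, w i ∈ Set.Icc (0 : ℝ) 1) :
    Tendsto (fun i => bayesRegret (w i) (x i)) l (𝓝 (bayesRegret w₀ x₀)) := by
  refine tendsto_integral_filter_of_dominated_convergence (fun _ => 1) ?_ ?_
    (integrable_const 1) ?_
  · filter_upwards [hwl] with i hi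
    exact (integrable_bayesRegret hi _).aestronglyMeasurable
  · filter_upwards [hwl] with i hi
    refine ae_of_all _ fun z => ?_
    rw [Real.norm_eq_abs, abs_of_nonneg (bayesRegret_integrand_nonneg hi _ z)]
    exact (bayesRegret_integrand_le hi _ z).trans (min_le_left _ _)
  · refine ae_of_all _ fun z => ?_
    exact (((hw.mul (hw.const_sub 1)).mul (tendsto_mix hx z)).mul
      (((tendsto_posterior hx z).sub_const _).pow 2)).div
      (hw.add ((hw.const_sub 1).mul (tendsto_mix hx z))) (mixWeight_pos hw₀ x₀ z).ne'

end Continuity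

/-! ### Existence of the least favourable two-point prior -/

lemma tendsto_tilt_atTop (z : ℝ) : Tendsto (fun x => tilt x z) atTop (𝓝 0) := by
  unfold tilt
  refine Real.tendsto_exp_atBot.comp ?_
  have : (fun x : ℝ => x * z - x ^ 2 / 2) = fun x => x * (z - x / 2) := by ext x; ring
  rw [this]
  refine tendsto_id.atTop_mul_atBot₀ ?_
  simp only [sub_eq_add_neg]
  exact tendsto_atBot_add_const_left _ z (tendsto_neg_atTop_atBot.comp
    (tendsto_id.atTop_div_const two_pos))

/-- Truncation is essential: `mix x` has Gaussian integral one for every `x`, its mass escaping to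
infinity while it tends to zero pointwise. -/
lemma tendsto_integral_min_mix : Tendsto (fun x => ∫ z, min 1 (mix x z) ∂gauss) atTop (𝓝 0) := by
  have h0 : (0 : ℝ) = ∫ _ : ℝ, (0 : ℝ) ∂gauss := by simp
  rw [h0]
  refine tendsto_integral_filter_of_dominated_convergence (fun _ => 1) ?_ ?_
    (integrable_const 1) ?_
  · exact Eventually.of_forall fun x => Measurable.aestronglyMeasurable (by fun_prop)
  · refine Eventually.of_forall fun x => ae_of_all _ fun z => ?_
    rw [Real.norm_eq_abs, abs_of_nonneg (le_min zero_le_one (mix_pos x z).le)]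
    exact min_le_left _ _
  · refine ae_of_all _ fun z => ?_
    have : Tendsto (fun x => mix x z) atTop (𝓝 ((0 + 0) / 2)) :=
      ((tendsto_tilt_atTop z).add (tendsto_tilt_atTop (-z))).div_const 2
    have h := (tendsto_const_nhds (x := (1 : ℝ))).min this
    simpa using h

lemma tilt_ne_tilt_neg {x z : ℝ} (hx : x ≠ 0) (hz : z ≠ 0) : tilt x z ≠ tilt x (-z) := by
  intro h
  have := Real.exp_injective h
  have : x * z = 0 := by linarith
  simp [hx, hz] at this

lemma bayesRegret_pos {w x : ℝ} (hw0 : 0 < w) (hw1 : w < 1) (hx : x ≠ 0) :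
    0 < bayesRegret w x := by
  have hw : w ∈ Set.Icc (0 : ℝ) 1 := ⟨hw0.le, hw1.le⟩
  refine integral_gauss_pos (integrable_bayesRegret hw x) (fun z hz => ?_)
    (bayesRegret_integrand_nonneg hw x 0)
  have h1 := mixWeight_pos hw x z
  have h2 := mix_pos x z
  have h3 : 0 < 1 - w := by linarith
  have h4 : posterior x z - 1 / 2 ≠ 0 := by
    rw [sub_ne_zero, posterior, ne_eq, div_eq_iff h2.ne', mix]
    intro h
    exact tilt_ne_tilt_neg hx hz (by linarith)
  have h5 : 0 < (posterior x z - 1 / 2) ^ 2 := by positivity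
  positivity

/-- Decay in `x` reduces the problem to a compact rectangle, where continuity gives a maximiser. The
Bayes regret vanishes for `w = 0`, `w = 1` and `x = 0`, so a positive maximum avoids these edges. -/
lemma exists_isMax_bayesRegret : ∃ w x : ℝ, 0 < w ∧ w < 1 ∧ 0 < x ∧
    ∀ w' ∈ Set.Icc (0 : ℝ) 1, ∀ x' : ℝ, 0 ≤ x' → bayesRegret w' x' ≤ bayesRegret w x := by
  have hv : 0 < bayesRegret (1 / 2) 1 := bayesRegret_pos (by norm_num) (by norm_num) one_ne_zero
  obtain ⟨C, hC⟩ := eventually_atTop.1 (tendsto_integral_min_mix.eventually (gt_mem_nhds hv))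
  have hbound : ∀ w ∈ Set.Icc (0 : ℝ) 1, ∀ x, C ≤ x → bayesRegret w x < bayesRegret (1 / 2) 1 := by
    intro w hw x hx
    refine lt_of_le_of_lt (integral_mono (integrable_bayesRegret hw x) ?_
      (bayesRegret_integrand_le hw x)) (hC x hx)
    refine integrable_gauss_of_bounded (C := 1) (by fun_prop) fun z => ?_
    rw [abs_of_nonneg (le_min zero_le_one (mix_pos x z).le)]
    exact min_le_left _ _
  -- The side length `max C 1` keeps the reference point `(1/2, 1)` inside the rectangle.
  have hcomp : IsCompact (Set.Icc (0 : ℝ) 1 ×ˢ Set.Icc (0 : ℝ) (max C 1)) :=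
    isCompact_Icc.prod isCompact_Icc
  have hne : (Set.Icc (0 : ℝ) 1 ×ˢ Set.Icc (0 : ℝ) (max C 1)).Nonempty :=
    ⟨(0, 0), ⟨le_rfl, zero_le_one⟩, ⟨le_rfl, zero_le_one.trans (le_max_right _ _)⟩⟩
  have hcont : ContinuousOn (fun p : ℝ × ℝ => bayesRegret p.1 p.2)
      (Set.Icc (0 : ℝ) 1 ×ˢ Set.Icc (0 : ℝ) (max C 1)) := by
    rintro ⟨w, x⟩ h
    refine tendsto_bayesRegret h.1 ?_ ?_ ?_
    · exact (continuous_fst.tendsto _).mono_left nhdsWithin_le_nhds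
    · exact (continuous_snd.tendsto _).mono_left nhdsWithin_le_nhds
    · filter_upwards [self_mem_nhdsWithin] with p hp using hp.1
  obtain ⟨⟨w, x⟩, hmem, hmax⟩ := hcomp.exists_isMaxOn hne hcont
  have hge : bayesRegret (1 / 2) 1 ≤ bayesRegret w x :=
    hmax (a := ((1 / 2 : ℝ), (1 : ℝ))) ⟨⟨by norm_num, by norm_num⟩, ⟨zero_le_one, le_max_right _ _⟩⟩
  have hpos : 0 < bayesRegret w x := hv.trans_le hge
  refine ⟨w, x, lt_of_le_of_ne hmem.1.1 ?_, lt_of_le_of_ne hmem.1.2 ?_,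
    lt_of_le_of_ne hmem.2.1 ?_, fun w' hw' x' hx' => ?_⟩
  · rintro rfl; simp [bayesRegret] at hpos
  · rintro rfl; simp [bayesRegret] at hpos
  · rintro rfl; simp [bayesRegret, posterior_zero] at hpos
  · rcases le_total x' (max C 1) with h | h
    · exact hmax (a := (w', x')) ⟨hw', hx', h⟩
    · exact (hbound w' hw' x' ((le_max_left _ _).trans h)).le.trans hge

/-- A pair `(w, x)` for which the two-point prior with mass `w` at `0` and `1 - w` at `x` is the
least favourable one, and its best reply attains its maximal regret exactly at `0` and `x`. -/
structure IsSaddle (w x : ℝ) : Prop where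
  pos : 0 < w
  lt_one : w < 1
  signal_pos : 0 < x
  regret_zero : gaussRegret (bayesRule w x) 0 = bayesRegret w x
  regret_signal : gaussRegret (bayesRule w x) x = bayesRegret w x
  regret_lt : ∀ y, 0 < y → y ≠ x → gaussRegret (bayesRule w x) y < bayesRegret w x

lemma IsSaddle.mem {w x : ℝ} (h : IsSaddle w x) : w ∈ Set.Icc (0 : ℝ) 1 := ⟨h.pos.le, h.lt_one.le⟩

lemma IsSaddle.value_pos {w x : ℝ} (h : IsSaddle w x) : 0 < bayesRegret w x :=
  bayesRegret_pos h.pos h.lt_one h.signal_pos.ne'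

lemma IsSaddle.regret_le {w x : ℝ} (h : IsSaddle w x) {y : ℝ} (hy : 0 ≤ y) :
    gaussRegret (bayesRule w x) y ≤ bayesRegret w x := by
  rcases hy.eq_or_lt with rfl | hy
  · exact h.regret_zero.le
  · by_cases hyx : y = x
    · rw [hyx]; exact h.regret_signal.le
    · exact (h.regret_lt y hy hyx).le

/-- An envelope argument avoids differentiating `bayesRegret`: the best reply to a perturbed prior
is a feasible rule against the optimal prior. Comparing its two Bayes regrets with the maximum gives
one-sided inequalities, which become equalities as the perturbation vanishes. -/
lemma exists_isSaddle : ∃ w x : ℝ, IsSaddle w x := by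
  obtain ⟨w, x, hw0, hw1, hx, hmax⟩ := exists_isMax_bayesRegret
  have hw : w ∈ Set.Icc (0 : ℝ) 1 := ⟨hw0.le, hw1.le⟩
  -- first-order condition in the weight
  have hfoc : ∀ w' ∈ Set.Icc (0 : ℝ) 1,
      (w' - w) * (gaussRegret (bayesRule w' x) 0 - gaussRegret (bayesRule w' x) x) ≤ 0 := by
    intro w' hw'
    have h1 := hmax w' hw' x hx.le
    have h2 := bayesRegret_le (continuous_bayesRule hw' x).measurable (bayesRule_mem_Icc hw' x) hw x
    rw [bayesRegret_eq hw' x] at h1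
    linarith
  have hIoo : Set.Ioo (0 : ℝ) 1 ∈ 𝓝 w := Ioo_mem_nhds hw0 hw1
  -- For `w' > w` and `w' < w` the inequality `hfoc` has opposite signs; letting `w' → w` from each
  -- side gives equality.
  have heq : gaussRegret (bayesRule w x) 0 = gaussRegret (bayesRule w x) x := by
    have key : ∀ l : Filter ℝ, l ≤ 𝓝 w → l.IsCountablyGenerated → ∀ y,
        Tendsto (fun w' => gaussRegret (bayesRule w' x) y) l
          (𝓝 (gaussRegret (bayesRule w x) y)) := fun l hl _ y =>
      tendsto_gaussRegret hw hl tendsto_const_nhds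
        (hl (mem_of_superset hIoo Set.Ioo_subset_Icc_self)) y
    refine le_antisymm ?_ ?_
    · refine le_of_tendsto_of_tendsto (key (𝓝[>] w) nhdsWithin_le_nhds inferInstance 0)
        (key (𝓝[>] w) nhdsWithin_le_nhds inferInstance x) ?_
      filter_upwards [nhdsWithin_le_nhds hIoo, self_mem_nhdsWithin] with w' hw' hlt
      have h := hfoc w' (Set.Ioo_subset_Icc_self hw')
      have : 0 < w' - w := sub_pos.2 hlt
      by_contra! hn
      nlinarith
    · refine le_of_tendsto_of_tendsto (key (𝓝[<] w) nhdsWithin_le_nhds inferInstance x)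
        (key (𝓝[<] w) nhdsWithin_le_nhds inferInstance 0) ?_
      filter_upwards [nhdsWithin_le_nhds hIoo, self_mem_nhdsWithin] with w' hw' hlt
      have h := hfoc w' (Set.Ioo_subset_Icc_self hw')
      have : 0 < w - w' := sub_pos.2 hlt
      by_contra! hn
      nlinarith
  -- first-order condition in the signal
  have hfoc' : ∀ x', 0 ≤ x' → gaussRegret (bayesRule w x') x' ≤ gaussRegret (bayesRule w x') x := by
    intro x' hx'
    have h1 := hmax w hw x' hx'
    have h2 := bayesRegret_le (continuous_bayesRule hw x').measurable (bayesRule_mem_Icc hw x') hw x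
    rw [bayesRegret_eq hw x'] at h1
    have : 0 < 1 - w := by linarith
    by_contra! hn
    nlinarith
  have mvt : ∀ x', 0 ≤ x' → ∀ s t, s < t → ∃ ξ ∈ Set.Ioo s t,
      Real.exp (-ξ ^ 2 / 2) * regretDrift w x' ξ =
        (gaussRegret (bayesRule w x') t - gaussRegret (bayesRule w x') s) / (t - s) :=
    fun x' hx' s t hst => exists_hasDerivAt_eq_slope (gaussRegret (bayesRule w x')) _ hst
      (fun y _ => (hasDerivAt_gaussRegret hw hx' y).continuousAt.continuousWithinAt)
      (fun y _ => hasDerivAt_gaussRegret hw hx' y)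
  -- Perturbing `x` to either side, the mean value theorem turns `hfoc'` into a sign of the drift at
  -- a point squeezed between `x` and `x'`.
  have hcrit : regretDrift w x x = 0 := by
    refine le_antisymm ?_ ?_
    · have h : ∀ x', ∃ ξ, x < x' → ξ ∈ Set.Ioo x x' ∧ regretDrift w x' ξ ≤ 0 := by
        intro x'
        by_cases hlt : x < x'
        · obtain ⟨ξ, hξ, e⟩ := mvt x' (hx.trans hlt).le x x' hlt
          refine ⟨ξ, fun _ => ⟨hξ, ?_⟩⟩
          have h1 := hfoc' x' (hx.trans hlt).le
          by_contra! hn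
          have h2 := mul_pos (Real.exp_pos (-ξ ^ 2 / 2)) hn
          rw [e, div_pos_iff_of_pos_right (sub_pos.2 hlt)] at h2
          linarith
        · exact ⟨0, fun h => absurd h hlt⟩
      choose ξ hξ using h
      have hξt : Tendsto ξ (𝓝[>] x) (𝓝 x) := by
        refine tendsto_of_tendsto_of_tendsto_of_le_of_le' tendsto_const_nhds
          (tendsto_id.mono_left nhdsWithin_le_nhds) ?_ ?_
        · filter_upwards [self_mem_nhdsWithin] with x' hx' using (hξ x' hx').1.1.le
        · filter_upwards [self_mem_nhdsWithin] with x' hx' using (hξ x' hx').1.2.le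
      refine le_of_tendsto (tendsto_regretDrift hw (tendsto_const_nhds (x := w))
        (tendsto_id.mono_left nhdsWithin_le_nhds) (Eventually.of_forall fun _ => hw) ?_ hξt) ?_
      · filter_upwards [self_mem_nhdsWithin] with x' hx' using (hx.trans hx').le
      · filter_upwards [self_mem_nhdsWithin] with x' hx' using (hξ x' hx').2
    · have h : ∀ x', ∃ ξ, 0 < x' → x' < x → ξ ∈ Set.Ioo x' x ∧ 0 ≤ regretDrift w x' ξ := by
        intro x'
        by_cases hlt : 0 < x' ∧ x' < x
        · obtain ⟨ξ, hξ, e⟩ := mvt x' hlt.1.le x' x hlt.2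
          refine ⟨ξ, fun _ _ => ⟨hξ, ?_⟩⟩
          have h1 := hfoc' x' hlt.1.le
          by_contra! hn
          have h2 := mul_neg_of_pos_of_neg (Real.exp_pos (-ξ ^ 2 / 2)) hn
          rw [e, div_neg_iff] at h2
          rcases h2 with h2 | h2 <;> linarith [h2.1, h2.2, hlt.2]
        · exact ⟨0, fun h h' => absurd ⟨h, h'⟩ hlt⟩
      choose ξ hξ using h
      have hpos : ∀ᶠ x' in 𝓝[<] x, 0 < x' := nhdsWithin_le_nhds (lt_mem_nhds hx)
      have hξt : Tendsto ξ (𝓝[<] x) (𝓝 x) := by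
        refine tendsto_of_tendsto_of_tendsto_of_le_of_le'
          (tendsto_id.mono_left nhdsWithin_le_nhds) tendsto_const_nhds ?_ ?_
        · filter_upwards [hpos, self_mem_nhdsWithin] with x' h0 hx' using (hξ x' h0 hx').1.1.le
        · filter_upwards [hpos, self_mem_nhdsWithin] with x' h0 hx' using (hξ x' h0 hx').1.2.le
      refine ge_of_tendsto (tendsto_regretDrift hw (tendsto_const_nhds (x := w))
        (tendsto_id.mono_left nhdsWithin_le_nhds) (Eventually.of_forall fun _ => hw) ?_ hξt) ?_
      · filter_upwards [hpos] with x' hx' using hx'.le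
      · filter_upwards [hpos, self_mem_nhdsWithin] with x' h0 hx' using (hξ x' h0 hx').2
  have hval : gaussRegret (bayesRule w x) x = bayesRegret w x := by
    rw [bayesRegret_eq hw x, heq]; ring
  exact ⟨w, x, hw0, hw1, hx, heq.trans hval, hval, fun y hy hyx =>
    (gaussRegret_lt_of_critical hw hw1 hx heq hcrit hy hyx).trans_eq hval⟩

/-- The equilibrium rule has equal regret at `0` and `x`, so its average regret under weight `w'` is
still the value. By `twoPoint_regret` this exceeds `bayesRegret w' x` by a weighted squared distance
between two replies, which is positive when the weights differ. -/
lemma IsSaddle.eq_of_bayesRegret_eq {w x : ℝ} (h : IsSaddle w x) {w' : ℝ}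
    (hw' : w' ∈ Set.Icc (0 : ℝ) 1) (he : bayesRegret w x ≤ bayesRegret w' x) : w' = w := by
  by_contra hne
  have hm : Measurable (bayesRule w x) := (continuous_bayesRule h.mem x).measurable
  have hm' : Measurable (bayesRule w' x) := (continuous_bayesRule hw' x).measurable
  have hd := twoPoint_regret hm (bayesRule_mem_Icc h.mem x) hw' x
  rw [h.regret_zero, h.regret_signal] at hd
  have hi : Integrable (fun z => (w' + (1 - w') * mix x z) *
      (bayesRule w x z - bayesRule w' x z) ^ 2) gauss := by
    refine ((integrable_const w').add ((integrable_mix x).const_mul (1 - w'))).mono'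
      (by fun_prop) (ae_of_all _ fun z => ?_)
    rw [Real.norm_eq_abs, mul_comm]
    refine (abs_mul_le_of_abs_le_one ?_).trans (abs_of_pos (mixWeight_pos hw' x z)).le
    rw [abs_of_nonneg (sq_nonneg _)]
    exact sq_le_one_of_mem (bayesRule_mem_Icc h.mem x z) (bayesRule_mem_Icc hw' x z)
  have hpos : 0 < ∫ z, (w' + (1 - w') * mix x z) *
      (bayesRule w x z - bayesRule w' x z) ^ 2 ∂gauss := by
    refine integral_gauss_pos hi (fun z hz => ?_)
      (mul_nonneg (mixWeight_pos hw' x 0).le (sq_nonneg _))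
    refine mul_pos (mixWeight_pos hw' x z) (sq_pos_of_ne_zero ?_)
    have l1 := lik_pos h.mem x z
    have l2 := lik_pos h.mem x (-z)
    have l3 := lik_pos hw' x z
    have l4 := lik_pos hw' x (-z)
    rw [sub_ne_zero, bayesRule, bayesRule, ne_eq, div_eq_div_iff (by positivity) (by positivity)]
    intro e
    have : (w - w') * (tilt x (-z) - tilt x z) = 0 := by
      simp only [lik] at e
      linear_combination e
    rcases mul_eq_zero.1 this with h1 | h1
    · exact hne (by linarith)
    · exact tilt_ne_tilt_neg h.signal_pos.ne' hz (by linarith)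
  linarith

/-! ### A central limit theorem for the count of high signals -/

lemma highProb_eq (n : ℕ) (θ : Bool) (c : ℝ) :
    highProb n θ c = 1 / 2 + signalMean θ c / 2 / √(n : ℝ) := by
  cases θ <;> simp [highProb, precision, signalMean]; ring

lemma highProb_mem_of_abs_le {n : ℕ} {c : ℝ} (hc : |c| ≤ √(n : ℝ) / 2) (θ : Bool) :
    0 ≤ highProb n θ c ∧ highProb n θ c ≤ 1 := by
  have h1 : |c / √(n : ℝ)| ≤ 1 / 2 := by
    rw [abs_div, abs_of_nonneg (Real.sqrt_nonneg _)]
    exact div_le_of_le_mul₀ (Real.sqrt_nonneg _) (by norm_num) (by linarith)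
  rw [abs_le] at h1
  cases θ <;> simp only [highProb, precision, if_true, Bool.false_eq_true, if_false] <;>
    constructor <;> linarith [h1.1, h1.2]

lemma countProb_nonneg_of_abs_le {n : ℕ} {c : ℝ} (hc : |c| ≤ √(n : ℝ) / 2) (θ : Bool)
    (k : Fin (n + 1)) : 0 ≤ countProb n θ c k := by
  have h := highProb_mem_of_abs_le hc θ
  have h0 := h.1
  have h' : 0 ≤ 1 - highProb n θ c := by linarith [h.2]
  unfold countProb
  positivity

/-- The excess `2 k - n` of high signals over low signals. -/
def excess {n : ℕ} (k : Fin (n + 1)) : ℝ := 2 * (k : ℝ) - n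

/-- The expectation of `f` at the excess of high signals in state `θ`. -/
def countMean (n : ℕ) (θ : Bool) (c : ℝ) (f : ℝ → ℝ) : ℝ :=
  ∑ k : Fin (n + 1), countProb n θ c k * f (excess k)

/-- The law of the scaled excess of high signals. -/
def excessLaw (n : ℕ) (θ : Bool) (c s : ℝ) : Measure ℝ :=
  ∑ k : Fin (n + 1), ENNReal.ofReal (countProb n θ c k) • Measure.dirac (s * excess k)

lemma isProbabilityMeasure_excessLaw {n : ℕ} {c : ℝ} (hc : |c| ≤ √(n : ℝ) / 2) (θ : Bool) (s : ℝ) :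
    IsProbabilityMeasure (excessLaw n θ c s) := by
  constructor
  simp only [excessLaw, Measure.coe_finsetSum, Finset.sum_apply, Measure.smul_apply, measure_univ,
    smul_eq_mul, mul_one]
  rw [← ENNReal.ofReal_sum_of_nonneg fun k _ => countProb_nonneg_of_abs_le hc θ k,
    sum_countProb, ENNReal.ofReal_one]

lemma integral_excessLaw {E : Type*} [NormedAddCommGroup E] [NormedSpace ℝ E] [CompleteSpace E]
    {n : ℕ} {c : ℝ} (hc : |c| ≤ √(n : ℝ) / 2) (θ : Bool) (s : ℝ) (f : ℝ → E) :
    ∫ y, f y ∂excessLaw n θ c s = ∑ k : Fin (n + 1), countProb n θ c k • f (s * excess k) := by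
  rw [excessLaw, integral_finsetSum_measure]
  · refine Finset.sum_congr rfl fun k _ => ?_
    rw [integral_smul_measure, integral_dirac,
      ENNReal.toReal_ofReal (countProb_nonneg_of_abs_le hc θ k)]
  · intro k _
    exact (integrable_dirac (by simp)).smul_measure ENNReal.ofReal_ne_top

/-- The binomial theorem for a sum of `n` signs; the form `(1 + g) ^ n` prepares the limit in which
`n g` converges. -/
lemma charFun_excessLaw {n : ℕ} {c : ℝ} (hc : |c| ≤ √(n : ℝ) / 2) (θ : Bool) (s t : ℝ) :
    charFun (excessLaw n θ c s) t =
      (1 + (((Real.cos (s * t) - 1 : ℝ) : ℂ) +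
        ((signalMean θ c / √(n : ℝ) * Real.sin (s * t) : ℝ) : ℂ) * Complex.I)) ^ n := by
  rw [charFun_apply_real, integral_excessLaw hc]
  set p := highProb n θ c with hp
  have h1 : (1 + (((Real.cos (s * t) - 1 : ℝ) : ℂ) +
        ((signalMean θ c / √(n : ℝ) * Real.sin (s * t) : ℝ) : ℂ) * Complex.I)) =
      (p : ℂ) * Complex.exp ((s * t : ℝ) * Complex.I)
        + ((1 - p : ℝ) : ℂ) * Complex.exp (-((s * t : ℝ) * Complex.I)) := by
    rw [← neg_mul, ← Complex.ofReal_neg, Complex.exp_mul_I, Complex.exp_mul_I,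
      ← Complex.ofReal_cos, ← Complex.ofReal_sin, ← Complex.ofReal_cos, ← Complex.ofReal_sin,
      Real.cos_neg, Real.sin_neg, hp, highProb_eq]
    push_cast
    ring
  rw [h1, add_pow, ← Fin.sum_univ_eq_sum_range (fun m =>
    ((p : ℂ) * Complex.exp ((s * t : ℝ) * Complex.I)) ^ m *
    (((1 - p : ℝ) : ℂ) * Complex.exp (-((s * t : ℝ) * Complex.I))) ^ (n - m) * (n.choose m : ℂ))]
  refine Finset.sum_congr rfl fun k _ => ?_
  have hk : (k : ℕ) ≤ n := Nat.lt_succ_iff.1 k.2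
  have h2 : Complex.exp ((t : ℂ) * ((s * excess k : ℝ) : ℂ) * Complex.I) =
      Complex.exp ((s * t : ℝ) * Complex.I) ^ (k : ℕ) *
        Complex.exp (-((s * t : ℝ) * Complex.I)) ^ (n - (k : ℕ)) := by
    rw [← Complex.exp_nat_mul, ← Complex.exp_nat_mul, ← Complex.exp_add, Nat.cast_sub hk, excess]
    congr 1
    push_cast
    ring
  rw [h2, countProb, Complex.real_smul, mul_pow, mul_pow]
  push_cast
  ring

/-- Since `N g` is bounded and `g → 0`, the error `N (log (1 + g) - g)` is of order `‖N g‖ ‖g‖`. The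
threshold `1/2` makes the factor `(1 - ‖g‖)⁻¹` in the logarithm estimate at most `2`. -/
lemma tendsto_one_add_pow_exp {ι : Type*} {l : Filter ι} {N : ι → ℕ} {g : ι → ℂ} {t : ℂ}
    (hN : Tendsto N l atTop) (hg : Tendsto (fun i => (N i : ℂ) * g i) l (𝓝 t)) :
    Tendsto (fun i => (1 + g i) ^ N i) l (𝓝 (Complex.exp t)) := by
  have hNr : Tendsto (fun i => ((N i : ℝ))⁻¹) l (𝓝 0) :=
    tendsto_inv_atTop_zero.comp (tendsto_natCast_atTop_atTop.comp hN)
  have hNc : Tendsto (fun i => ((N i : ℂ))⁻¹) l (𝓝 0) := by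
    have := (Complex.continuous_ofReal.tendsto 0).comp hNr
    simpa [Function.comp_def] using this
  have hpos : ∀ᶠ i in l, 0 < N i := hN.eventually_gt_atTop 0
  have hg0 : Tendsto g l (𝓝 0) := by
    have h := hNc.mul hg
    rw [zero_mul] at h
    refine h.congr' ?_
    filter_upwards [hpos] with i hi
    have : (N i : ℂ) ≠ 0 := by exact_mod_cast hi.ne'
    field_simp
  have hsmall : ∀ᶠ i in l, ‖g i‖ < 1 / 2 := by
    have := hg0.norm
    rw [norm_zero] at this
    exact this.eventually (gt_mem_nhds (by norm_num))
  have herr : Tendsto (fun i => (N i : ℂ) * (Complex.log (1 + g i) - g i)) l (𝓝 0) := by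
    rw [tendsto_zero_iff_norm_tendsto_zero]
    have hb : Tendsto (fun i => ‖(N i : ℂ) * g i‖ * ‖g i‖) l (𝓝 0) := by
      have := hg.norm.mul hg0.norm
      simpa using this
    refine squeeze_zero' (Eventually.of_forall fun i => norm_nonneg _) ?_ hb
    filter_upwards [hsmall] with i hi
    have h := Complex.norm_log_one_add_sub_self_le (hi.trans (by norm_num))
    have h2 : (1 - ‖g i‖)⁻¹ ≤ 2 := by
      rw [inv_le_comm₀ (by linarith) two_pos]; linarith
    rw [norm_mul, norm_mul]
    calc ‖(N i : ℂ)‖ * ‖Complex.log (1 + g i) - g i‖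
        ≤ ‖(N i : ℂ)‖ * (‖g i‖ ^ 2 * 2 / 2) := by
          gcongr
          exact h.trans (by gcongr)
      _ = ‖(N i : ℂ)‖ * ‖g i‖ * ‖g i‖ := by ring
  have hsum := herr.add hg
  rw [zero_add] at hsum
  refine ((Complex.continuous_exp.tendsto t).comp hsum).congr' ?_
  filter_upwards [hsmall] with i hi
  have h1 : 1 + g i ≠ 0 := by
    intro h
    have : g i = -1 := by linear_combination h
    rw [this, norm_neg, norm_one] at hi
    norm_num at hi
  simp only [Function.comp_apply]
  rw [← mul_add, sub_add_cancel, Complex.exp_nat_mul, Complex.exp_log h1]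

lemma continuous_signalMean (θ : Bool) : Continuous (signalMean θ) := by
  cases θ
  · change Continuous fun c : ℝ => -(2 * c)
    fun_prop
  · change Continuous fun c : ℝ => 2 * c
    fun_prop

/-- The cosine supplies the variance and the sine the mean of the limit. The scale `s` is left free
since both `1/√n` and the log-likelihood slope are needed. -/
lemma tendsto_charFun_excessLaw {N : ℕ → ℕ} {c s : ℕ → ℝ} {c₀ τ : ℝ} (hN : Tendsto N atTop atTop)
    (hc : Tendsto c atTop (𝓝 c₀)) (hs : Tendsto (fun j => √(N j : ℝ) * s j) atTop (𝓝 τ))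
    (hcN : ∀ j, |c j| ≤ √(N j : ℝ) / 2) (θ : Bool) (t : ℝ) :
    Tendsto (fun j => charFun (excessLaw (N j) θ (c j) (s j)) t) atTop
      (𝓝 (charFun (gauss.map fun W => τ * (signalMean θ c₀ + W)) t)) := by
  have hmap : gauss.map (fun W => τ * (signalMean θ c₀ + W)) =
      gaussianReal (τ * signalMean θ c₀) (.mk (τ ^ 2) (sq_nonneg _)) := by
    have h : (fun W => τ * (signalMean θ c₀ + W)) =
      (fun y => τ * y) ∘ fun W => signalMean θ c₀ + W := rfl
    rw [h, ← Measure.map_map (by fun_prop) (by fun_prop), gaussianReal_map_const_add,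
      gaussianReal_map_const_mul, zero_add, mul_one]
  rw [hmap, charFun_gaussianReal]
  simp_rw [charFun_excessLaw (hcN _)]
  refine tendsto_one_add_pow_exp hN ?_
  have hsq : Tendsto (fun j => √(N j : ℝ)) atTop atTop :=
    Real.tendsto_sqrt_atTop.comp (tendsto_natCast_atTop_atTop.comp hN)
  have hpos : ∀ᶠ j in atTop, 0 < √(N j : ℝ) := hsq.eventually_gt_atTop 0
  have hs0 : Tendsto s atTop (𝓝 0) := by
    have h := (tendsto_inv_atTop_zero.comp hsq).mul hs
    rw [zero_mul] at h
    refine h.congr' ?_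
    filter_upwards [hpos] with j hj
    simp only [Function.comp_apply]
    field_simp
  have hu : Tendsto (fun j => √(N j : ℝ) * (s j * t)) atTop (𝓝 (τ * t)) := by
    refine (hs.mul_const t).congr fun j => by ring
  have hu0 : Tendsto (fun j => s j * t) atTop (𝓝 0) := by simpa using hs0.mul_const t
  have hsinc : Tendsto (fun j => Real.sinc (s j * t)) atTop (𝓝 1) := by
    have := (Real.continuous_sinc.tendsto 0).comp hu0
    rwa [Real.sinc_zero] at this
  have hsinc2 : Tendsto (fun j => Real.sinc (s j * t / 2)) atTop (𝓝 1) := by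
    have := (Real.continuous_sinc.tendsto 0).comp (by simpa using hu0.div_const 2)
    rwa [Real.sinc_zero] at this
  -- Expressing sine through `Real.sinc` avoids a case distinction where `s j * t = 0`.
  have hsin : ∀ y, Real.sin y = y * Real.sinc y := by
    intro y
    by_cases hy : y = 0
    · simp [hy]
    · rw [Real.sinc_of_ne_zero hy]; field_simp
  have h1 : Tendsto (fun j => (N j : ℝ) * (Real.cos (s j * t) - 1)) atTop
      (𝓝 (-(τ ^ 2 * t ^ 2 / 2))) := by
    have h := ((hu.pow 2).mul (hsinc2.pow 2)).neg.div_const 2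
    refine (h.congr fun j => ?_).trans (by rw [one_pow, mul_one]; apply le_of_eq; congr 1; ring)
    have hc1 : Real.cos (s j * t) - 1 = -2 * Real.sin (s j * t / 2) ^ 2 := by
      have h := Real.cos_two_mul (s j * t / 2)
      rw [mul_div_cancel₀ _ two_ne_zero] at h
      have h2 := Real.sin_sq_add_cos_sq (s j * t / 2)
      linarith
    rw [hc1, hsin (s j * t / 2), mul_pow, Real.sq_sqrt (Nat.cast_nonneg _)]
    ring
  have h2 : Tendsto (fun j => (N j : ℝ) * (signalMean θ (c j) / √(N j : ℝ) * Real.sin (s j * t)))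
      atTop (𝓝 (t * (τ * signalMean θ c₀))) := by
    have h := (((continuous_signalMean θ).tendsto c₀).comp hc).mul (hu.mul hsinc)
    refine (h.congr' ?_).trans (by rw [mul_one]; apply le_of_eq; congr 1; ring)
    filter_upwards [hpos] with j hj
    simp only [Function.comp_apply]
    rw [hsin (s j * t)]
    have : (N j : ℝ) = √(N j : ℝ) * √(N j : ℝ) := (Real.mul_self_sqrt (Nat.cast_nonneg _)).symm
    rw [div_mul_eq_mul_div, mul_div_assoc', eq_div_iff hj.ne']
    nth_rewrite 3 [this]
    ring
  have h3 := ((Complex.continuous_ofReal.tendsto _).comp h1).add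
    (((Complex.continuous_ofReal.tendsto _).comp h2).mul_const Complex.I)
  refine (h3.congr fun j => ?_).trans (le_of_eq ?_)
  · simp only [Function.comp_apply]
    push_cast
    ring
  · congr 1
    push_cast
    ring

lemma tendsto_countMean_seq {N : ℕ → ℕ} {c s : ℕ → ℝ} {c₀ τ : ℝ} (hN : Tendsto N atTop atTop)
    (hc : Tendsto c atTop (𝓝 c₀)) (hs : Tendsto (fun j => √(N j : ℝ) * s j) atTop (𝓝 τ))
    (hcN : ∀ j, |c j| ≤ √(N j : ℝ) / 2) (θ : Bool) {f : ℝ → ℝ} (hf : Continuous f) {C : ℝ}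
    (hC : ∀ y, |f y| ≤ C) :
    Tendsto (fun j => countMean (N j) θ (c j) (fun y => f (s j * y))) atTop
      (𝓝 (∫ W, f (τ * (signalMean θ c₀ + W)) ∂gauss)) := by
  have hm : Measurable fun W : ℝ => τ * (signalMean θ c₀ + W) := by fun_prop
  have : IsProbabilityMeasure (gauss.map fun W => τ * (signalMean θ c₀ + W)) :=
    Measure.isProbabilityMeasure_map hm.aemeasurable
  let μ : ℕ → ProbabilityMeasure ℝ := fun j =>
    ⟨excessLaw (N j) θ (c j) (s j), isProbabilityMeasure_excessLaw (hcN j) θ (s j)⟩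
  let μ₀ : ProbabilityMeasure ℝ := ⟨gauss.map fun W => τ * (signalMean θ c₀ + W), this⟩
  have hμ : Tendsto μ atTop (𝓝 μ₀) :=
    ProbabilityMeasure.tendsto_of_tendsto_charFun fun t =>
      tendsto_charFun_excessLaw hN hc hs hcN θ t
  have h := (ProbabilityMeasure.tendsto_iff_forall_integral_tendsto.1 hμ)
    (BoundedContinuousFunction.ofNormedAddCommGroup f hf C hC)
  refine (h.congr fun j => ?_).trans (le_of_eq ?_)
  · exact integral_excessLaw (hcN j) θ (s j) f
  · congr 1
    exact integral_map hm.aemeasurable hf.aestronglyMeasurable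

/-- The central limit theorem for the scaled excess of high signals. -/
lemma tendsto_countMean {ι : Type*} {l : Filter ι} [l.IsCountablyGenerated] {N : ι → ℕ}
    {c s : ι → ℝ} {c₀ τ : ℝ} (hN : Tendsto N l atTop)
    (hc : Tendsto c l (𝓝 c₀)) (hs : Tendsto (fun j => √(N j : ℝ) * s j) l (𝓝 τ))
    (θ : Bool) {f : ℝ → ℝ} (hf : Continuous f) {C : ℝ} (hC : ∀ y, |f y| ≤ C) :
    Tendsto (fun j => countMean (N j) θ (c j) (fun y => f (s j * y))) l
      (𝓝 (∫ W, f (τ * (signalMean θ c₀ + W)) ∂gauss)) := by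
  refine tendsto_of_seq_tendsto fun u hu => ?_
  have hN' := hN.comp hu
  have hc' := hc.comp hu
  have hsq : Tendsto (fun j => √(N (u j) : ℝ)) atTop atTop :=
    Real.tendsto_sqrt_atTop.comp (tendsto_natCast_atTop_atTop.comp hN')
  have hev : ∀ᶠ j in atTop, |c (u j)| ≤ √(N (u j) : ℝ) / 2 := by
    filter_upwards [hc'.abs.eventually (ge_mem_nhds (lt_add_one |c₀|)),
      hsq.eventually_ge_atTop (2 * (|c₀| + 1))] with j h1 h2
    simp only [Function.comp_apply] at h1
    linarith
  -- The binomial weights are only known to be nonnegative once `|c| ≤ √N / 2`, so the sequence is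
  -- shifted past finitely many indices.
  obtain ⟨J, hJ⟩ := eventually_atTop.1 hev
  rw [← tendsto_add_atTop_iff_nat J]
  exact tendsto_countMean_seq (N := fun j => N (u (j + J))) (c := fun j => c (u (j + J)))
    (s := fun j => s (u (j + J)))
    ((tendsto_add_atTop_iff_nat J).2 hN') ((tendsto_add_atTop_iff_nat J).2 hc')
    ((tendsto_add_atTop_iff_nat (f := fun j => √(N (u j) : ℝ) * s (u j)) J).2 (hs.comp hu))
    (fun j => hJ _ (Nat.le_add_left _ _)) θ hf hC

/-! ### Asymptotics of the finite regret -/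

lemma marginalProb_mul_sq {n : ℕ} {c : ℝ} (hc : |c| ≤ √(n : ℝ) / 2) (k : Fin (n + 1)) (t : ℝ) :
    marginalProb n c k * (oracle n c k - t) ^ 2 =
      countProb n true c k * (1 - t) ^ 2 / 2 + countProb n false c k * t ^ 2 / 2 -
        countProb n true c k * (countProb n false c k /
          (countProb n true c k + countProb n false c k)) / 2 := by
  have h1 := countProb_nonneg_of_abs_le hc true k
  have h0 := countProb_nonneg_of_abs_le hc false k
  rw [oracle, marginalProb]
  -- At counts of probability zero in both states, both sides vanish whatever value division by zero
  -- takes.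
  rcases (add_nonneg h1 h0).eq_or_lt with h | h
  · have e1 : countProb n true c k = 0 := by linarith
    have e0 : countProb n false c k = 0 := by linarith
    simp [e1, e0]
  · field_simp
    ring

lemma marginalProb_nonneg {n : ℕ} {c : ℝ} (hc : |c| ≤ √(n : ℝ) / 2) (k : Fin (n + 1)) :
    0 ≤ marginalProb n c k := by
  have h1 := countProb_nonneg_of_abs_le hc true k
  have h0 := countProb_nonneg_of_abs_le hc false k
  unfold marginalProb
  positivity

lemma sum_marginalProb (n : ℕ) (c : ℝ) : ∑ k, marginalProb n c k = 1 := by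
  simp only [marginalProb]
  rw [← Finset.sum_div, Finset.sum_add_distrib, sum_countProb, sum_countProb]
  norm_num

lemma oracle_mem {n : ℕ} {c : ℝ} (hc : |c| ≤ √(n : ℝ) / 2) (k : Fin (n + 1)) :
    oracle n c k ∈ Set.Icc (0 : ℝ) 1 := by
  have h1 := countProb_nonneg_of_abs_le hc true k
  have h0 := countProb_nonneg_of_abs_le hc false k
  have hm := marginalProb_nonneg hc k
  refine ⟨div_nonneg (by positivity) hm, div_le_one_of_le₀ ?_ hm⟩
  rw [marginalProb]
  linarith

lemma regretAt_mem {n : ℕ} {a : Fin (n + 1) → ℝ} (ha : ∀ k, a k ∈ Set.Icc (0 : ℝ) 1) {c : ℝ}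
    (hc : |c| ≤ √(n : ℝ) / 2) : regretAt n a c ∈ Set.Icc (0 : ℝ) 1 := by
  refine ⟨Finset.sum_nonneg fun k _ => mul_nonneg (marginalProb_nonneg hc k) (sq_nonneg _), ?_⟩
  rw [← sum_marginalProb n c]
  refine Finset.sum_le_sum fun k _ => ?_
  exact mul_le_of_le_one_right (marginalProb_nonneg hc k)
    (sq_le_one_of_mem (oracle_mem hc k) (ha k))

lemma abs_le_of_mem_Icc {n : ℕ} (c : Set.Icc (0 : ℝ) (√(n : ℝ) / 2)) :
    |(c : ℝ)| ≤ √(n : ℝ) / 2 := by rw [abs_of_nonneg c.2.1]; exact c.2.2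

/-! ### Exponential tilting of the binomial laws and the local limit of the regret -/

/-- The log-likelihood ratio of a high signal. -/
def logOdds (n : ℕ) (c : ℝ) : ℝ := Real.log (1 + 2 * c / √(n : ℝ)) - Real.log (1 - 2 * c / √(n : ℝ))

/-- The normalising factor of the tilted binomial law. -/
def tiltFactor (n : ℕ) (c : ℝ) : ℝ := Real.exp (n / 2 * Real.log (1 - (2 * c / √(n : ℝ)) ^ 2))

/-- With `u = 2c/√n`, the likelihood ratio to a fair coin is `(1 + u)^k (1 - u)^(n-k) = (1 -
u²)^(n/2) ((1 + u)/(1 - u))^((2k-n)/2)`. It depends on the count only through the excess, mirroring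
`tilt`. -/
lemma countProb_true_eq {n : ℕ} {c : ℝ} (hc : |2 * c / √(n : ℝ)| < 1) (k : Fin (n + 1)) :
    countProb n true c k = countProb n true 0 k *
      (tiltFactor n c * Real.exp (logOdds n c / 2 * excess k)) := by
  have hk : (k : ℕ) ≤ n := Nat.lt_succ_iff.1 k.2
  rw [abs_lt] at hc
  have e1 : highProb n true c = 1 / 2 * (1 + 2 * c / √(n : ℝ)) := by
    simp only [highProb, precision, if_true]; ring
  have e0 : highProb n true 0 = 1 / 2 := by simp [highProb, precision]
  set u := 2 * c / √(n : ℝ) with hu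
  have hp : 0 < 1 + u := by linarith [hc.1]
  have hq : 0 < 1 - u := by linarith [hc.2]
  have e2 : 1 - 1 / 2 * (1 + u) = 1 / 2 * (1 - u) := by ring
  have e3 : (1 + u) ^ (k : ℕ) * (1 - u) ^ (n - (k : ℕ)) =
      tiltFactor n c * Real.exp (logOdds n c / 2 * excess k) := by
    rw [← Real.exp_log hp, ← Real.exp_log hq, ← Real.exp_nat_mul, ← Real.exp_nat_mul,
      ← Real.exp_add, tiltFactor, ← Real.exp_add, logOdds, ← hu,
      show 1 - u ^ 2 = (1 + u) * (1 - u) by ring, Real.log_mul hp.ne' hq.ne', Nat.cast_sub hk,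
      excess]
    congr 1
    ring
  simp only [countProb, e1, e0]
  rw [← e3, e2, mul_pow, mul_pow]
  norm_num
  ring

lemma countProb_false_eq {n : ℕ} {c : ℝ} (hc : |2 * c / √(n : ℝ)| < 1) (k : Fin (n + 1)) :
    countProb n false c k = countProb n true 0 k *
      (tiltFactor n c * Real.exp (-(logOdds n c / 2 * excess k))) := by
  have h : countProb n false c k = countProb n true (-c) k := by
    simp only [countProb, highProb, precision, if_true, Bool.false_eq_true, if_false]
    rw [show 1 - (1 / 2 + c / √(n : ℝ)) = 1 / 2 + -c / √(n : ℝ) by ring]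
  have h2 : logOdds n (-c) = -logOdds n c := by
    simp only [logOdds, mul_neg, neg_div, sub_neg_eq_add, ← sub_eq_add_neg]
    ring
  have h3 : tiltFactor n (-c) = tiltFactor n c := by
    simp only [tiltFactor, mul_neg, neg_div, even_two.neg_pow]
  rw [h, countProb_true_eq (by rwa [mul_neg, neg_div, abs_neg]), h2, h3, neg_div, neg_mul]

lemma countProb_zero_pos (n : ℕ) (k : Fin (n + 1)) : 0 < countProb n true 0 k := by
  have : 0 < n.choose k := Nat.choose_pos (Nat.lt_succ_iff.1 k.2)
  simp only [countProb, highProb, precision, if_true, zero_div, add_zero]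
  norm_num
  exact this

lemma tiltFactor_pos (n : ℕ) (c : ℝ) : 0 < tiltFactor n c := Real.exp_pos _

section Limits

variable {ι : Type*} {l : Filter ι}

/-- A first-order expansion through `dslope`, which stays continuous at `0`, so indices with `u i =
0` need no separate treatment. -/
lemma tendsto_mul_of_hasDerivAt {f : ℝ → ℝ} {f' : ℝ} (hf : HasDerivAt f f' 0) (h0 : f 0 = 0)
    {r u : ι → ℝ} {τ : ℝ} (hu : Tendsto u l (𝓝 0)) (hru : Tendsto (fun i => r i * u i) l (𝓝 τ)) :
    Tendsto (fun i => r i * f (u i)) l (𝓝 (τ * f')) := by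
  have hc : ContinuousAt (dslope f 0) 0 := continuousAt_dslope_same.2 hf.differentiableAt
  have h := hc.tendsto.comp hu
  rw [dslope_same, hf.deriv] at h
  refine (hru.mul h).congr fun i => ?_
  have := sub_smul_dslope f 0 (u i)
  rw [sub_zero, smul_eq_mul, h0, sub_zero] at this
  simp only [Function.comp_apply]
  rw [mul_assoc, this]

variable {N : ι → ℕ} {c : ι → ℝ} {c₀ : ℝ}

lemma tendsto_sqrt_natCast (hN : Tendsto N l atTop) : Tendsto (fun i => √(N i : ℝ)) l atTop :=
  Real.tendsto_sqrt_atTop.comp (tendsto_natCast_atTop_atTop.comp hN)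

lemma tendsto_two_mul_div_sqrt (hN : Tendsto N l atTop) (hc : Tendsto c l (𝓝 c₀)) :
    Tendsto (fun i => 2 * c i / √(N i : ℝ)) l (𝓝 0) :=
  (hc.const_mul 2).div_atTop (tendsto_sqrt_natCast hN)

lemma tendsto_logOdds (hN : Tendsto N l atTop) (hc : Tendsto c l (𝓝 c₀)) :
    Tendsto (fun i => √(N i : ℝ) * logOdds (N i) (c i)) l (𝓝 (2 * (2 * c₀))) := by
  have hd : HasDerivAt (fun u : ℝ => Real.log (1 + u) - Real.log (1 - u)) 2 0 := by
    have h1 := ((hasDerivAt_id (0 : ℝ)).const_add 1).log (by norm_num)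
    have h2 := ((hasDerivAt_id (0 : ℝ)).const_sub 1).log (by norm_num)
    refine (h1.sub h2).congr_deriv ?_
    norm_num
  rw [mul_comm 2 (2 * c₀)]
  refine tendsto_mul_of_hasDerivAt hd (by simp) (tendsto_two_mul_div_sqrt hN hc) ?_
  refine (hc.const_mul 2).congr' ?_
  filter_upwards [(tendsto_sqrt_natCast hN).eventually_gt_atTop 0] with i hi
  field_simp

lemma tendsto_tiltFactor (hN : Tendsto N l atTop) (hc : Tendsto c l (𝓝 c₀)) :
    Tendsto (fun i => tiltFactor (N i) (c i)) l (𝓝 (Real.exp (-(2 * c₀) ^ 2 / 2))) := by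
  have hd : HasDerivAt (fun u : ℝ => Real.log (1 - u)) (-1) 0 := by
    refine (((hasDerivAt_id (0 : ℝ)).const_sub 1).log (by norm_num)).congr_deriv ?_
    norm_num
  refine (Real.continuous_exp.tendsto _).comp ?_
  have hu := (tendsto_two_mul_div_sqrt hN hc).pow 2
  rw [zero_pow two_ne_zero] at hu
  have h := tendsto_mul_of_hasDerivAt (r := fun i => (N i : ℝ) / 2) (τ := (2 * c₀) ^ 2 / 2) hd
    (by simp) hu ?_
  · refine h.trans (le_of_eq ?_)
    congr 1
    ring
  · refine (((hc.const_mul 2).pow 2).div_const 2).congr' ?_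
    filter_upwards [hN.eventually_gt_atTop 0] with i hi
    have : (0 : ℝ) < N i := by exact_mod_cast hi
    rw [div_pow, Real.sq_sqrt this.le]
    field_simp

lemma eventually_abs_lt_one (hN : Tendsto N l atTop) (hc : Tendsto c l (𝓝 c₀)) :
    ∀ᶠ i in l, |2 * c i / √(N i : ℝ)| < 1 := by
  have := (tendsto_two_mul_div_sqrt hN hc).abs
  rw [abs_zero] at this
  exact this.eventually (gt_mem_nhds one_pos)

lemma abs_le_of_abs_lt_one {n : ℕ} (hn : 0 < n) {c : ℝ} (h : |2 * c / √(n : ℝ)| < 1) :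
    |c| ≤ √(n : ℝ) / 2 := by
  have hs : 0 < √(n : ℝ) := Real.sqrt_pos.2 (by exact_mod_cast hn)
  rw [abs_div, abs_mul, abs_of_pos hs, div_lt_one hs, abs_two] at h
  linarith

/-- The rule that applies `a` to the normalised excess of high signals. -/
def normalizedRule (a : ℝ → ℝ) (n : ℕ) (k : Fin (n + 1)) : ℝ := a ((√(n : ℝ))⁻¹ * excess k)

/-- The mean of `p (1 - p)` is half the mean of `1 - p` in state `1`. This is a bounded continuous
function of the log-likelihood ratio, to which the central limit theorem applies. -/
lemma oracleLoss_eq (x : ℝ) :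
    oracleLoss x = (∫ W, (1 + Real.exp (2 * x * (x + W)))⁻¹ ∂gauss) / 2 := by
  rw [← integral_tilt_mul x (fun z => (1 + Real.exp (2 * x * z))⁻¹), oracleLoss,
    ← integral_const_mul, ← integral_div]
  refine integral_congr_ae (ae_of_all _ fun z => ?_)
  simp only
  have h1 : tilt x z = Real.exp (-x ^ 2 / 2) * Real.exp (x * z) := by
    rw [tilt, ← Real.exp_add]; ring_nf
  have h2 : Real.exp (2 * x * z) = Real.exp (x * z) * Real.exp (x * z) := by
    rw [← Real.exp_add]; ring_nf
  have h3 := Real.exp_pos (x * z)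
  rw [sech, Real.cosh_eq, h1, h2, Real.exp_neg]
  field_simp
  ring

variable [l.IsCountablyGenerated]

/-- The regret of a normalised rule converges to the limit regret, along convergent parameters. -/
lemma tendsto_regretAt (hN : Tendsto N l atTop) (hc : Tendsto c l (𝓝 c₀)) {a : ℝ → ℝ}
    (ha : Continuous a) (h01 : ∀ z, a z ∈ Set.Icc (0 : ℝ) 1) :
    Tendsto (fun i => regretAt (N i) (normalizedRule a (N i)) (c i)) l
      (𝓝 (gaussRegret a (2 * c₀))) := by
  have hs1 : Tendsto (fun i => √(N i : ℝ) * (√(N i : ℝ))⁻¹) l (𝓝 1) := by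
    refine tendsto_const_nhds.congr' ?_
    filter_upwards [(tendsto_sqrt_natCast hN).eventually_gt_atTop 0] with i hi
    rw [mul_inv_cancel₀ hi.ne']
  have hb : ∀ z, |a z ^ 2| ≤ 1 := fun z => by
    rw [abs_pow, abs_of_nonneg (h01 _).1]; exact pow_le_one₀ (h01 _).1 (h01 _).2
  have hb' : ∀ z, |(1 - a z) ^ 2| ≤ 1 := fun z => by
    rw [abs_of_nonneg (sq_nonneg _)]; exact sq_le_one_of_mem ⟨zero_le_one, le_rfl⟩ (h01 z)
  have hb'' : ∀ y : ℝ, |(1 + Real.exp y)⁻¹| ≤ 1 := fun y => by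
    have := Real.exp_pos y
    rw [abs_of_pos (by positivity)]
    exact inv_le_one_of_one_le₀ (by linarith)
  have t1 := tendsto_countMean hN hc hs1 true (f := fun y => (1 - a y) ^ 2) (by fun_prop) hb'
  have t0 := tendsto_countMean hN hc hs1 false (f := fun y => a y ^ 2) (by fun_prop) hb
  have hcont : Continuous fun y : ℝ => (1 + Real.exp y)⁻¹ :=
    Continuous.inv₀ (by fun_prop) fun y => by have := Real.exp_pos y; positivity
  -- The finite oracle gives state `0` the probability `(1 + exp (logOdds * excess))⁻¹`, so here the
  -- scale of the excess is the log-likelihood slope.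
  have t2 := tendsto_countMean hN hc (tendsto_logOdds hN hc) true hcont hb''
  have ht := ((t1.div_const 2).add (t0.div_const 2)).sub (t2.div_const 2)
  have hlim : (∫ W, (1 - a (1 * (signalMean true c₀ + W))) ^ 2 ∂gauss) / 2 +
      (∫ W, a (1 * (signalMean false c₀ + W)) ^ 2 ∂gauss) / 2 -
      (∫ W, (1 + Real.exp (2 * (2 * c₀) * (signalMean true c₀ + W)))⁻¹ ∂gauss) / 2 =
      gaussRegret a (2 * c₀) := by
    rw [gaussRegret_eq ha.measurable h01, oracleLoss_eq]
    simp [signalMean]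
  rw [hlim] at ht
  refine ht.congr' ?_
  filter_upwards [eventually_abs_lt_one hN hc, hN.eventually_gt_atTop 0] with i hi hi0
  have hci := abs_le_of_abs_lt_one hi0 hi
  simp only [countMean, regretAt]
  rw [Finset.sum_div, Finset.sum_div, Finset.sum_div, ← Finset.sum_add_distrib,
    ← Finset.sum_sub_distrib]
  refine Finset.sum_congr rfl fun k _ => ?_
  rw [marginalProb_mul_sq hci, normalizedRule]
  congr 3
  rw [countProb_true_eq hi, countProb_false_eq hi]
  have hp := countProb_zero_pos (N i) k
  have hκ := tiltFactor_pos (N i) (c i)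
  rw [show logOdds (N i) (c i) * excess k = logOdds (N i) (c i) / 2 * excess k +
    logOdds (N i) (c i) / 2 * excess k by ring, Real.exp_add, Real.exp_neg]
  have he := Real.exp_pos (logOdds (N i) (c i) / 2 * excess k)
  field_simp
  ring

end Limits

/-! ### Uniform bounds on the regret of a normalised rule -/

/-- The exponential moment of the normalised excess, in the unfavourable direction. -/
lemma countMean_exp_le {n : ℕ} (hn : 0 < n) (c : Set.Icc (0 : ℝ) (√(n : ℝ) / 2)) :
    countMean n true c (fun y => Real.exp (-((√(n : ℝ))⁻¹ * y))) ≤ Real.exp (1 - 2 * c) ∧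
    countMean n false c (fun y => Real.exp ((√(n : ℝ))⁻¹ * y)) ≤ Real.exp (1 - 2 * c) := by
  have hn1 : (1 : ℝ) ≤ n := by exact_mod_cast hn
  have hs1 : 1 ≤ √(n : ℝ) := by rw [Real.one_le_sqrt]; exact hn1
  set s := (√(n : ℝ))⁻¹ with hs
  have hs0 : 0 < s := by positivity
  have hsle : s ≤ 1 := inv_le_one_of_one_le₀ hs1
  obtain ⟨hp0, hp1⟩ := precision_mem n c
  set p := precision n c with hp
  have key : ∀ (q t : ℝ), ∑ k : Fin (n + 1), (n.choose k : ℝ) * q ^ (k : ℕ) * (1 - q) ^ (n - (k : ℕ)) *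
      Real.exp (t * excess k) = (q * Real.exp t + (1 - q) * Real.exp (-t)) ^ n := by
    intro q t
    rw [add_pow, ← Fin.sum_univ_eq_sum_range (fun m => (q * Real.exp t) ^ m *
      ((1 - q) * Real.exp (-t)) ^ (n - m) * (n.choose m : ℝ))]
    refine Finset.sum_congr rfl fun k _ => ?_
    have hk : (k : ℕ) ≤ n := Nat.lt_succ_iff.1 k.2
    have : Real.exp (t * excess k) = Real.exp t ^ (k : ℕ) * Real.exp (-t) ^ (n - (k : ℕ)) := by
      rw [← Real.exp_nat_mul, ← Real.exp_nat_mul, ← Real.exp_add, Nat.cast_sub hk, excess]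
      congr 1
      ring
    rw [this, mul_pow, mul_pow]
    ring
  have e1 : Real.exp (-s) ≤ 1 - s + s ^ 2 := by
    have := Real.abs_exp_sub_one_sub_id_le (x := -s) (by rw [abs_neg, abs_of_pos hs0]; exact hsle)
    rw [abs_le] at this
    linarith [this.2, neg_sq s]
  have e2 : Real.exp s ≤ 1 + s + s ^ 2 := by
    have := Real.abs_exp_sub_one_sub_id_le (x := s) (by rw [abs_of_pos hs0]; exact hsle)
    rw [abs_le] at this
    linarith [this.2]
  -- The quadratic bounds give at most `1 - (2p - 1) s + s² = 1 + (1 - 2c)/n`, one factor of the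
  -- `n`-fold product.
  have hbase : p * Real.exp (-s) + (1 - p) * Real.exp s ≤ Real.exp ((1 - 2 * c) / n) := by
    have h1 : p * Real.exp (-s) ≤ p * (1 - s + s ^ 2) := by gcongr
    have h2 : (1 - p) * Real.exp s ≤ (1 - p) * (1 + s + s ^ 2) :=
      mul_le_mul_of_nonneg_left e2 (by linarith)
    have h3 : s ^ 2 = 1 / n := by rw [hs, inv_pow, Real.sq_sqrt (by positivity), one_div]
    have h4 : (2 * p - 1) * s = 2 * c / n := by
      rw [hp, precision, div_eq_mul_inv _ √(n : ℝ), ← hs]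
      linear_combination 2 * (c : ℝ) * h3
    have h5 := Real.add_one_le_exp ((1 - 2 * (c : ℝ)) / n)
    rw [sub_div] at h5 ⊢
    nlinarith
  have hbase0 : 0 ≤ p * Real.exp (-s) + (1 - p) * Real.exp s := by
    have : 0 ≤ 1 - p := by linarith
    positivity
  have hpow : (p * Real.exp (-s) + (1 - p) * Real.exp s) ^ n ≤ Real.exp (1 - 2 * c) := by
    refine (pow_le_pow_left₀ hbase0 hbase n).trans (le_of_eq ?_)
    rw [← Real.exp_nat_mul, mul_div_cancel₀ _ (by positivity)]
  constructor
  · refine le_trans (le_of_eq ?_) hpow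
    have := key p (-s)
    rw [neg_neg] at this
    rw [← this, countMean]
    simp only [countProb, highProb, if_true, neg_mul, ← hp]
  · refine le_trans (le_of_eq ?_) hpow
    have := key (1 - p) s
    rw [sub_sub_cancel, add_comm ((1 - p) * _)] at this
    rw [← this, countMean]
    simp only [countProb, highProb, Bool.false_eq_true, if_false, ← hp, sub_sub_cancel]

/-- Drop the oracle's loss and split at `z₀`: in state `1` the rule errs by at most `1 - a z₀` above
it, and below it `exp (z₀ - z) ≥ 1` permits an exponential Markov bound. State `0` is the mirror
image. -/
lemma regretAt_le_tail {a : ℝ → ℝ} (hmono : Monotone a) (h01 : ∀ z, a z ∈ Set.Icc (0 : ℝ) 1)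
    (hsymm : ∀ z, a (-z) = 1 - a z) (z₀ : ℝ) {n : ℕ} (hn : 0 < n)
    (c : Set.Icc (0 : ℝ) (√(n : ℝ) / 2)) :
    regretAt n (normalizedRule a n) c ≤
      (1 - a z₀) ^ 2 + Real.exp z₀ * Real.exp (1 - 2 * c) := by
  have hc := abs_le_of_mem_Icc c
  obtain ⟨b1, b0⟩ := countMean_exp_le hn c
  have hpt : ∀ z, (1 - a z) ^ 2 ≤ (1 - a z₀) ^ 2 + Real.exp z₀ * Real.exp (-z) := by
    intro z
    have hz := h01 z
    rcases le_total z₀ z with h | h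
    · have h1 := hmono h
      have h2 : (1 - a z) ^ 2 ≤ (1 - a z₀) ^ 2 := by
        have : 0 ≤ 1 - a z := by linarith [hz.2]
        gcongr
      have := Real.exp_pos z₀
      have := Real.exp_pos (-z)
      nlinarith
    · have h1 : 1 ≤ Real.exp z₀ * Real.exp (-z) := by
        rw [← Real.exp_add]; exact Real.one_le_exp (by linarith)
      have h2 := sq_le_one_of_mem (p := 1) ⟨zero_le_one, le_rfl⟩ hz
      nlinarith [sq_nonneg (1 - a z₀)]
  have hpt0 : ∀ z, a z ^ 2 ≤ (1 - a z₀) ^ 2 + Real.exp z₀ * Real.exp z := by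
    intro z
    have := hpt (-z)
    rwa [hsymm, sub_sub_cancel, neg_neg] at this
  have h1 : ∑ k, countProb n true c k * (1 - normalizedRule a n k) ^ 2 ≤
      (1 - a z₀) ^ 2 + Real.exp z₀ * Real.exp (1 - 2 * c) := by
    calc ∑ k, countProb n true c k * (1 - normalizedRule a n k) ^ 2
        ≤ ∑ k, countProb n true c k * ((1 - a z₀) ^ 2 +
          Real.exp z₀ * Real.exp (-((√(n : ℝ))⁻¹ * excess k))) :=
          Finset.sum_le_sum fun k _ =>
            mul_le_mul_of_nonneg_left (hpt _) (countProb_nonneg n true c k)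
      _ = (1 - a z₀) ^ 2 + Real.exp z₀ *
          countMean n true c (fun y => Real.exp (-((√(n : ℝ))⁻¹ * y))) := by
          simp only [mul_add, Finset.sum_add_distrib]
          rw [← Finset.sum_mul, sum_countProb, one_mul, countMean, Finset.mul_sum]
          congr 1
          exact Finset.sum_congr rfl fun k _ => by ring
      _ ≤ _ := by gcongr
  have h0 : ∑ k, countProb n false c k * normalizedRule a n k ^ 2 ≤
      (1 - a z₀) ^ 2 + Real.exp z₀ * Real.exp (1 - 2 * c) := by
    calc ∑ k, countProb n false c k * normalizedRule a n k ^ 2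
        ≤ ∑ k, countProb n false c k * ((1 - a z₀) ^ 2 +
          Real.exp z₀ * Real.exp ((√(n : ℝ))⁻¹ * excess k)) :=
          Finset.sum_le_sum fun k _ =>
            mul_le_mul_of_nonneg_left (hpt0 _) (countProb_nonneg n false c k)
      _ = (1 - a z₀) ^ 2 + Real.exp z₀ *
          countMean n false c (fun y => Real.exp ((√(n : ℝ))⁻¹ * y)) := by
          simp only [mul_add, Finset.sum_add_distrib]
          rw [← Finset.sum_mul, sum_countProb, one_mul, countMean, Finset.mul_sum]
          congr 1
          exact Finset.sum_congr rfl fun k _ => by ring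
      _ ≤ _ := by gcongr
  have h2 : regretAt n (normalizedRule a n) c ≤
      ∑ k, (countProb n true c k * (1 - normalizedRule a n k) ^ 2 / 2 +
        countProb n false c k * normalizedRule a n k ^ 2 / 2) := by
    refine Finset.sum_le_sum fun k _ => ?_
    rw [marginalProb_mul_sq hc]
    have p1 := countProb_nonneg n true c k
    have p0 := countProb_nonneg n false c k
    have : 0 ≤ countProb n true c k * (countProb n false c k /
          (countProb n true c k + countProb n false c k)) / 2 := by positivity
    linarith
  rw [Finset.sum_add_distrib, ← Finset.sum_div, ← Finset.sum_div] at h2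
  linarith

/-- The tail bound handles large `c` for all `n` at once, with margins `v/4 + v/4`; on the remaining
compact set of `c` the limit regret stays below `v` by a definite gap, and convergence transfers
that gap. -/
lemma eventually_regretAt_le {a : ℝ → ℝ} (ha : Continuous a) (hmono : Monotone a)
    (h01 : ∀ z, a z ∈ Set.Icc (0 : ℝ) 1) (hsymm : ∀ z, a (-z) = 1 - a z)
    (hlim : Tendsto a atTop (𝓝 1)) (hD : Continuous (gaussRegret a)) {K : Set ℝ} (hK : IsClosed K)
    {v : ℝ} (hv : 0 < v) (hKv : ∀ c ∈ K, 0 ≤ c → gaussRegret a (2 * c) < v) :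
    ∃ B < v, ∀ᶠ n : ℕ in atTop, ∀ c : Set.Icc (0 : ℝ) (√(n : ℝ) / 2), (c : ℝ) ∈ K →
      regretAt n (normalizedRule a n) c ≤ B := by
  obtain ⟨z₀, hz₀⟩ : ∃ z₀, (1 - a z₀) ^ 2 < v / 4 := by
    have : Tendsto (fun z => (1 - a z) ^ 2) atTop (𝓝 ((1 - 1) ^ 2)) := (hlim.const_sub 1).pow 2
    rw [sub_self, zero_pow two_ne_zero] at this
    exact (this.eventually (gt_mem_nhds (by positivity))).exists
  obtain ⟨C, hC⟩ : ∃ C : ℝ, ∀ c, C ≤ c → Real.exp z₀ * Real.exp (1 - 2 * c) < v / 4 := by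
    have h1 : Tendsto (fun c : ℝ => 1 - 2 * c) atTop atBot := by
      simp only [sub_eq_add_neg]
      exact tendsto_atBot_add_const_left _ _ (tendsto_neg_atTop_atBot.comp
        (tendsto_id.const_mul_atTop two_pos))
    have := (Real.tendsto_exp_atBot.comp h1).const_mul (Real.exp z₀)
    rw [mul_zero] at this
    exact eventually_atTop.1 (this.eventually (gt_mem_nhds (by positivity)))
  have hcomp : IsCompact (K ∩ Set.Icc 0 C) := isCompact_Icc.inter_left hK
  obtain ⟨B₀, hB₀, hB₀'⟩ : ∃ B₀ < v, ∀ c ∈ K ∩ Set.Icc 0 C, gaussRegret a (2 * c) < B₀ := by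
    rcases (K ∩ Set.Icc 0 C).eq_empty_or_nonempty with he | hne
    · exact ⟨0, hv, by simp [he]⟩
    · have hcont : Continuous fun c => gaussRegret a (2 * c) := hD.comp (by fun_prop)
      obtain ⟨c, hc, hmax⟩ := hcomp.exists_isMaxOn hne hcont.continuousOn
      obtain ⟨B₀, h1, h2⟩ := exists_between (hKv c hc.1 hc.2.1)
      exact ⟨B₀, h2, fun c' hc' => lt_of_le_of_lt (hmax hc') h1⟩
  refine ⟨max (v / 2) B₀, max_lt (by linarith) hB₀, ?_⟩
  -- Convergence holds jointly in `n` and `c` near each point, so compactness gives one threshold in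
  -- `n` for the whole set.
  have hloc : ∀ᶠ p : ℕ × ℝ in atTop ×ˢ 𝓝ˢ (K ∩ Set.Icc 0 C),
      regretAt p.1 (normalizedRule a p.1) p.2 < B₀ := by
    rw [hcomp.prod_nhdsSet_eq_biSup]
    simp only [eventually_iSup]
    intro c hc
    exact (tendsto_regretAt tendsto_fst tendsto_snd ha h01).eventually (gt_mem_nhds (hB₀' c hc))
  filter_upwards [hloc.curry, eventually_gt_atTop 0] with n hn hn0 c hcK
  rcases le_total (c : ℝ) C with h | h
  · exact (hn.self_of_nhdsSet c ⟨hcK, c.2.1, h⟩).le.trans (le_max_right _ _)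
  · refine (regretAt_le_tail hmono h01 hsymm z₀ hn0 c).trans (le_trans ?_ (le_max_left _ _))
    linarith [hC c h]

/-! ### A lower bound on the value of the finite games -/

/-- The integrand of `bayesRegret` as a function of the log-likelihood ratio. -/
def riskDensity (w r y : ℝ) : ℝ :=
  w * (1 - w) * (r * Real.cosh y) * (Real.tanh y / 2) ^ 2 / (w + (1 - w) * (r * Real.cosh y))

lemma cosh_ratio (y : ℝ) : Real.exp y / 2 / Real.cosh y = 1 / 2 + Real.tanh y / 2 := by
  have := Real.cosh_pos y
  rw [Real.tanh_eq_sinh_div_cosh, ← Real.cosh_add_sinh]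
  field_simp

/-- In both games the mixture density is `r cosh y` and the posterior `1/2 + tanh y / 2`, with `y`
half the log-likelihood ratio; only the prefactor `r` and the law of `y` differ. -/
lemma bayesRegret_eq_riskDensity (w x : ℝ) :
    bayesRegret w x = ∫ z, riskDensity w (Real.exp (-x ^ 2 / 2)) (x * z) ∂gauss := by
  refine integral_congr_ae (ae_of_all _ fun z => ?_)
  have h1 : tilt x z = Real.exp (-x ^ 2 / 2) * Real.exp (x * z) := by
    rw [tilt, ← Real.exp_add]; ring_nf
  have h2 : tilt x (-z) = Real.exp (-x ^ 2 / 2) * Real.exp (-(x * z)) := by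
    rw [tilt, ← Real.exp_add]; ring_nf
  have h3 : mix x z = Real.exp (-x ^ 2 / 2) * Real.cosh (x * z) := by
    rw [mix, h1, h2, Real.cosh_eq]; ring
  have h4 : posterior x z - 1 / 2 = Real.tanh (x * z) / 2 := by
    rw [posterior, h1, h3, mul_div_assoc, mul_div_mul_left _ _ (Real.exp_pos _).ne', cosh_ratio]
    ring
  simp only [riskDensity]
  rw [h4, h3]

lemma riskWeight_pos {w r : ℝ} (hw0 : 0 < w) (hw1 : w < 1) (hr : 0 < r) (y : ℝ) :
    0 < w + (1 - w) * (r * Real.cosh y) := by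
  have := Real.cosh_pos y
  have : 0 < 1 - w := by linarith
  positivity

lemma riskDensity_nonneg {w r : ℝ} (hw0 : 0 < w) (hw1 : w < 1) (hr : 0 < r) (y : ℝ) :
    0 ≤ riskDensity w r y := by
  have := Real.cosh_pos y
  have := riskWeight_pos hw0 hw1 hr y
  have : 0 < 1 - w := by linarith
  unfold riskDensity
  positivity

lemma riskDensity_le_one {w r : ℝ} (hw0 : 0 < w) (hw1 : w < 1) (hr : 0 < r) (y : ℝ) :
    riskDensity w r y ≤ 1 := by
  have hT := riskWeight_pos hw0 hw1 hr y
  have hc := Real.cosh_pos y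
  have h1 : 0 < 1 - w := by linarith
  rw [riskDensity, div_le_one hT]
  have h2 : (Real.tanh y / 2) ^ 2 ≤ 1 := by
    have := abs_tanh_le_one y
    rw [sq_le_one_iff_abs_le_one, abs_div, abs_two]
    linarith
  have h3 : 0 < (1 - w) * (r * Real.cosh y) := by positivity
  calc w * (1 - w) * (r * Real.cosh y) * (Real.tanh y / 2) ^ 2
      ≤ w * (1 - w) * (r * Real.cosh y) * 1 := by gcongr
    _ ≤ w + (1 - w) * (r * Real.cosh y) := by nlinarith

lemma continuous_riskDensity {w r : ℝ} (hw0 : 0 < w) (hw1 : w < 1) (hr : 0 < r) :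
    Continuous (riskDensity w r) := by
  have ht : Continuous Real.tanh :=
    continuous_iff_continuousAt.2 fun y => (hasDerivAt_tanh' y).continuousAt
  unfold riskDensity
  exact Continuous.div₀ (by fun_prop) (by fun_prop) fun y => (riskWeight_pos hw0 hw1 hr y).ne'

/-- The central limit theorem needs a fixed integrand, but the finite prefactor depends on `n`. The
numerator is linear and the denominator increasing in `r`, so replacing it costs a factor that tends
to one. -/
lemma riskDensity_scale {w r r' : ℝ} (hw0 : 0 < w) (hw1 : w < 1) (hr : 0 < r) (hr' : 0 < r')
    (y : ℝ) : min 1 (r' / r) * riskDensity w r y ≤ riskDensity w r' y := by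
  have hc := Real.cosh_pos y
  have h1 : 0 < 1 - w := by linarith
  set m := min 1 (r' / r) with hm
  have hm0 : 0 < m := lt_min one_pos (by positivity)
  have hm1 : m ≤ 1 := min_le_left _ _
  have hmr : m * r ≤ r' := by
    have := min_le_right 1 (r' / r)
    rw [le_div_iff₀ hr] at this
    exact this
  rw [riskDensity, riskDensity, mul_div_assoc', div_le_div_iff₀ (riskWeight_pos hw0 hw1 hr y)
    (riskWeight_pos hw0 hw1 hr' y)]
  have ht := sq_nonneg (Real.tanh y / 2)
  have key : m * r * (w + (1 - w) * (r' * Real.cosh y)) ≤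
      r' * (w + (1 - w) * (r * Real.cosh y)) := by
    have e1 : m * r * w ≤ r' * w := by gcongr
    have e2 : m * (r * ((1 - w) * (r' * Real.cosh y))) ≤ 1 * (r * ((1 - w) * (r' * Real.cosh y))) := by
      gcongr
    nlinarith
  calc m * (w * (1 - w) * (r * Real.cosh y) * (Real.tanh y / 2) ^ 2) *
        (w + (1 - w) * (r' * Real.cosh y))
      = w * (1 - w) * Real.cosh y * (Real.tanh y / 2) ^ 2 *
        (m * r * (w + (1 - w) * (r' * Real.cosh y))) := by ring
    _ ≤ w * (1 - w) * Real.cosh y * (Real.tanh y / 2) ^ 2 *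
        (r' * (w + (1 - w) * (r * Real.cosh y))) := by gcongr
    _ = _ := by ring

/-- Count by count, `two_point_sq` bounds the average loss below by the Bayes regret, whatever the
rule. The reference measure is the fair-coin law at `c = 0`. -/
lemma twoPoint_regretAt_ge {w : ℝ} (hw0 : 0 < w) (hw1 : w < 1) {n : ℕ} {c : ℝ}
    (hc : |2 * c / √(n : ℝ)| < 1) (a : Fin (n + 1) → ℝ) :
    countMean n true 0 (fun y => riskDensity w (tiltFactor n c) (logOdds n c / 2 * y)) ≤
      w * regretAt n a 0 + (1 - w) * regretAt n a c := by
  simp only [countMean, regretAt, Finset.mul_sum]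
  rw [← Finset.sum_add_distrib]
  refine Finset.sum_le_sum fun k _ => ?_
  have hb := countProb_zero_pos n k
  have hκ := tiltFactor_pos n c
  have m0 : marginalProb n 0 k = countProb n true 0 k := by
    have : highProb n false 0 = highProb n true 0 := by norm_num [highProb, precision]
    simp only [marginalProb, countProb, this]
    ring
  have o0 : oracle n 0 k = 1 / 2 := by
    rw [oracle, m0]; field_simp
  set b := countProb n true 0 k with hbdef
  set y := logOdds n c / 2 * excess k with hy
  have mc : marginalProb n c k = b * (tiltFactor n c * Real.cosh y) := by
    rw [marginalProb, countProb_true_eq hc, countProb_false_eq hc, Real.cosh_eq]; ring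
  have oc : oracle n c k = 1 / 2 + Real.tanh y / 2 := by
    rw [oracle, mc, countProb_true_eq hc, ← cosh_ratio, ← hbdef, ← hy]
    have := Real.cosh_pos y
    field_simp
  have hid := two_point_sq (w := w) (M := tiltFactor n c * Real.cosh y)
    (p := 1 / 2 + Real.tanh y / 2) (riskWeight_pos hw0 hw1 hκ y).ne' (a k)
  have hT := riskWeight_pos hw0 hw1 hκ y
  have hsq := mul_nonneg hT.le (sq_nonneg (a k - (w / 2 + (1 - w) * (tiltFactor n c * Real.cosh y *
    (1 / 2 + Real.tanh y / 2))) / (w + (1 - w) * (tiltFactor n c * Real.cosh y))))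
  rw [add_sub_cancel_left] at hid
  rw [m0, o0, mc, oc]
  calc b * riskDensity w (tiltFactor n c) y
      ≤ b * (w * (1 / 2 - a k) ^ 2 + (1 - w) * (tiltFactor n c * Real.cosh y *
        (1 / 2 + Real.tanh y / 2 - a k) ^ 2)) := by
        refine mul_le_mul_of_nonneg_left ?_ hb.le
        rw [hid, riskDensity]
        exact le_add_of_nonneg_right hsq
    _ = _ := by ring

lemma tendsto_countMean_riskDensity {w : ℝ} (hw0 : 0 < w) (hw1 : w < 1) (c : ℝ) :
    Tendsto (fun n : ℕ => min 1 (tiltFactor n c / Real.exp (-(2 * c) ^ 2 / 2)) *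
      countMean n true 0
        (fun y => riskDensity w (Real.exp (-(2 * c) ^ 2 / 2)) (logOdds n c / 2 * y))) atTop
      (𝓝 (bayesRegret w (2 * c))) := by
  have hκ := Real.exp_pos (-(2 * c) ^ 2 / 2)
  have h1 : Tendsto (fun n : ℕ => min 1 (tiltFactor n c / Real.exp (-(2 * c) ^ 2 / 2))) atTop
      (𝓝 1) := by
    have := (tendsto_const_nhds (x := (1 : ℝ))).min
      ((tendsto_tiltFactor tendsto_id (tendsto_const_nhds (x := c))).div_const
        (Real.exp (-(2 * c) ^ 2 / 2)))
    rw [div_self hκ.ne', min_self] at this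
    exact this
  have hs : Tendsto (fun n : ℕ => √(n : ℝ) * (logOdds n c / 2)) atTop (𝓝 (2 * c)) := by
    have := (tendsto_logOdds tendsto_id (tendsto_const_nhds (x := c))).div_const 2
    rw [mul_div_cancel_left₀ _ two_ne_zero] at this
    exact this.congr fun n => mul_div_assoc _ _ _
  have h2 := tendsto_countMean tendsto_id (tendsto_const_nhds (x := (0 : ℝ))) hs true
    (continuous_riskDensity hw0 hw1 hκ) (C := 1) fun y => by
      rw [abs_of_nonneg (riskDensity_nonneg hw0 hw1 hκ y)]
      exact riskDensity_le_one hw0 hw1 hκ y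
  have h3 := h1.mul h2
  rw [one_mul] at h3
  refine h3.trans (le_of_eq ?_)
  rw [bayesRegret_eq_riskDensity]
  simp [signalMean]

lemma countMean_riskDensity_le {w : ℝ} (hw0 : 0 < w) (hw1 : w < 1) (n : ℕ) (c : ℝ) :
    min 1 (tiltFactor n c / Real.exp (-(2 * c) ^ 2 / 2)) *
      countMean n true 0
        (fun y => riskDensity w (Real.exp (-(2 * c) ^ 2 / 2)) (logOdds n c / 2 * y)) ≤
    countMean n true 0 (fun y => riskDensity w (tiltFactor n c) (logOdds n c / 2 * y)) := by
  simp only [countMean, Finset.mul_sum]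
  refine Finset.sum_le_sum fun k _ => ?_
  rw [mul_left_comm]
  exact mul_le_mul_of_nonneg_left
    (riskDensity_scale hw0 hw1 (Real.exp_pos _) (tiltFactor_pos n c) _) (countProb_zero_pos n k).le

/-! ### Equilibria of the finite games -/

section Finite

variable {n : ℕ} {a : Fin (n + 1) → ℝ} {γ : NatureStrategy n}

lemma measurable_marginalProb (n : ℕ) (k : Fin (n + 1)) :
    Measurable fun c : Set.Icc (0 : ℝ) (√(n : ℝ) / 2) => marginalProb n c k :=
  ((measurable_countProb n true k).add (measurable_countProb n false k)).div_const 2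

lemma measurable_regretAt (n : ℕ) (a : Fin (n + 1) → ℝ) :
    Measurable fun c : Set.Icc (0 : ℝ) (√(n : ℝ) / 2) => regretAt n a c := by
  unfold regretAt oracle
  refine Finset.measurable_sum _ fun k _ => (measurable_marginalProb n k).mul ?_
  exact ((((measurable_countProb n true k).div_const 2).div
    (measurable_marginalProb n k)).sub_const _).pow_const 2

lemma integrable_regretAt (ha : ∀ k, a k ∈ Set.Icc (0 : ℝ) 1) (γ : NatureStrategy n) :
    Integrable (fun c : Set.Icc (0 : ℝ) (√(n : ℝ) / 2) => regretAt n a c) (γ : Measure _) := by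
  refine Integrable.of_bound (measurable_regretAt n a).aestronglyMeasurable 1
    (ae_of_all _ fun c => ?_)
  have h := regretAt_mem ha (abs_le_of_mem_Icc c)
  rw [Real.norm_eq_abs, abs_of_nonneg h.1]
  exact h.2

/-- Nature may deviate to a point mass. -/
lemma IsEquilibrium.regretAt_le (h : IsEquilibrium n a γ) (c : Set.Icc (0 : ℝ) (√(n : ℝ) / 2)) :
    regretAt n a c ≤ regret n a γ := by
  have := h.nature_optimal ⟨Measure.dirac c, inferInstance⟩
  refine le_trans (le_of_eq ?_) this
  simp [regret]

lemma IsEquilibrium.twoPoint_le (h : IsEquilibrium n a γ) {w : ℝ} (hw : w ∈ Set.Icc (0 : ℝ) 1)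
    {c : ℝ} (hc0 : 0 ≤ c) (hc : c ≤ √(n : ℝ) / 2) :
    w * regretAt n a 0 + (1 - w) * regretAt n a c ≤ regret n a γ := by
  have h0 := h.regretAt_le ⟨0, le_rfl, by positivity⟩
  have h1 := h.regretAt_le ⟨c, hc0, hc⟩
  simp only at h0 h1
  have := hw.1
  have : 0 ≤ 1 - w := by linarith [hw.2]
  nlinarith

/-- The mean squared distance between the equilibrium rule and another rule is controlled by the
regret that the other rule gives up. -/
lemma IsEquilibrium.sq_dist_le (h : IsEquilibrium n a γ) {b : Fin (n + 1) → ℝ}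
    (hb : ∀ k, b k ∈ Set.Icc (0 : ℝ) 1) :
    ∫ c, ∑ k, marginalProb n c k * (a k - b k) ^ 2 ∂(γ : Measure (Set.Icc (0 : ℝ) (√(n : ℝ) / 2))) ≤
      2 * (regret n b γ - regret n a γ) := by
  have ha := h.mem_unit
  have hm : ∀ k, (a k + b k) / 2 ∈ Set.Icc (0 : ℝ) 1 := fun k =>
    ⟨by linarith [(ha k).1, (hb k).1], by linarith [(ha k).2, (hb k).2]⟩
  have hopt := h.dm_optimal _ hm
  -- Parallelogram identity around the midpoint rule, an admissible deviation whose regret is at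
  -- least that of `a`.
  have hid : ∀ c : Set.Icc (0 : ℝ) (√(n : ℝ) / 2),
      ∑ k, marginalProb n c k * (a k - b k) ^ 2 =
        2 * regretAt n a c + 2 * regretAt n b c
          - 4 * regretAt n (fun k => (a k + b k) / 2) c := by
    intro c
    simp only [regretAt, Finset.mul_sum]
    rw [← Finset.sum_add_distrib, ← Finset.sum_sub_distrib]
    exact Finset.sum_congr rfl fun k _ => by ring
  simp_rw [hid]
  have ia := (integrable_regretAt ha γ).const_mul 2
  have ib := (integrable_regretAt hb γ).const_mul 2
  have im := (integrable_regretAt hm γ).const_mul 4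
  have iab : Integrable (fun c : Set.Icc (0 : ℝ) (√(n : ℝ) / 2) =>
    2 * regretAt n a c + 2 * regretAt n b c) (γ : Measure _) := ia.add ib
  rw [integral_sub iab im, integral_add ia ib, integral_const_mul, integral_const_mul,
    integral_const_mul]
  simp only [regret] at hopt ⊢
  linarith

lemma integral_playLaw (γ : NatureStrategy n) (f : Bool × Fin (n + 1) → ℝ) :
    ∫ ω, f ω ∂playLaw n γ = ∫ c, ∑ θ : Bool, ∑ k, countProb n θ c k / 2 * f (θ, k)
      ∂(γ : Measure (Set.Icc (0 : ℝ) (√(n : ℝ) / 2))) := by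
  have hi : ∀ θ k, Integrable (fun c : Set.Icc (0 : ℝ) (√(n : ℝ) / 2) => countProb n θ c k / 2)
      (γ : Measure _) := by
    intro θ k
    refine Integrable.of_bound ((measurable_countProb n θ k).div_const 2).aestronglyMeasurable 1
      (ae_of_all _ fun c => ?_)
    have h0 := countProb_nonneg n θ c k
    have h1 : countProb n θ c k ≤ 1 := by
      rw [← sum_countProb n θ c]
      exact Finset.single_le_sum (fun j _ => countProb_nonneg n θ c j) (Finset.mem_univ k)
    rw [Real.norm_eq_abs, abs_of_nonneg (by positivity)]
    linarith
  rw [integral_finsetSum _ fun θ _ => integrable_finsetSum _ fun k _ => (hi θ k).mul_const _,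
    playLaw, integral_finsetSum_measure]
  · refine Finset.sum_congr rfl fun θ _ => ?_
    rw [integral_finsetSum _ fun k _ => (hi θ k).mul_const _, integral_finsetSum_measure]
    · refine Finset.sum_congr rfl fun k _ => ?_
      rw [integral_smul_measure, integral_dirac, integral_mul_const, smul_eq_mul,
        integral_eq_lintegral_of_nonneg_ae
          (ae_of_all _ fun c => div_nonneg (countProb_nonneg n θ c k) zero_le_two)
          (hi θ k).aestronglyMeasurable]
    · intro k _
      refine (integrable_dirac (by simp)).smul_measure ?_
      have := (hi θ k).lintegral_lt_top
      exact this.ne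
  · intro θ _
    rw [integrable_finsetSum_measure]
    intro k _
    refine (integrable_dirac (by simp)).smul_measure ?_
    have := (hi θ k).lintegral_lt_top
    exact this.ne

end Finite

/-! ### The saddle point of the limit game -/

/-- For `z ≥ 0` the likelihood of state `0` is at most one, while that of state `1` diverges since
`w < 1` and `x > 0`. -/
lemma tendsto_bayesRule_atTop {w x : ℝ} (h : IsSaddle w x) :
    Tendsto (bayesRule w x) atTop (𝓝 1) := by
  have h1w : 0 < 1 - w := by linarith [h.lt_one]
  have hlik : Tendsto (lik w x) atTop atTop := by
    refine tendsto_atTop_add_const_left _ _ (Tendsto.const_mul_atTop h1w ?_)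
    refine Real.tendsto_exp_atTop.comp ?_
    simp only [sub_eq_add_neg]
    exact tendsto_atTop_add_const_right _ _ (tendsto_id.const_mul_atTop h.signal_pos)
  have hinv : Tendsto (fun z => 1 - (lik w x z)⁻¹) atTop (𝓝 1) := by
    simpa using (tendsto_inv_atTop_zero.comp hlik).const_sub (1 : ℝ)
  refine tendsto_of_tendsto_of_tendsto_of_le_of_le' hinv tendsto_const_nhds ?_
    (Eventually.of_forall fun z => (bayesRule_mem h.mem x z).2.le)
  filter_upwards [eventually_ge_atTop 0] with z hz
  have h1 := lik_pos h.mem x z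
  have h2 := lik_pos h.mem x (-z)
  have h3 : lik w x (-z) ≤ 1 := by
    have : tilt x (-z) ≤ 1 := by
      rw [tilt, Real.exp_le_one_iff]
      nlinarith [mul_nonneg h.signal_pos.le hz, sq_nonneg x]
    unfold lik
    nlinarith
  rw [bayesRule, ← one_div, le_div_iff₀ (by positivity), sub_mul, one_mul]
  have : lik w x (-z) ≤ 1 / lik w x z * (lik w x z + lik w x (-z)) := by
    rw [mul_add, one_div, inv_mul_cancel₀ h1.ne']
    have : 0 ≤ (lik w x z)⁻¹ * lik w x (-z) := by positivity
    linarith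
  linarith

section Equilibrium

variable {w x : ℝ}

lemma IsSaddle.continuous_rule (h : IsSaddle w x) : Continuous (bayesRule w x) :=
  continuous_bayesRule h.mem x

lemma IsSaddle.strictMono_rule (h : IsSaddle w x) : StrictMono (bayesRule w x) :=
  strictMono_bayesRule h.mem h.lt_one h.signal_pos

lemma IsSaddle.continuous_regret (h : IsSaddle w x) : Continuous (gaussRegret (bayesRule w x)) :=
  continuous_iff_continuousAt.2 fun y =>
    (hasDerivAt_gaussRegret h.mem h.signal_pos.le y).continuousAt

lemma IsSaddle.exists_bound (h : IsSaddle w x) {K : Set ℝ} (hK : IsClosed K) {v : ℝ} (hv : 0 < v)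
    (hKv : ∀ c ∈ K, 0 ≤ c → gaussRegret (bayesRule w x) (2 * c) < v) :
    ∃ B < v, ∀ᶠ n : ℕ in atTop, ∀ c : Set.Icc (0 : ℝ) (√(n : ℝ) / 2), (c : ℝ) ∈ K →
      regretAt n (normalizedRule (bayesRule w x) n) c ≤ B :=
  eventually_regretAt_le h.continuous_rule h.strictMono_rule.monotone (bayesRule_mem_Icc h.mem x)
    (bayesRule_neg h.mem x) (tendsto_bayesRule_atTop h) h.continuous_regret hK hv hKv

lemma IsSaddle.eventually_le (h : IsSaddle w x) {ε : ℝ} (hε : 0 < ε) :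
    ∀ᶠ n : ℕ in atTop, ∀ c : Set.Icc (0 : ℝ) (√(n : ℝ) / 2),
      regretAt n (normalizedRule (bayesRule w x) n) c ≤ bayesRegret w x + ε := by
  obtain ⟨B, hB, hev⟩ := h.exists_bound isClosed_univ (v := bayesRegret w x + ε)
    (by linarith [h.value_pos]) fun c _ hc => by
      linarith [h.regret_le (y := 2 * c) (by positivity)]
  filter_upwards [hev] with n hn c
  exact (hn c (Set.mem_univ _)).trans hB.le

lemma normalizedRule_mem {b : ℝ → ℝ} (hb : ∀ z, b z ∈ Set.Icc (0 : ℝ) 1) (n : ℕ)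
    (k : Fin (n + 1)) : normalizedRule b n k ∈ Set.Icc (0 : ℝ) 1 := hb _

lemma IsSaddle.eventually_regret_le (h : IsSaddle w x) (γ : ∀ n : ℕ, NatureStrategy n) {ε : ℝ}
    (hε : 0 < ε) : ∀ᶠ n : ℕ in atTop,
      regret n (normalizedRule (bayesRule w x) n) (γ n) ≤ bayesRegret w x + ε := by
  filter_upwards [h.eventually_le hε] with n hn
  refine (integral_mono (integrable_regretAt (normalizedRule_mem (bayesRule_mem_Icc h.mem x) n)
    (γ n)) (integrable_const _) hn).trans (le_of_eq ?_)
  simp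

/-! ### Convergence of the values and of Nature's strategies -/

variable {a : ∀ n : ℕ, Fin (n + 1) → ℝ} {γ : ∀ n : ℕ, NatureStrategy n}

lemma IsSaddle.regret_le_rule (h : IsSaddle w x) (heq : ∀ n, IsEquilibrium n (a n) (γ n)) (n : ℕ) :
    regret n (a n) (γ n) ≤ regret n (normalizedRule (bayesRule w x) n) (γ n) :=
  (heq n).dm_optimal _ (normalizedRule_mem (bayesRule_mem_Icc h.mem x) n)

/-- The values of the finite games converge to the value of the limit game. -/
lemma IsSaddle.tendsto_value (h : IsSaddle w x) (heq : ∀ n, IsEquilibrium n (a n) (γ n)) :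
    Tendsto (fun n => regret n (a n) (γ n)) atTop (𝓝 (bayesRegret w x)) := by
  -- Lower bound: Nature may put weight `w` on `0` and `1 - w` on `c = x/2`, the parameter with
  -- signal mean `x`. The upper bound below comes from the decision-maker's deviation to the limit
  -- rule.
  have hlow := tendsto_countMean_riskDensity h.pos h.lt_one (x / 2)
  rw [mul_div_cancel₀ _ two_ne_zero] at hlow
  have hle : ∀ᶠ n : ℕ in atTop, min 1 (tiltFactor n (x / 2) / Real.exp (-x ^ 2 / 2)) *
      countMean n true 0 (fun y => riskDensity w (Real.exp (-x ^ 2 / 2))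
        (logOdds n (x / 2) / 2 * y)) ≤ regret n (a n) (γ n) := by
    filter_upwards [eventually_abs_lt_one tendsto_id (tendsto_const_nhds (x := x / 2)),
      eventually_gt_atTop 0] with n hn hn0
    have h1 := countMean_riskDensity_le h.pos h.lt_one n (x / 2)
    rw [mul_div_cancel₀ _ two_ne_zero] at h1
    refine h1.trans ((twoPoint_regretAt_ge h.pos h.lt_one hn (a n)).trans ?_)
    have hx := h.signal_pos
    exact (heq n).twoPoint_le h.mem (by positivity)
      ((le_abs_self _).trans (abs_le_of_abs_lt_one hn0 hn))
  rw [tendsto_order]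
  refine ⟨fun v hv => ?_, fun v hv => ?_⟩
  · filter_upwards [hlow.eventually (lt_mem_nhds hv), hle] with n h1 h2 using h1.trans_le h2
  · filter_upwards [h.eventually_regret_le γ (ε := (v - bayesRegret w x) / 2) (by linarith)]
      with n hn
    linarith [h.regret_le_rule heq n]

/-- Squeezed between the equilibrium value and the uniform upper bound. That the limit rule loses
nothing asymptotically drives both the concentration of Nature's strategies and the closeness of the
rules. -/
lemma IsSaddle.tendsto_regret_rule (h : IsSaddle w x)
    (heq : ∀ n, IsEquilibrium n (a n) (γ n)) :
    Tendsto (fun n => regret n (normalizedRule (bayesRule w x) n) (γ n)) atTop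
      (𝓝 (bayesRegret w x)) := by
  rw [tendsto_order]
  refine ⟨fun v hv => ?_, fun v hv => ?_⟩
  · filter_upwards [(h.tendsto_value heq).eventually (lt_mem_nhds hv)] with n hn
    exact hn.trans_le (h.regret_le_rule heq n)
  · filter_upwards [h.eventually_regret_le γ (ε := (v - bayesRegret w x) / 2) (by linarith)]
      with n hn
    linarith

/-- The parameters at distance at least `δ` from the support of the limit prior. -/
def farSet (x δ : ℝ) : Set ℝ := {c | δ ≤ |c| ∧ δ ≤ |c - x / 2|}

lemma isClosed_farSet (x δ : ℝ) : IsClosed (farSet x δ) :=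
  (isClosed_le continuous_const continuous_abs).inter
    (isClosed_le continuous_const (continuous_id.sub continuous_const).abs)

/-- The probability that Nature's strategy gives to parameters in `s`. -/
def massOf {n : ℕ} (γ : NatureStrategy n) (s : Set ℝ) : ℝ :=
  (γ : Measure (Set.Icc (0 : ℝ) (√(n : ℝ) / 2))).real ((↑) ⁻¹' s)

lemma massOf_nonneg {n : ℕ} (γ : NatureStrategy n) (s : Set ℝ) : 0 ≤ massOf γ s := measureReal_nonneg

lemma massOf_le_one {n : ℕ} (γ : NatureStrategy n) (s : Set ℝ) : massOf γ s ≤ 1 :=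
  measureReal_le_one

/-- Away from `{0, x/2}` the limit rule has regret below the value by a fixed gap, and elsewhere at
most slightly above it; an average tending to the value leaves no mass for the far set. -/
lemma IsSaddle.tendsto_massOf_farSet (h : IsSaddle w x)
    (heq : ∀ n, IsEquilibrium n (a n) (γ n)) {δ : ℝ} (hδ : 0 < δ) :
    Tendsto (fun n => massOf (γ n) (farSet x δ)) atTop (𝓝 0) := by
  obtain ⟨B, hB, hev⟩ := h.exists_bound (isClosed_farSet x δ) h.value_pos (by
    intro c hc hc0
    have h0 : c ≠ 0 := by rintro rfl; simp [farSet] at hc; linarith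
    have h1 : 2 * c ≠ x := by
      rintro e
      have : c - x / 2 = 0 := by linarith
      simp [farSet, this] at hc
      linarith [hc.2]
    exact h.regret_lt _ (by positivity) h1)
  rw [tendsto_order]
  refine ⟨fun v hv => Eventually.of_forall fun n => hv.trans_le (massOf_nonneg _ _),
    fun η hη => ?_⟩
  have hgap : 0 < bayesRegret w x - B := by linarith
  -- Far mass at least `η` would cost `3 ε`, bringing the average down to the value minus `2 ε`,
  -- below the lower bound at `ε`.
  set ε := (bayesRegret w x - B) * η / 3 with hε
  have hε0 : 0 < ε := by positivity
  filter_upwards [hev, h.eventually_le hε0,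
    (h.tendsto_regret_rule heq).eventually (lt_mem_nhds (sub_lt_self _ hε0))] with n h1 h2 h3
  set S : Set (Set.Icc (0 : ℝ) (√(n : ℝ) / 2)) := (↑) ⁻¹' farSet x δ with hS
  have hSm : MeasurableSet S := measurable_subtype_coe (isClosed_farSet x δ).measurableSet
  have hbound : regret n (normalizedRule (bayesRule w x) n) (γ n) ≤
      ∫ c, (bayesRegret w x + ε - S.indicator (fun _ => bayesRegret w x - B) c)
        ∂(γ n : Measure (Set.Icc (0 : ℝ) (√(n : ℝ) / 2))) := by
    refine integral_mono (integrable_regretAt (normalizedRule_mem (bayesRule_mem_Icc h.mem x) n)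
      (γ n)) ((integrable_const _).sub ((integrable_const _).indicator hSm)) fun c => ?_
    by_cases hc : c ∈ S
    · simp only [Set.indicator_of_mem hc]
      linarith [h1 c hc]
    · simp only [Set.indicator_of_notMem hc]
      linarith [h2 c]
  rw [integral_sub (integrable_const _) ((integrable_const _).indicator hSm), integral_const,
    integral_indicator_const _ hSm, probReal_univ, one_smul, smul_eq_mul] at hbound
  change _ ≤ _ - massOf (γ n) (farSet x δ) * _ at hbound
  by_contra! hn
  have : (bayesRegret w x - B) * η ≤ massOf (γ n) (farSet x δ) * (bayesRegret w x - B) := by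
    rw [mul_comm]; gcongr
  linarith

/-- Along strategies that concentrate on `{0, x / 2}`, the integrals of a continuously convergent
family of functions are asymptotically those against a two-point law. -/
lemma tendsto_integral_of_concentrated {x : ℝ} (hx : 0 < x) {γ : ∀ n : ℕ, NatureStrategy n}
    (hγ : ∀ δ > 0, Tendsto (fun n => massOf (γ n) (farSet x δ)) atTop (𝓝 0))
    {f : ℕ → ℝ → ℝ} {f₀ f₁ C : ℝ}
    (hm : ∀ n : ℕ, Measurable fun c : Set.Icc (0 : ℝ) (√(n : ℝ) / 2) => f n c)
    (hC : ∀ n : ℕ, ∀ c : Set.Icc (0 : ℝ) (√(n : ℝ) / 2), |f n c| ≤ C)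
    (h₀ : Tendsto (fun p : ℕ × ℝ => f p.1 p.2) (atTop ×ˢ 𝓝 0) (𝓝 f₀))
    (h₁ : Tendsto (fun p : ℕ × ℝ => f p.1 p.2) (atTop ×ˢ 𝓝 (x / 2)) (𝓝 f₁)) :
    Tendsto (fun n : ℕ => (∫ c, f n c ∂(γ n : Measure (Set.Icc (0 : ℝ) (√(n : ℝ) / 2)))) -
      (massOf (γ n) (Set.Iio (x / 4)) * f₀ + (1 - massOf (γ n) (Set.Iio (x / 4))) * f₁))
      atTop (𝓝 0) := by
  have hloc : ∀ {c₀ g : ℝ}, Tendsto (fun p : ℕ × ℝ => f p.1 p.2) (atTop ×ˢ 𝓝 c₀) (𝓝 g) →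
      ∀ ε > 0, ∃ δ > 0, ∀ᶠ n : ℕ in atTop, ∀ c, |c - c₀| < δ → |f n c - g| < ε := by
    intro c₀ g hg ε hε
    have := hg.eventually (Metric.ball_mem_nhds g hε)
    obtain ⟨pa, hpa, pb, hpb, hp⟩ := eventually_prod_iff.1 this
    obtain ⟨δ, hδ, hball⟩ := Metric.eventually_nhds_iff.1 hpb
    refine ⟨δ, hδ, ?_⟩
    filter_upwards [hpa] with n hn c hc
    exact hp hn (hball hc)
  rw [Metric.tendsto_nhds]
  intro ε hε
  obtain ⟨δ₀, hδ₀, e₀⟩ := hloc h₀ (ε / 2) (by positivity)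
  obtain ⟨δ₁, hδ₁, e₁⟩ := hloc h₁ (ε / 2) (by positivity)
  -- The cut `x/4` is midway between the two atoms, so `δ ≤ x/4` puts parameters within `δ` of `0`
  -- below it and those within `δ` of `x/2` not below it.
  set δ := min (x / 4) (min δ₀ δ₁) with hδ
  have hδ0 : 0 < δ := by positivity
  have hδx : δ ≤ x / 4 := min_le_left _ _
  have hδδ₀ : δ ≤ δ₀ := (min_le_right _ _).trans (min_le_left _ _)
  have hδδ₁ : δ ≤ δ₁ := (min_le_right _ _).trans (min_le_right _ _)
  set M := C + |f₀| + |f₁| + 1 with hM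
  have hM0 : 0 < M := by
    have : 0 ≤ C := (abs_nonneg _).trans (hC 0 ⟨0, le_rfl, by positivity⟩)
    positivity
  filter_upwards [e₀, e₁, (hγ δ hδ0).eventually (gt_mem_nhds (show 0 < ε / (2 * M) by positivity))]
    with n h0 h1 hfar
  set μ : Measure (Set.Icc (0 : ℝ) (√(n : ℝ) / 2)) := (γ n : Measure (Set.Icc (0 : ℝ) (√(n : ℝ) / 2)))
    with hμ
  set S : Set (Set.Icc (0 : ℝ) (√(n : ℝ) / 2)) := (↑) ⁻¹' farSet x δ with hS
  set T : Set (Set.Icc (0 : ℝ) (√(n : ℝ) / 2)) := (↑) ⁻¹' Set.Iio (x / 4) with hT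
  have hSm : MeasurableSet S := measurable_subtype_coe (isClosed_farSet x δ).measurableSet
  have hTm : MeasurableSet T := measurable_subtype_coe measurableSet_Iio
  have hfi : Integrable (fun c : Set.Icc (0 : ℝ) (√(n : ℝ) / 2) => f n c) μ :=
    Integrable.of_bound (hm n).aestronglyMeasurable C (ae_of_all _ (hC n))
  have hgi : Integrable (fun c => f₁ + T.indicator (fun _ => f₀ - f₁) c) μ :=
    (integrable_const _).add ((integrable_const _).indicator hTm)
  have hg : ∫ c, (f₁ + T.indicator (fun _ => f₀ - f₁) c) ∂μ =
      massOf (γ n) (Set.Iio (x / 4)) * f₀ + (1 - massOf (γ n) (Set.Iio (x / 4))) * f₁ := by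
    rw [integral_add (integrable_const _) ((integrable_const _).indicator hTm), integral_const,
      integral_indicator_const _ hTm, probReal_univ, one_smul, smul_eq_mul]
    change f₁ + massOf (γ n) (Set.Iio (x / 4)) * _ = _
    ring
  rw [← hg, dist_zero_right, ← integral_sub hfi hgi]
  refine lt_of_le_of_lt (norm_integral_le_of_norm_le (g := fun c => ε / 2 + S.indicator (fun _ => M) c)
    ((integrable_const _).add ((integrable_const _).indicator hSm)) (ae_of_all _ fun c => ?_)) ?_
  · by_cases hc : c ∈ S
    · rw [Set.indicator_of_mem hc, Real.norm_eq_abs]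
      have b1 := hC n c
      have b2 : |f₁ + T.indicator (fun _ => f₀ - f₁) c| ≤ |f₀| + |f₁| := by
        by_cases hcT : c ∈ T
        · rw [Set.indicator_of_mem hcT, add_sub_cancel]; linarith [abs_nonneg f₁]
        · rw [Set.indicator_of_notMem hcT, add_zero]; linarith [abs_nonneg f₀]
      have b3 := abs_sub (f n c) (f₁ + T.indicator (fun _ => f₀ - f₁) c)
      linarith
    · rw [Set.indicator_of_notMem hc, add_zero, Real.norm_eq_abs]
      have hc' : ¬ (δ ≤ |(c : ℝ)| ∧ δ ≤ |(c : ℝ) - x / 2|) := hc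
      rw [not_and_or, not_le, not_le] at hc'
      rcases hc' with hc' | hc'
      · have hcT : c ∈ T := by
          change (c : ℝ) < x / 4
          exact (le_abs_self _).trans_lt (hc'.trans_le hδx)
        rw [Set.indicator_of_mem hcT, add_sub_cancel]
        exact (h0 c (by rw [sub_zero]; linarith)).le
      · have hcT : c ∉ T := by
          change ¬ ((c : ℝ) < x / 4)
          have := (abs_lt.1 hc').1
          linarith
        rw [Set.indicator_of_notMem hcT, add_zero]
        exact (h1 c (by linarith)).le
  · rw [integral_add (integrable_const _) ((integrable_const _).indicator hSm), integral_const,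
      integral_indicator_const _ hSm, probReal_univ, one_smul, smul_eq_mul]
    change ε / 2 + massOf (γ n) (farSet x δ) * M < ε
    rw [lt_div_iff₀ (by positivity)] at hfar
    linarith

/-- Nature's mass near zero converges to the mass at zero of the least favourable prior. -/
lemma IsSaddle.tendsto_weight (h : IsSaddle w x) (heq : ∀ n, IsEquilibrium n (a n) (γ n)) :
    Tendsto (fun n => massOf (γ n) (Set.Iio (x / 4))) atTop (𝓝 w) := by
  -- In a compact interval it suffices to identify every cluster point `w'`. The decision-maker
  -- could deviate to the reply to `w'`, so the limiting value is at most `bayesRegret w' x`.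
  refine isCompact_Icc.tendsto_nhds_of_unique_mapClusterPt (s := Set.Icc (0 : ℝ) 1)
    (Eventually.of_forall fun n => ⟨massOf_nonneg _ _, massOf_le_one _ _⟩) fun w' hw' hcl => ?_
  refine h.eq_of_bayesRegret_eq hw' ?_
  obtain ⟨U, hU, hUw⟩ := mapClusterPt_iff_ultrafilter.1 hcl
  have hcont := continuous_bayesRule hw' x
  have hmem := bayesRule_mem_Icc hw' x
  have hlim := tendsto_integral_of_concentrated h.signal_pos
    (fun δ hδ => h.tendsto_massOf_farSet heq hδ)
    (f := fun n c => regretAt n (normalizedRule (bayesRule w' x) n) c) (C := 1)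
    (fun n => measurable_regretAt n _) (fun n c => by
      have := regretAt_mem (normalizedRule_mem hmem n) (abs_le_of_mem_Icc c)
      rw [abs_of_nonneg this.1]
      exact this.2)
    (tendsto_regretAt tendsto_fst tendsto_snd hcont hmem)
    (tendsto_regretAt tendsto_fst tendsto_snd hcont hmem)
  rw [mul_zero, mul_div_cancel₀ _ two_ne_zero] at hlim
  have hlimU := (hlim.mono_left hU).add
    ((hUw.mul_const (gaussRegret (bayesRule w' x) 0)).add
      ((hUw.const_sub 1).mul_const (gaussRegret (bayesRule w' x) x)))
  rw [zero_add, ← bayesRegret_eq hw'] at hlimU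
  refine le_of_tendsto_of_tendsto ((h.tendsto_value heq).mono_left hU) hlimU
    (Eventually.of_forall fun n => ?_)
  have := (heq n).dm_optimal _ (normalizedRule_mem hmem n)
  refine this.trans (le_of_eq ?_)
  rw [regret]
  exact (sub_add_cancel _ _).symm

lemma IsSaddle.tendsto_integral (h : IsSaddle w x) (heq : ∀ n, IsEquilibrium n (a n) (γ n))
    {f : ℕ → ℝ → ℝ} {f₀ f₁ C : ℝ}
    (hm : ∀ n : ℕ, Measurable fun c : Set.Icc (0 : ℝ) (√(n : ℝ) / 2) => f n c)
    (hC : ∀ n : ℕ, ∀ c : Set.Icc (0 : ℝ) (√(n : ℝ) / 2), |f n c| ≤ C)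
    (h₀ : Tendsto (fun p : ℕ × ℝ => f p.1 p.2) (atTop ×ˢ 𝓝 0) (𝓝 f₀))
    (h₁ : Tendsto (fun p : ℕ × ℝ => f p.1 p.2) (atTop ×ˢ 𝓝 (x / 2)) (𝓝 f₁)) :
    Tendsto (fun n : ℕ => ∫ c, f n c ∂(γ n : Measure (Set.Icc (0 : ℝ) (√(n : ℝ) / 2))))
      atTop (𝓝 (w * f₀ + (1 - w) * f₁)) := by
  have h1 := tendsto_integral_of_concentrated h.signal_pos
    (fun δ hδ => h.tendsto_massOf_farSet heq hδ) hm hC h₀ h₁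
  have hw := h.tendsto_weight heq
  have h2 := h1.add ((hw.mul_const f₀).add ((hw.const_sub 1).mul_const f₁))
  rw [zero_add] at h2
  exact h2.congr fun n => sub_add_cancel _ _

/-! ### Convergence of play -/

/-- The law of play under the normalised limit rule converges. -/
lemma IsSaddle.tendsto_play_rule (h : IsSaddle w x) (heq : ∀ n, IsEquilibrium n (a n) (γ n))
    {H : Bool → ℝ → ℝ} (hH : ∀ θ, Continuous (H θ)) {C : ℝ} (hC : ∀ θ t, |H θ t| ≤ C) :
    Tendsto (fun n => ∫ ω, H ω.1 (normalizedRule (bayesRule w x) n ω.2) ∂playLaw n (γ n)) atTop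
      (𝓝 (w * (∑ θ, (∫ W, H θ (bayesRule w x (signalMean θ 0 + W)) ∂gauss) / 2) +
        (1 - w) * (∑ θ, (∫ W, H θ (bayesRule w x (signalMean θ (x / 2) + W)) ∂gauss) / 2))) := by
  have hlim : ∀ c₀ : ℝ, Tendsto (fun p : ℕ × ℝ => ∑ θ : Bool, ∑ k, countProb p.1 θ p.2 k / 2 *
      H θ (normalizedRule (bayesRule w x) p.1 k)) (atTop ×ˢ 𝓝 c₀)
      (𝓝 (∑ θ, (∫ W, H θ (bayesRule w x (signalMean θ c₀ + W)) ∂gauss) / 2)) := by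
    intro c₀
    refine tendsto_finsetSum _ fun θ _ => ?_
    have hs1 : Tendsto (fun p : ℕ × ℝ => √(p.1 : ℝ) * (√(p.1 : ℝ))⁻¹) (atTop ×ˢ 𝓝 c₀) (𝓝 1) := by
      refine tendsto_const_nhds.congr' ?_
      filter_upwards [(tendsto_sqrt_natCast (tendsto_fst (f := atTop)
        (g := 𝓝 c₀))).eventually_gt_atTop 0] with p hp
      rw [mul_inv_cancel₀ hp.ne']
    have ht := tendsto_countMean tendsto_fst tendsto_snd hs1 θ
      (f := fun y => H θ (bayesRule w x y)) ((hH θ).comp h.continuous_rule) (fun y => hC θ _)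
    simp only [one_mul] at ht
    refine (ht.div_const 2).congr fun p => ?_
    rw [countMean, Finset.sum_div]
    refine Finset.sum_congr rfl fun k _ => ?_
    rw [normalizedRule]
    ring
  have hres := h.tendsto_integral heq (C := C)
    (f := fun n c => ∑ θ : Bool, ∑ k, countProb n θ c k / 2 *
      H θ (normalizedRule (bayesRule w x) n k)) (fun n => ?_) (fun n c => ?_) (hlim 0) (hlim (x / 2))
  · refine hres.congr fun n => ?_
    rw [integral_playLaw]
  · exact Finset.measurable_sum _ fun θ _ => Finset.measurable_sum _ fun k _ =>
      ((measurable_countProb n θ k).div_const 2).mul_const _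
  · have : ∀ θ, |∑ k, countProb n θ c k / 2 * H θ (normalizedRule (bayesRule w x) n k)| ≤ C / 2 := by
      intro θ
      refine (Finset.abs_sum_le_sum_abs _ _).trans ?_
      calc ∑ k, |countProb n θ c k / 2 * H θ (normalizedRule (bayesRule w x) n k)|
          ≤ ∑ k, countProb n θ c k / 2 * C := Finset.sum_le_sum fun k _ => by
            have := countProb_nonneg n θ c k
            rw [abs_mul, abs_of_nonneg (by positivity)]
            exact mul_le_mul_of_nonneg_left (hC _ _) (by positivity)
        _ = C / 2 := by rw [← Finset.sum_mul, ← Finset.sum_div, sum_countProb]; ring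
    rw [Fintype.sum_bool]
    have := abs_add_le (∑ k, countProb n true c k / 2 * H true (normalizedRule (bayesRule w x) n k))
      (∑ k, countProb n false c k / 2 * H false (normalizedRule (bayesRule w x) n k))
    linarith [‹∀ θ, _› true, ‹∀ θ, _› false]

lemma integrable_playLaw {n : ℕ} (γ : NatureStrategy n) (f : Bool × Fin (n + 1) → ℝ) :
    Integrable f (playLaw n γ) :=
  Integrable.of_finite

/-- The equilibrium rules approach the normalised limit rule in mean square under play. -/
lemma IsSaddle.tendsto_sq_dist (h : IsSaddle w x) (heq : ∀ n, IsEquilibrium n (a n) (γ n)) :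
    Tendsto (fun n => ∫ ω, (a n ω.2 - normalizedRule (bayesRule w x) n ω.2) ^ 2 ∂playLaw n (γ n))
      atTop (𝓝 0) := by
  have hub : Tendsto (fun n => 2 * (regret n (normalizedRule (bayesRule w x) n) (γ n) -
      regret n (a n) (γ n))) atTop (𝓝 0) := by
    have := ((h.tendsto_regret_rule heq).sub (h.tendsto_value heq)).const_mul 2
    simpa using this
  refine squeeze_zero (fun n => integral_nonneg fun ω => sq_nonneg _) (fun n => ?_) hub
  refine le_trans (le_of_eq ?_)
    ((heq n).sq_dist_le (normalizedRule_mem (bayesRule_mem_Icc h.mem x) n))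
  rw [integral_playLaw]
  refine integral_congr_ae (ae_of_all _ fun c => ?_)
  simp only [Fintype.sum_bool]
  rw [← Finset.sum_add_distrib]
  refine Finset.sum_congr rfl fun k _ => ?_
  rw [marginalProb]
  ring

/-- The law of equilibrium play converges. -/
lemma IsSaddle.tendsto_play (h : IsSaddle w x) (heq : ∀ n, IsEquilibrium n (a n) (γ n))
    {H : Bool → ℝ → ℝ} (hH : ∀ θ, Continuous (H θ)) {C : ℝ} (hC : ∀ θ t, |H θ t| ≤ C) :
    Tendsto (fun n => ∫ ω, H ω.1 (a n ω.2) ∂playLaw n (γ n)) atTop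
      (𝓝 (w * (∑ θ, (∫ W, H θ (bayesRule w x (signalMean θ 0 + W)) ∂gauss) / 2) +
        (1 - w) * (∑ θ, (∫ W, H θ (bayesRule w x (signalMean θ (x / 2) + W)) ∂gauss) / 2))) := by
  have hdiff : Tendsto (fun n => ∫ ω, (H ω.1 (a n ω.2) -
      H ω.1 (normalizedRule (bayesRule w x) n ω.2)) ∂playLaw n (γ n)) atTop (𝓝 0) := by
    rw [Metric.tendsto_nhds]
    intro ε hε
    have huc : ∀ θ, ∃ δ > 0, ∀ s ∈ Set.Icc (0 : ℝ) 1, ∀ t ∈ Set.Icc (0 : ℝ) 1, |s - t| < δ →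
        |H θ s - H θ t| < ε / 2 := fun θ =>
      (Metric.uniformContinuousOn_iff.1
        (isCompact_Icc.uniformContinuousOn_of_continuous (hH θ).continuousOn)) (ε / 2)
        (by positivity) |>.imp fun δ hδ => ⟨hδ.1, fun s hs t ht => hδ.2 s hs t ht⟩
    obtain ⟨δ₁, hδ₁, u₁⟩ := huc true
    obtain ⟨δ₀, hδ₀, u₀⟩ := huc false
    set δ := min δ₀ δ₁ with hδdef
    have hδ : 0 < δ := lt_min hδ₀ hδ₁
    have hC0 : 0 ≤ C := (abs_nonneg _).trans (hC true 0)
    -- Uniform continuity on `[0, 1]` covers nearby posteriors and a Chebyshev term the others, so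
    -- mean-square closeness of the rules suffices.
    have hpt : ∀ θ, ∀ s ∈ Set.Icc (0 : ℝ) 1, ∀ t ∈ Set.Icc (0 : ℝ) 1,
        |H θ s - H θ t| ≤ ε / 2 + 2 * C / δ ^ 2 * (s - t) ^ 2 := by
      intro θ s hs t ht
      by_cases hst : |s - t| < δ
      · have : |H θ s - H θ t| < ε / 2 := by
          cases θ
          · exact u₀ s hs t ht (hst.trans_le (min_le_left _ _))
          · exact u₁ s hs t ht (hst.trans_le (min_le_right _ _))
        have : 0 ≤ 2 * C / δ ^ 2 * (s - t) ^ 2 := by positivity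
        linarith
      · rw [not_lt] at hst
        have h1 : δ ^ 2 ≤ (s - t) ^ 2 := by rw [← sq_abs (s - t)]; gcongr
        have h2 : 2 * C ≤ 2 * C / δ ^ 2 * (s - t) ^ 2 := by
          rw [div_mul_eq_mul_div, le_div_iff₀ (by positivity)]
          gcongr
        have h3 := abs_sub (H θ s) (H θ t)
        linarith [hC θ s, hC θ t]
    have hsmall := (h.tendsto_sq_dist heq).const_mul (2 * C / δ ^ 2)
    rw [mul_zero] at hsmall
    filter_upwards [hsmall.eventually (gt_mem_nhds (half_pos hε))] with n hn
    rw [dist_zero_right]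
    refine lt_of_le_of_lt (norm_integral_le_of_norm_le (g := fun ω => ε / 2 + 2 * C / δ ^ 2 *
      (a n ω.2 - normalizedRule (bayesRule w x) n ω.2) ^ 2) (integrable_playLaw _ _)
      (ae_of_all _ fun ω => ?_)) ?_
    · exact hpt _ _ ((heq n).mem_unit _) _ (normalizedRule_mem (bayesRule_mem_Icc h.mem x) n _)
    · rw [integral_add (integrable_const _) (integrable_playLaw _ _), integral_const,
        probReal_univ, one_smul, integral_const_mul]
      linarith
  have hsum := hdiff.add (h.tendsto_play_rule heq hH hC)
  rw [zero_add] at hsum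
  refine hsum.congr fun n => ?_
  rw [integral_sub (integrable_playLaw _ (fun ω => H ω.1 (a n ω.2))) (integrable_playLaw _ _),
    sub_add_cancel]

end Equilibrium

/-! ### The limit equilibrium -/

/-- The prior with mass `w` at `0` and `1 - w` at `c`. -/
def twoPointPrior (w : ℝ) (hw : w ∈ Set.Icc (0 : ℝ) 1) (c : Set.Ici (0 : ℝ)) :
    LimitNatureStrategy :=
  ⟨ENNReal.ofReal w • Measure.dirac ⟨0, Set.self_mem_Ici⟩ +
    ENNReal.ofReal (1 - w) • Measure.dirac c, ⟨by
      have h1 : 0 ≤ 1 - w := by linarith [hw.2]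
      simp only [Measure.add_apply, Measure.smul_apply, measure_univ, smul_eq_mul, mul_one]
      rw [← ENNReal.ofReal_add hw.1 h1, add_sub_cancel, ENNReal.ofReal_one]⟩⟩

lemma coe_twoPointPrior {w : ℝ} (hw : w ∈ Set.Icc (0 : ℝ) 1) (c : Set.Ici (0 : ℝ)) :
    (twoPointPrior w hw c : Measure (Set.Ici (0 : ℝ))) =
      ENNReal.ofReal w • Measure.dirac ⟨0, Set.self_mem_Ici⟩ +
        ENNReal.ofReal (1 - w) • Measure.dirac c := rfl

lemma integral_twoPointPrior {w : ℝ} (hw : w ∈ Set.Icc (0 : ℝ) 1) (c : Set.Ici (0 : ℝ))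
    (f : Set.Ici (0 : ℝ) → ℝ) :
    ∫ y, f y ∂(twoPointPrior w hw c : Measure (Set.Ici (0 : ℝ))) =
      w * f ⟨0, Set.self_mem_Ici⟩ + (1 - w) * f c := by
  have h1 : 0 ≤ 1 - w := by linarith [hw.2]
  have hi : ∀ y : Set.Ici (0 : ℝ), Integrable f (Measure.dirac y) := fun y =>
    integrable_dirac (by simp)
  rw [coe_twoPointPrior, integral_add_measure ((hi _).smul_measure ENNReal.ofReal_ne_top)
    ((hi _).smul_measure ENNReal.ofReal_ne_top), integral_smul_measure,
    integral_smul_measure, integral_dirac, integral_dirac, ENNReal.toReal_ofReal hw.1,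
    ENNReal.toReal_ofReal h1, smul_eq_mul, smul_eq_mul]

/-- The least favourable prior of a saddle point. -/
def IsSaddle.prior {w x : ℝ} (h : IsSaddle w x) : LimitNatureStrategy :=
  twoPointPrior w h.mem ⟨x / 2, by have := h.signal_pos; exact Set.mem_Ici.2 (by positivity)⟩

lemma IsSaddle.limitRegret_prior {w x : ℝ} (h : IsSaddle w x) (b : ℝ → ℝ) :
    limitRegret b h.prior = w * gaussRegret b 0 + (1 - w) * gaussRegret b x := by
  rw [limitRegret, IsSaddle.prior, integral_twoPointPrior]
  simp only [limitRegretAt_eq, mul_zero, mul_div_cancel₀ _ (two_ne_zero' ℝ)]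

lemma IsSaddle.limitRegret_eq {w x : ℝ} (h : IsSaddle w x) :
    limitRegret (bayesRule w x) h.prior = bayesRegret w x := by
  rw [h.limitRegret_prior, h.regret_zero, h.regret_signal]
  ring

/-- Nature's payoff is bounded pointwise by the value, and `bayesRule w x` is Bayes optimal among
all measurable rules into `[0, 1]`; monotonicity of a deviation serves only to make it measurable.
-/
lemma IsSaddle.isLimitEquilibrium {w x : ℝ} (h : IsSaddle w x) :
    IsLimitEquilibrium (bayesRule w x) h.prior where
  isLimitRule := ⟨h.strictMono_rule.monotone, bayesRule_mem_Icc h.mem x⟩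
  nature_optimal γ' := by
    rw [h.limitRegret_eq, limitRegret]
    refine (integral_mono_of_nonneg (ae_of_all _ fun c => ?_) (integrable_const (bayesRegret w x))
      (ae_of_all _ fun c => ?_)).trans (le_of_eq (by simp))
    · simp only [limitRegretAt_eq]
      exact gaussRegret_nonneg _ _
    · simp only [limitRegretAt_eq]
      exact h.regret_le (mul_nonneg zero_le_two c.2)
  dm_optimal a' ha' := by
    rw [h.limitRegret_eq, h.limitRegret_prior]
    exact bayesRegret_le ha'.1.measurable ha'.2 h.mem x

lemma measurable_limitSignal : Measurable limitSignal := by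
  have : Measurable fun p : Bool × Set.Ici (0 : ℝ) => signalMean p.1 p.2 :=
    measurable_from_prod_countable_right fun θ =>
      (continuous_signalMean θ).measurable.comp measurable_subtype_coe
  exact (this.comp (measurable_fst.prodMk (measurable_fst.comp measurable_snd))).add
    (measurable_snd.comp measurable_snd)

lemma IsSaddle.integral_limitPlayLaw {w x : ℝ} (h : IsSaddle w x) {H : Bool → ℝ → ℝ}
    (hH : ∀ θ, Continuous (H θ)) {C : ℝ} (hC : ∀ θ t, |H θ t| ≤ C) :
    ∫ ω, H ω.1 (bayesRule w x (limitSignal ω)) ∂limitPlayLaw h.prior =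
      w * (∑ θ, (∫ W, H θ (bayesRule w x (signalMean θ 0 + W)) ∂gauss) / 2) +
        (1 - w) * (∑ θ, (∫ W, H θ (bayesRule w x (signalMean θ (x / 2) + W)) ∂gauss) / 2) := by
  have hHm : Measurable fun p : Bool × ℝ => H p.1 p.2 :=
    measurable_from_prod_countable_right fun θ => (hH θ).measurable
  have hmeas : Measurable fun ω : Bool × Set.Ici (0 : ℝ) × ℝ =>
      H ω.1 (bayesRule w x (limitSignal ω)) :=
    hHm.comp (measurable_fst.prodMk (h.continuous_rule.measurable.comp measurable_limitSignal))
  have hint : Integrable (fun ω : Bool × Set.Ici (0 : ℝ) × ℝ =>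
      H ω.1 (bayesRule w x (limitSignal ω))) (limitPlayLaw h.prior) :=
    Integrable.of_bound hmeas.aestronglyMeasurable C (ae_of_all _ fun ω => hC _ _)
  rw [limitPlayLaw] at hint ⊢
  rw [integral_prod _ hint, PMF.integral_eq_sum]
  have hθ : ∀ θ : Bool, ∫ y, H θ (bayesRule w x (limitSignal (θ, y)))
      ∂((h.prior : Measure (Set.Ici (0 : ℝ))).prod (gaussianReal 0 1)) =
      w * (∫ W, H θ (bayesRule w x (signalMean θ 0 + W)) ∂gauss) +
        (1 - w) * (∫ W, H θ (bayesRule w x (signalMean θ (x / 2) + W)) ∂gauss) := by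
    intro θ
    have hint' : Integrable (fun y : Set.Ici (0 : ℝ) × ℝ => H θ (bayesRule w x (limitSignal (θ, y))))
        ((h.prior : Measure (Set.Ici (0 : ℝ))).prod (gaussianReal 0 1)) :=
      Integrable.of_bound (hmeas.comp measurable_prodMk_left).aestronglyMeasurable C
        (ae_of_all _ fun ω => hC _ _)
    rw [integral_prod _ hint', IsSaddle.prior, integral_twoPointPrior]
    rfl
  simp only [hθ, PMF.uniformOfFintype_apply, Fintype.sum_bool, Fintype.card_bool]
  simp
  ring

/-- For fixed `θ` and `c`, strict monotonicity leaves at most one noise value `W` in a level set of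
the posterior, and the Gaussian has no atoms. -/
lemma IsSaddle.not_ae_eq_const {w x : ℝ} (h : IsSaddle w x) :
    ¬ ∃ y : ℝ, ∀ᵐ ω ∂(limitPlayLaw h.prior), bayesRule w x (limitSignal ω) = y := by
  rintro ⟨y, hy⟩
  have hms : MeasurableSet {ω : Bool × Set.Ici (0 : ℝ) × ℝ | bayesRule w x (limitSignal ω) = y} :=
    (h.continuous_rule.measurable.comp measurable_limitSignal) (measurableSet_singleton y)
  have hnull : limitPlayLaw h.prior {ω | bayesRule w x (limitSignal ω) = y} = 0 := by
    rw [limitPlayLaw, Measure.measure_prod_null hms]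
    refine ae_of_all _ fun θ => ?_
    simp only [Pi.zero_apply]
    rw [Measure.measure_prod_null (measurable_prodMk_left hms)]
    refine ae_of_all _ fun c => ?_
    simp only [Pi.zero_apply]
    have hsub : (Prod.mk c ⁻¹' (Prod.mk θ ⁻¹'
        {ω : Bool × Set.Ici (0 : ℝ) × ℝ | bayesRule w x (limitSignal ω) = y})).Subsingleton := by
      intro W₁ h₁ W₂ h₂
      have := h.strictMono_rule.injective (h₁.trans h₂.symm)
      simp only [limitSignal] at this
      linarith
    have := nullSingletonClass_gaussianReal (μ := 0) (v := 1) one_ne_zero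
    exact hsub.measure_zero _
  have hfull := (prob_compl_eq_zero_iff hms).1 hy
  rw [hnull] at hfull
  exact zero_ne_one hfull

/-! ### Convergence in distribution and failure of learning -/

section Conclusion

variable {w x : ℝ} {a : ∀ n : ℕ, Fin (n + 1) → ℝ} {γ : ∀ n : ℕ, NatureStrategy n}

lemma IsSaddle.tendsto_integral_play (h : IsSaddle w x) (heq : ∀ n, IsEquilibrium n (a n) (γ n))
    {H : Bool → ℝ → ℝ} (hH : ∀ θ, Continuous (H θ)) {C : ℝ} (hC : ∀ θ t, |H θ t| ≤ C) :
    Tendsto (fun n => ∫ ω, H ω.1 (a n ω.2) ∂playLaw n (γ n)) atTop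
      (𝓝 (∫ ω, H ω.1 (bayesRule w x (limitSignal ω)) ∂limitPlayLaw h.prior)) := by
  rw [h.integral_limitPlayLaw hH hC]
  exact h.tendsto_play heq hH hC

lemma IsSaddle.measurable_limit (h : IsSaddle w x) :
    Measurable fun ω : Bool × Set.Ici (0 : ℝ) × ℝ => (ω.1, bayesRule w x (limitSignal ω)) :=
  measurable_fst.prodMk (h.continuous_rule.measurable.comp measurable_limitSignal)

lemma IsSaddle.tendstoInDistribution (h : IsSaddle w x)
    (heq : ∀ n, IsEquilibrium n (a n) (γ n)) :
    TendstoInDistribution (fun n (ω : Bool × Fin (n + 1)) => (ω.1, a n ω.2)) atTop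
      (fun ω => (ω.1, bayesRule w x (limitSignal ω)))
      (fun n => playLaw n (γ n)) (limitPlayLaw h.prior) := by
  have hm : ∀ n, Measurable fun ω : Bool × Fin (n + 1) => (ω.1, a n ω.2) := fun n =>
    measurable_of_countable _
  refine ⟨fun n => (hm n).aemeasurable, h.measurable_limit.aemeasurable, ?_⟩
  refine ProbabilityMeasure.tendsto_iff_forall_integral_tendsto.2 fun F => ?_
  have ht := h.tendsto_integral_play heq (H := fun θ t => F (θ, t))
    (fun θ => F.continuous.comp (by fun_prop)) (C := ‖F‖) (fun θ t => F.norm_coe_le_norm _)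
  refine (ht.congr fun n => ?_).trans (le_of_eq ?_)
  · exact (integral_map (hm n).aemeasurable F.continuous.measurable.aestronglyMeasurable).symm
  · congr 1
    exact (integral_map h.measurable_limit.aemeasurable
      F.continuous.measurable.aestronglyMeasurable).symm

/-- The truncated squared error is a bounded continuous test function. Its limiting mean is positive
since the limit posterior never equals `0` or `1`. -/
lemma IsSaddle.not_learning (h : IsSaddle w x) (heq : ∀ n, IsEquilibrium n (a n) (γ n)) :
    ∃ ε > 0, ∃ δ > 0, ∀ᶠ n in atTop,
      δ ≤ (playLaw n (γ n)).real {ω | ε ≤ |a n ω.2 - stateValue ω.1|} := by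
  set H : Bool → ℝ → ℝ := fun θ t => min 1 ((t - stateValue θ) ^ 2) with hHdef
  have hH : ∀ θ, Continuous (H θ) := fun θ => by simp only [hHdef]; fun_prop
  have hH0 : ∀ θ t, 0 ≤ H θ t := fun θ t => le_min zero_le_one (sq_nonneg _)
  have hH1 : ∀ θ t, |H θ t| ≤ 1 := fun θ t => by
    rw [abs_of_nonneg (hH0 θ t)]; exact min_le_left _ _
  have ht := h.tendsto_integral_play heq hH hH1
  set m := ∫ ω, H ω.1 (bayesRule w x (limitSignal ω)) ∂limitPlayLaw h.prior with hmdef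
  have hm : 0 < m := by
    have hHm : Measurable fun p : Bool × ℝ => H p.1 p.2 :=
      measurable_from_prod_countable_right fun θ => (hH θ).measurable
    have hint : Integrable (fun ω : Bool × Set.Ici (0 : ℝ) × ℝ =>
        H ω.1 (bayesRule w x (limitSignal ω))) (limitPlayLaw h.prior) :=
      Integrable.of_bound (hHm.comp h.measurable_limit).aestronglyMeasurable 1
        (ae_of_all _ fun ω => hH1 _ _)
    rw [hmdef, integral_pos_iff_support_of_nonneg (fun ω => hH0 _ _) hint]
    have : Function.support (fun ω : Bool × Set.Ici (0 : ℝ) × ℝ =>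
        H ω.1 (bayesRule w x (limitSignal ω))) = Set.univ := by
      refine Set.eq_univ_of_forall fun ω => ne_of_gt (lt_min one_pos (sq_pos_of_ne_zero ?_))
      have hb := bayesRule_mem h.mem x (limitSignal ω)
      rcases ω.1 with _ | _
      · simpa [stateValue] using hb.1.ne'
      · simpa [stateValue, sub_eq_zero] using hb.2.ne
    rw [this, measure_univ]
    exact one_pos
  -- Eventually the mean error exceeds `m/2`. Errors below `√(m/4)` contribute at most `m/4`, and
  -- the truncated error is at most one, so larger errors have probability at least `m/4`.
  refine ⟨√(m / 4), by positivity, m / 4, by positivity, ?_⟩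
  filter_upwards [ht.eventually (lt_mem_nhds (half_lt_self hm))] with n hn
  set S : Set (Bool × Fin (n + 1)) := {ω | √(m / 4) ≤ |a n ω.2 - stateValue ω.1|} with hS
  have hSm : MeasurableSet S := S.to_countable.measurableSet
  have hle : ∫ ω, H ω.1 (a n ω.2) ∂playLaw n (γ n) ≤
      ∫ ω, (m / 4 + S.indicator (fun _ => (1 : ℝ)) ω) ∂playLaw n (γ n) := by
    refine integral_mono (integrable_playLaw _ _) (integrable_playLaw _ _) fun ω => ?_
    by_cases hω : ω ∈ S
    · simp only [Set.indicator_of_mem hω]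
      exact (min_le_left _ _).trans (by linarith)
    · simp only [Set.indicator_of_notMem hω, add_zero]
      have hlt : |a n ω.2 - stateValue ω.1| < √(m / 4) := not_le.1 hω
      refine (min_le_right _ _).trans ?_
      rw [← sq_abs, ← Real.sq_sqrt (show 0 ≤ m / 4 by positivity)]
      gcongr
  rw [integral_add (integrable_const _) (integrable_playLaw _ _), integral_const,
    integral_indicator_const _ hSm, probReal_univ, one_smul, smul_eq_mul, mul_one] at hle
  linarith

end Conclusion

end RobustLearning

end

open RobustLearning in
theorem corollary1 :
    ∃ (aStar : ℝ → ℝ) (γStar : LimitNatureStrategy),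
      IsLimitEquilibrium aStar γStar ∧
      -- the limiting regret is strictly positive
      0 < limitRegret aStar γStar ∧
      -- the limiting posterior lies strictly inside `(0,1)` and is not degenerate
      (∀ᵐ ω ∂(limitPlayLaw γStar), 0 < aStar (limitSignal ω) ∧ aStar (limitSignal ω) < 1) ∧
      (¬ ∃ x : ℝ, ∀ᵐ ω ∂(limitPlayLaw γStar), aStar (limitSignal ω) = x) ∧
      -- every sequence of equilibria of the finite games converges to these limits
      ∀ (a : ∀ n : ℕ, Fin (n + 1) → ℝ) (γ : ∀ n : ℕ, NatureStrategy n),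
        (∀ n, IsEquilibrium n (a n) (γ n)) →
          Tendsto (fun n => regret n (a n) (γ n)) atTop (𝓝 (limitRegret aStar γStar)) ∧
          TendstoInDistribution
            (fun n (ω : Bool × Fin (n + 1)) => (ω.1, a n ω.2)) atTop
            (fun ω => (ω.1, aStar (limitSignal ω)))
            (fun n => playLaw n (γ n)) (limitPlayLaw γStar) ∧
          -- the posterior does not converge to the state in probability
          ∃ ε > 0, ∃ δ > 0, ∀ᶠ n in atTop,
            δ ≤ (playLaw n (γ n)).real {ω | ε ≤ |a n ω.2 - stateValue ω.1|} := by
  obtain ⟨w, x, h⟩ := exists_isSaddle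
  refine ⟨bayesRule w x, h.prior, h.isLimitEquilibrium, ?_, ?_, h.not_ae_eq_const, ?_⟩
  · rw [h.limitRegret_eq]
    exact h.value_pos
  · exact Eventually.of_forall fun ω => bayesRule_mem h.mem x _
  · intro a γ heq
    refine ⟨?_, h.tendstoInDistribution heq, h.not_learning heq⟩
    rw [h.limitRegret_eq]
    exact h.tendsto_value heq
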